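/- Let $c$ be real edge lengths of the complete DAG on the integer interval $[s:N]$ (edges $(i,j)$, $s\le i<j\le N$), $1\le s<N$, with the Monge property $c(i_1,j_2)+c(i_2,j_1)\le c(i_1,j_1)+c(i_2,j_2)$ for all edges $(i_1,j_1),(i_2,j_2)$ with $i_1<i_2$, $j_2<j_1$. Let $f_s(m,n)$ be the minimum length of an $m$-link $s$-$n$ path, $\delta_s(m,n)=f_s(m+1,n)-f_s(m,n)$, and $\Lambda_s(M,N)=[\delta_s(M-1,N),\delta_s(M,N)]$. For $\lambda\in\mathbb R$ let $d_s^{\min}(\lambda,N)$ and $d_s^{\max}(\lambda,N)$ be the least and greatest number of links of a shortest $s$-$N$ path (over all numbers of links) when every edge length is decreased by $\lambda$. Let $4\le M\le N-s-1$ and $2\le m\le M-2$. The $m$-probe $r$ is the least $r\in[s+m+1:N-M+m]$ with $\delta_s(m,r)\le\delta_s(M,N)$; it exists. The procedure $\mathrm{Probe}(s,m)$ works with arrays $f,\bar f,h$, and has three phases. 1. *Exponential search.* Start with $n'=s+m$, $n''=N-M+m$, $l=1$. Repeat: put $n=\min(n'+l,n'')$; compute $f(j)=f_s(m,j)$ for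 $s+m\le j\le n$ and $\bar f(j)=f_s(m+1,j)$ for $s+m+1\le j\le n$ by the dynamic program over the link numbers $k=1,\dots,m+1$ that for each $k\ge2$ computes $f_s(k,j)=\min_{s+k-1\le i<j}[f_s(k-1,i)+c(i,j)]$, for $s+k\le j\le n-m+k$ if $k\le m$ and for $s+m+1\le j\le n$ if $k=m+1$, by one call of a linear-time row-minima routine (SMAWK); put $\lambda=\bar f(n)-f(n)$ and $M'=d_s^{\min}(\lambda,N)$; if $M'=M$, return $\lambda$; if $M'>M$, put $n'=n$ and double $l$; if $M'<M$, put $n''=n$ and leave the loop. 2. *Binary search.* While $n''-n'>1$, put $n=\lceil(n'+n'')/2\rceil$, $\lambda=\bar f(n)-f(n)$, $M'=d_s^{\min}(\lambda,N)$; if $M'=M$, return $\lambda$; if $M'>M$, put $n'=n$, else $n''=n$. Then $r=n''$; put $\lambda=\bar f(r)-f(r)$, and if $d_s^{\max}(\lambda,N)\ge M$, return $\lambda$. 3. *Contraction.* Compute $h(j)=\min_{s+m\le i<r}[f(i)+c(i,j)]$ for $r\le j\le N$ by one call of the row-minima routine; replace $s$ by $r-1$ and $M$ by $M-m$. **Lemma.**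 On a real RAM with unit-cost access to the edge lengths (additions, subtractions and comparisons of reals; integers and array indices $O(N)$), there are linear-time, linear-space subroutines for the row minima and for $d_s^{\min}(\lambda,N)$, $d_s^{\max}(\lambda,N)$ with which, for all inputs as above, $\mathrm{Probe}(s,m)$ halts within $$O\bigl(m(r-s-m+1)+(N-s+1)\log_2(r-s-m+1)\bigr)$$ time and $O(N)$ space, with absolute constants, where $s$ and $M$ in the bounds are the input values. It either returns some $\lambda=\delta_s(m,n)\in\Lambda_s(M,N)$ with $n\in[s+m+1:N-M+m]$; or no such $n$ exists, and it ends with $s$ replaced by $r-1$, $M$ by $M-m$, and with $h(j)=\min_{s+m\le i<r}[f_s(m,i)+c(i,j)]$ for all $j\in[r:N]$. -/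

import Mathlib

namespace MongeProbe

/-! ### Monge DAGs, shortest paths and the probe

The complete DAG on the integer interval `[s:N]` has the edges `(i, j)` with `s ≤ i < j ≤ N`. Its
edge lengths are given by `c : ℕ → ℕ → ℝ`; values of `c` off the edge lattice are irrelevant. -/

/-- Submodularity of a function on a set of integer pairs. -/
def SubmodularOn (L : Set (ℕ × ℕ)) (ρ : ℕ → ℕ → ℝ) : Prop :=
  ∀ i₁ j₁ i₂ j₂ : ℕ, (i₁, j₁) ∈ L → (i₂, j₂) ∈ L → i₁ < i₂ → j₂ < j₁ →
    ρ i₁ j₂ + ρ i₂ j₁ ≤ ρ i₁ j₁ + ρ i₂ j₂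

/-- The edge lattice of the complete DAG on `[s:N]`. -/
def edgeLattice (s N : ℕ) : Set (ℕ × ℕ) := {e | s ≤ e.1 ∧ e.1 < e.2 ∧ e.2 ≤ N}

/-- `c` makes the complete DAG on `[s:N]` a Monge DAG. -/
def IsMongeDAG (s N : ℕ) (c : ℕ → ℕ → ℝ) : Prop :=
  s < N ∧ SubmodularOn (edgeLattice s N) c

/-- `v 0, …, v m` is an `m`-link `s`-`n` path (the values of `v` beyond `m` are irrelevant). -/
def IsPath (s n m : ℕ) (v : ℕ → ℕ) : Prop :=
  v 0 = s ∧ v m = n ∧ ∀ i < m, v i < v (i + 1)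

/-- The length of the `m`-link path `v`. -/
def pathLength (c : ℕ → ℕ → ℝ) (m : ℕ) (v : ℕ → ℕ) : ℝ :=
  ∑ i ∈ Finset.range m, c (v i) (v (i + 1))

/-- `f_s(m,n)`: the minimum length of the `m`-link `s`-`n` paths (they exist, and are finite in
number up to irrelevant values, when `1 ≤ m ≤ n - s`). -/
noncomputable def minLength (c : ℕ → ℕ → ℝ) (s m n : ℕ) : ℝ :=
  sInf {x | ∃ v, IsPath s n m v ∧ pathLength c m v = x}

/-- `δ_s(m,n) = f_s(m+1,n) - f_s(m,n)`. -/
noncomputable def delta (c : ℕ → ℕ → ℝ) (s m n : ℕ) : ℝ :=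
  minLength c s (m + 1) n - minLength c s m n

/-- `Λ_s(m,n) = [δ_s(m-1,n), δ_s(m,n)]`; only used for `2 ≤ m < n - s`, where both ends are
finite. -/
noncomputable def Lam (c : ℕ → ℕ → ℝ) (s m n : ℕ) : Set ℝ :=
  Set.Icc (delta c s (m - 1) n) (delta c s m n)

/-- The edge lengths of `G_s(lam)`. -/
def shift (c : ℕ → ℕ → ℝ) (lam : ℝ) : ℕ → ℕ → ℝ := fun i j => c i j - lam

/-- `D_s(n)`: the set of the numbers of links of all shortest `s`-`n` paths. -/
def linkCounts (c : ℕ → ℕ → ℝ) (s n : ℕ) : Set ℕ :=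
  {m | ∃ v, IsPath s n m v ∧
    ∀ m' v', IsPath s n m' v' → pathLength c m v ≤ pathLength c m' v'}

/-- `d_s^min(lam,n)`. -/
noncomputable def dMin (c : ℕ → ℕ → ℝ) (s : ℕ) (lam : ℝ) (n : ℕ) : ℕ :=
  sInf (linkCounts (shift c lam) s n)

/-- `d_s^max(lam,n)`. -/
noncomputable def dMax (c : ℕ → ℕ → ℝ) (s : ℕ) (lam : ℝ) (n : ℕ) : ℕ :=
  sSup (linkCounts (shift c lam) s n)

/-- `r` is the `m`-probe: the least `r ∈ [s+m+1 : N-M+m]` with `δ_s(m,r) ≤ δ_s(M,N)`. -/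
def IsProbe (c : ℕ → ℕ → ℝ) (s N M m r : ℕ) : Prop :=
  IsLeast {n | n ∈ Set.Icc (s + m + 1) (N - M + m) ∧ delta c s m n ≤ delta c s M N} r

/-- The edge lengths of the contraction `G_{r-1}`: the edge `(r-1, j)` gets the length
`h(j) = min_{s+m ≤ i < r} (f_s(m,i) + c(i,j))`, the others keep their length. -/
noncomputable def contraction (c : ℕ → ℕ → ℝ) (s m r : ℕ) : ℕ → ℕ → ℝ := fun i j =>
  if i = r - 1 then sInf ((fun i' => minLength c s m i' + c i' j) '' Set.Ico (s + m) r) else c i j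

/-! ### The machine: a structured real RAM

Integer variables and arrays hold natural numbers, real variables and arrays hold reals.
Each arithmetic operation, memory access, edge-length evaluation, comparison and control step has
unit cost. The capacity `B` bounds both the indices of all arrays and all integers that are
computed. Only addition and subtraction are available on reals. -/

/-- Integer variables: those of the procedure and arbitrarily many scratch variables. -/
inductive IVar
  | s | N | M | m | r | n | n₁ | n₂ | l | k | j | a | b | lo | hi | d | hit | go
  | tmp (i : ℕ)
  deriving DecidableEq

/-- Real variables. -/
inductive RVar
  | lam
  | tmp (i : ℕ)
  deriving DecidableEq

/-- Real arrays. -/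
inductive RArr
  | f | fbar | h
  | tmp (i : ℕ)
  deriving DecidableEq

/-- Integer arrays (all scratch). -/
inductive IArr
  | tmp (i : ℕ)
  deriving DecidableEq

/-- The contents of the memory. -/
structure State where
  iv : IVar → ℕ
  rv : RVar → ℝ
  ia : IArr → ℕ → ℕ
  ra : RArr → ℕ → ℝ

/-- Integer expressions. -/
inductive IExp
  | const (n : ℕ)
  | var (x : IVar)
  | get (A : IArr) (i : IExp)
  | add (e₁ e₂ : IExp)
  | sub (e₁ e₂ : IExp)
  | half (e : IExp)

/-- Real expressions; `edge i j` evaluates the edge length `c i j`. -/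
inductive RExp
  | zero
  | var (x : RVar)
  | get (A : RArr) (i : IExp)
  | edge (i j : IExp)
  | add (e₁ e₂ : RExp)
  | sub (e₁ e₂ : RExp)

/-- Conditions. -/
inductive BExp
  | ieq (e₁ e₂ : IExp)
  | ilt (e₁ e₂ : IExp)
  | ile (e₁ e₂ : IExp)
  | rlt (e₁ e₂ : RExp)
  | rle (e₁ e₂ : RExp)
  | not (b : BExp)
  | and (b₁ b₂ : BExp)
  | or (b₁ b₂ : BExp)

/-- Programs. -/
inductive Cmd
  | skip
  | iset (x : IVar) (e : IExp)
  | rset (x : RVar) (e : RExp)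
  | iput (A : IArr) (i e : IExp)
  | rput (A : RArr) (i : IExp) (e : RExp)
  | seq (p q : Cmd)
  | cond (b : BExp) (p q : Cmd)
  | loop (b : BExp) (p : Cmd)

instance : Coe IVar IExp := ⟨IExp.var⟩
instance (n : ℕ) : OfNat IExp n := ⟨IExp.const n⟩
instance : Add IExp := ⟨IExp.add⟩
instance : Sub IExp := ⟨IExp.sub⟩
instance : Sub RExp := ⟨RExp.sub⟩

/-- The value of an integer expression (subtraction is truncated at `0`). -/
def IExp.eval (σ : State) : IExp → ℕ
  | .const n => n
  | .var x => σ.iv x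
  | .get A i => σ.ia A (i.eval σ)
  | .add e₁ e₂ => e₁.eval σ + e₂.eval σ
  | .sub e₁ e₂ => e₁.eval σ - e₂.eval σ
  | .half e => e.eval σ / 2

/-- The evaluation of the expression respects the capacity `B`. -/
def IExp.Fits (B : ℕ) (σ : State) : IExp → Prop
  | .const n => n ≤ B
  | .var _ => True
  | .get _ i => i.Fits B σ ∧ i.eval σ ≤ B
  | .add e₁ e₂ => e₁.Fits B σ ∧ e₂.Fits B σ ∧ e₁.eval σ + e₂.eval σ ≤ B
  | .sub e₁ e₂ => e₁.Fits B σ ∧ e₂.Fits B σ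
  | .half e => e.Fits B σ

/-- The number of unit-cost operations in an integer expression. -/
def IExp.cost : IExp → ℕ
  | .const _ => 1
  | .var _ => 1
  | .get _ i => i.cost + 1
  | .add e₁ e₂ => e₁.cost + e₂.cost + 1
  | .sub e₁ e₂ => e₁.cost + e₂.cost + 1
  | .half e => e.cost + 1

noncomputable def RExp.eval (c : ℕ → ℕ → ℝ) (σ : State) : RExp → ℝ
  | .zero => 0
  | .var x => σ.rv x
  | .get A i => σ.ra A (i.eval σ)
  | .edge i j => c (i.eval σ) (j.eval σ)
  | .add e₁ e₂ => e₁.eval c σ + e₂.eval c σ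
  | .sub e₁ e₂ => e₁.eval c σ - e₂.eval c σ

def RExp.Fits (B : ℕ) (σ : State) : RExp → Prop
  | .zero => True
  | .var _ => True
  | .get _ i => i.Fits B σ ∧ i.eval σ ≤ B
  | .edge i j => i.Fits B σ ∧ j.Fits B σ
  | .add e₁ e₂ => e₁.Fits B σ ∧ e₂.Fits B σ
  | .sub e₁ e₂ => e₁.Fits B σ ∧ e₂.Fits B σ

def RExp.cost : RExp → ℕ
  | .zero => 1
  | .var _ => 1
  | .get _ i => i.cost + 1
  | .edge i j => i.cost + j.cost + 1
  | .add e₁ e₂ => e₁.cost + e₂.cost + 1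
  | .sub e₁ e₂ => e₁.cost + e₂.cost + 1

def BExp.Holds (c : ℕ → ℕ → ℝ) (σ : State) : BExp → Prop
  | .ieq e₁ e₂ => e₁.eval σ = e₂.eval σ
  | .ilt e₁ e₂ => e₁.eval σ < e₂.eval σ
  | .ile e₁ e₂ => e₁.eval σ ≤ e₂.eval σ
  | .rlt e₁ e₂ => e₁.eval c σ < e₂.eval c σ
  | .rle e₁ e₂ => e₁.eval c σ ≤ e₂.eval c σ
  | .not b => ¬ b.Holds c σ
  | .and b₁ b₂ => b₁.Holds c σ ∧ b₂.Holds c σ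
  | .or b₁ b₂ => b₁.Holds c σ ∨ b₂.Holds c σ

def BExp.Fits (B : ℕ) (σ : State) : BExp → Prop
  | .ieq e₁ e₂ => e₁.Fits B σ ∧ e₂.Fits B σ
  | .ilt e₁ e₂ => e₁.Fits B σ ∧ e₂.Fits B σ
  | .ile e₁ e₂ => e₁.Fits B σ ∧ e₂.Fits B σ
  | .rlt e₁ e₂ => e₁.Fits B σ ∧ e₂.Fits B σ
  | .rle e₁ e₂ => e₁.Fits B σ ∧ e₂.Fits B σ
  | .not b => b.Fits B σ
  | .and b₁ b₂ => b₁.Fits B σ ∧ b₂.Fits B σ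
  | .or b₁ b₂ => b₁.Fits B σ ∧ b₂.Fits B σ

def BExp.cost : BExp → ℕ
  | .ieq e₁ e₂ => e₁.cost + e₂.cost + 1
  | .ilt e₁ e₂ => e₁.cost + e₂.cost + 1
  | .ile e₁ e₂ => e₁.cost + e₂.cost + 1
  | .rlt e₁ e₂ => e₁.cost + e₂.cost + 1
  | .rle e₁ e₂ => e₁.cost + e₂.cost + 1
  | .not b => b.cost + 1
  | .and b₁ b₂ => b₁.cost + b₂.cost + 1
  | .or b₁ b₂ => b₁.cost + b₂.cost + 1

def State.setI (σ : State) (x : IVar) (v : ℕ) : State :=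
  { σ with iv := Function.update σ.iv x v }

def State.setR (σ : State) (x : RVar) (v : ℝ) : State :=
  { σ with rv := Function.update σ.rv x v }

def State.putI (σ : State) (A : IArr) (i v : ℕ) : State :=
  { σ with ia := Function.update σ.ia A (Function.update (σ.ia A) i v) }

def State.putR (σ : State) (A : RArr) (i : ℕ) (v : ℝ) : State :=
  { σ with ra := Function.update σ.ra A (Function.update (σ.ra A) i v) }

/-- `Exec B c p σ t σ'`: on edge lengths `c` and with capacity `B`, the program `p` started in the
memory `σ` halts in the memory `σ'` after exactly `t` unit-cost steps. A run that exceeds the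
capacity has no derivation. -/
inductive Exec (B : ℕ) (c : ℕ → ℕ → ℝ) : Cmd → State → ℕ → State → Prop
  | skip (σ : State) : Exec B c .skip σ 1 σ
  | iset (σ : State) (x : IVar) (e : IExp) (he : e.Fits B σ) :
      Exec B c (.iset x e) σ (e.cost + 1) (σ.setI x (e.eval σ))
  | rset (σ : State) (x : RVar) (e : RExp) (he : e.Fits B σ) :
      Exec B c (.rset x e) σ (e.cost + 1) (σ.setR x (e.eval c σ))
  | iput (σ : State) (A : IArr) (i e : IExp) (hi : i.Fits B σ) (hB : i.eval σ ≤ B)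
      (he : e.Fits B σ) :
      Exec B c (.iput A i e) σ (i.cost + e.cost + 1) (σ.putI A (i.eval σ) (e.eval σ))
  | rput (σ : State) (A : RArr) (i : IExp) (e : RExp) (hi : i.Fits B σ) (hB : i.eval σ ≤ B)
      (he : e.Fits B σ) :
      Exec B c (.rput A i e) σ (i.cost + e.cost + 1) (σ.putR A (i.eval σ) (e.eval c σ))
  | seq {σ σ₁ σ₂ : State} {p q : Cmd} {t₁ t₂ : ℕ} (hp : Exec B c p σ t₁ σ₁)
      (hq : Exec B c q σ₁ t₂ σ₂) : Exec B c (.seq p q) σ (t₁ + t₂) σ₂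
  | condTrue {σ σ₁ : State} {b : BExp} {p q : Cmd} {t : ℕ} (hf : b.Fits B σ) (hb : b.Holds c σ)
      (hp : Exec B c p σ t σ₁) : Exec B c (.cond b p q) σ (b.cost + 1 + t) σ₁
  | condFalse {σ σ₁ : State} {b : BExp} {p q : Cmd} {t : ℕ} (hf : b.Fits B σ)
      (hb : ¬ b.Holds c σ) (hq : Exec B c q σ t σ₁) :
      Exec B c (.cond b p q) σ (b.cost + 1 + t) σ₁
  | loopTrue {σ σ₁ σ₂ : State} {b : BExp} {p : Cmd} {t₁ t₂ : ℕ} (hf : b.Fits B σ)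
      (hb : b.Holds c σ) (hp : Exec B c p σ t₁ σ₁) (hl : Exec B c (.loop b p) σ₁ t₂ σ₂) :
      Exec B c (.loop b p) σ (b.cost + 1 + t₁ + t₂) σ₂
  | loopFalse {σ : State} {b : BExp} {p : Cmd} (hf : b.Fits B σ) (hb : ¬ b.Holds c σ) :
      Exec B c (.loop b p) σ (b.cost + 1) σ

/-- Names of memory regions: a variable occupies one cell, an array the cells `0, …, B`. -/
inductive Region
  | iv (x : IVar)
  | rv (x : RVar)
  | ia (A : IArr)
  | ra (A : RArr)
  deriving DecidableEq

def Region.cells (B : ℕ) : Region → ℕ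
  | .iv _ => 1
  | .rv _ => 1
  | .ia _ => B + 1
  | .ra _ => B + 1

def IExp.regions : IExp → Finset Region
  | .const _ => ∅
  | .var x => {.iv x}
  | .get A i => insert (.ia A) i.regions
  | .add e₁ e₂ => e₁.regions ∪ e₂.regions
  | .sub e₁ e₂ => e₁.regions ∪ e₂.regions
  | .half e => e.regions

def RExp.regions : RExp → Finset Region
  | .zero => ∅
  | .var x => {.rv x}
  | .get A i => insert (.ra A) i.regions
  | .edge i j => i.regions ∪ j.regions
  | .add e₁ e₂ => e₁.regions ∪ e₂.regions
  | .sub e₁ e₂ => e₁.regions ∪ e₂.regions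

def BExp.regions : BExp → Finset Region
  | .ieq e₁ e₂ => e₁.regions ∪ e₂.regions
  | .ilt e₁ e₂ => e₁.regions ∪ e₂.regions
  | .ile e₁ e₂ => e₁.regions ∪ e₂.regions
  | .rlt e₁ e₂ => e₁.regions ∪ e₂.regions
  | .rle e₁ e₂ => e₁.regions ∪ e₂.regions
  | .not b => b.regions
  | .and b₁ b₂ => b₁.regions ∪ b₂.regions
  | .or b₁ b₂ => b₁.regions ∪ b₂.regions

def Cmd.regions : Cmd → Finset Region
  | .skip => ∅
  | .iset x e => insert (.iv x) e.regions
  | .rset x e => insert (.rv x) e.regions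
  | .iput A i e => insert (.ia A) (i.regions ∪ e.regions)
  | .rput A i e => insert (.ra A) (i.regions ∪ e.regions)
  | .seq p q => p.regions ∪ q.regions
  | .cond b p q => b.regions ∪ p.regions ∪ q.regions
  | .loop b p => b.regions ∪ p.regions

/-- The space of a program with capacity `B`: the number of memory cells it can ever address. -/
def Cmd.space (p : Cmd) (B : ℕ) : ℕ := ∑ x ∈ p.regions, x.cells B

/-! ### The procedure -/

/-- Sequential composition of a list of commands. -/
def block : List Cmd → Cmd
  | [] => .skip
  | p :: ps => .seq p (block ps)

/-- `for j = lo to hi do p`. -/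
def forJ (lo hi : IExp) (p : Cmd) : Cmd :=
  block [.iset .j lo, .loop (.ile IVar.j hi) (block [p, .iset .j (IVar.j + 1)])]

/-- The subroutines that the procedure calls: `rowMin out` computes row minima of a submodular
array into `out`, and `dMin`, `dMax` compute `d_s^min(lam,N)`, `d_s^max(lam,N)`. -/
structure Subroutines where
  rowMin : RArr → Cmd
  dMin : Cmd
  dMax : Cmd

open IVar in
/-- The dynamic programming `PBF(s,m,n)`. -/
def pbf (R : Subroutines) : Cmd := block [
  forJ (s + 1) (n - m + 1) (.rput .f j (.edge s j)),
  .iset k 2,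
  .loop (.ile k m) (block [
    .iset a (s + k - 1), .iset b (n - m + k - 1), .iset lo (s + k), .iset hi (n - m + k),
    R.rowMin .fbar,
    forJ (s + k) (n - m + k) (.rput .f j (.get .fbar j)),
    .iset k (k + 1)]),
  .iset a (s + m), .iset b (n - 1), .iset lo (s + m + 1), .iset hi n,
  R.rowMin .fbar]

open IVar in
/-- The exponential search. Returning `lam` is modelled by `hit := 1`. -/
def expSearch (R : Subroutines) : Cmd := block [
  .iset n₁ (s + m), .iset n₂ (N - M + m), .iset l 1, .iset hit 0, .iset go 1,
  .loop (.ieq go 1) (block [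
    .iset n (n₁ + l), .cond (.ilt n₂ n) (.iset n n₂) .skip,
    pbf R,
    .rset .lam (.get .fbar n - .get .f n),
    R.dMin,
    .cond (.ieq d M) (block [.iset hit 1, .iset go 0])
      (.cond (.ilt M d) (block [.iset n₁ n, .iset l (l + l)]) (.iset go 0))]),
  .iset n₂ n]

open IVar in
/-- The binary search, with the midpoint `⌈(n₁ + n₂) / 2⌉`. -/
def binSearch (R : Subroutines) : Cmd :=
  .loop (.and (.ieq hit 0) (.ilt (n₁ + 1) n₂)) (block [
    .iset n (.half (n₁ + n₂ + 1)),
    .rset .lam (.get .fbar n - .get .f n),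
    R.dMin,
    .cond (.ieq d M) (.iset hit 1)
      (.cond (.ilt M d) (.iset n₁ n) (.iset n₂ n))])

open IVar in
/-- The final test of the binary search. -/
def finalTest (R : Subroutines) : Cmd := block [
  .iset r n₂,
  .rset .lam (.get .fbar r - .get .f r),
  R.dMax,
  .cond (.ile M d) (.iset hit 1) .skip]

open IVar in
/-- The contraction. -/
def contractPhase (R : Subroutines) : Cmd := block [
  .iset a (s + m), .iset b (r - 1), .iset lo r, .iset hi N,
  R.rowMin .h,
  .iset s (r - 1), .iset M (M - m)]

/-- `Probe(s,m)`: exponential search, binary search, contraction. -/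
def probe (R : Subroutines) : Cmd := block [
  expSearch R,
  binSearch R,
  .cond (.ieq IVar.hit 0) (finalTest R) .skip,
  .cond (.ieq IVar.hit 0) (contractPhase R) .skip]

/-! ### What the subroutines have to do -/

def IVar.IsTmp : IVar → Prop
  | .tmp _ => True
  | _ => False

def RArr.IsTmp : RArr → Prop
  | .tmp _ => True
  | _ => False

/-- Apart from scratch memory, only the integer variables in `X` and the real arrays in `Y` may
differ. -/
def Frame (X : Set IVar) (Y : Set RArr) (σ σ' : State) : Prop :=
  (∀ x, ¬ x.IsTmp → x ∉ X → σ'.iv x = σ.iv x) ∧ σ'.rv .lam = σ.rv .lam ∧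
    ∀ A, ¬ A.IsTmp → A ∉ Y → σ'.ra A = σ.ra A

/-- `rowMin out` computes `out(j) = min {f(i) + c(i,j) : a ≤ i ≤ b, i < j}` for all
`j ∈ [lo:hi]` on a Monge DAG on `[s:N]`, in time linear in the numbers of rows and columns. -/
def RowMinCorrect (K : ℕ) (out : RArr) (p : Cmd) : Prop :=
  ∀ (B : ℕ) (c : ℕ → ℕ → ℝ) (σ : State), IsMongeDAG (σ.iv .s) (σ.iv .N) c → K * σ.iv .N ≤ B →
    σ.iv .s ≤ σ.iv .a → σ.iv .a ≤ σ.iv .b → σ.iv .b ≤ σ.iv .N →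
    σ.iv .a < σ.iv .lo → σ.iv .lo ≤ σ.iv .hi → σ.iv .hi ≤ σ.iv .N →
    ∃ t σ', Exec B c p σ t σ' ∧
      t ≤ K * ((σ.iv .b - σ.iv .a + 1) + (σ.iv .hi - σ.iv .lo + 1)) ∧
      Frame ∅ {out} σ σ' ∧
      ∀ j ∈ Set.Icc (σ.iv .lo) (σ.iv .hi),
        IsLeast ((fun i => σ.ra .f i + c i j) '' {i | σ.iv .a ≤ i ∧ i ≤ σ.iv .b ∧ i < j})
          (σ'.ra out j)

/-- `p` stores `g c s lam N` in the variable `d`, on any Monge DAG on `[s:N]`, in linear time. -/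
def DepthCorrect (K : ℕ) (g : (ℕ → ℕ → ℝ) → ℕ → ℝ → ℕ → ℕ) (p : Cmd) : Prop :=
  ∀ (B : ℕ) (c : ℕ → ℕ → ℝ) (σ : State), IsMongeDAG (σ.iv .s) (σ.iv .N) c → K * σ.iv .N ≤ B →
    ∃ t σ', Exec B c p σ t σ' ∧ t ≤ K * (σ.iv .N - σ.iv .s + 1) ∧
      Frame {.d} ∅ σ σ' ∧ σ'.iv .d = g c (σ.iv .s) (σ.rv .lam) (σ.iv .N)

/-- The subroutines are correct and run in linear time and space. -/
structure Subroutines.Correct (R : Subroutines) (K : ℕ) : Prop where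
  rowMin_fbar : RowMinCorrect K .fbar (R.rowMin .fbar)
  rowMin_h : RowMinCorrect K .h (R.rowMin .h)
  dMin : DepthCorrect K MongeProbe.dMin R.dMin
  dMax : DepthCorrect K MongeProbe.dMax R.dMax

/-- The memory holds the input `s, N, M, m`; all else is arbitrary. -/
def IsInput (s N M m : ℕ) (σ : State) : Prop :=
  σ.iv .s = s ∧ σ.iv .N = N ∧ σ.iv .M = M ∧ σ.iv .m = m

/-- The outcome. Either `lam` is a sample `δ_s(m,n)` that lies in `Λ_s(M,N)`; or there is no such
sample, `h` holds the new lengths of the edges out of `r-1` in the contraction, and `s` and `M`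
have been updated. -/
def HitOrContract (c : ℕ → ℕ → ℝ) (s N M m r : ℕ) (σ : State) : Prop :=
  (σ.iv .hit = 1 ∧ σ.rv .lam ∈ Lam c s M N ∧
    ∃ n ∈ Set.Icc (s + m + 1) (N - M + m), σ.rv .lam = delta c s m n) ∨
  (σ.iv .hit = 0 ∧ (∀ n ∈ Set.Icc (s + m + 1) (N - M + m), delta c s m n ∉ Lam c s M N) ∧
    σ.iv .s = r - 1 ∧ σ.iv .M = M - m ∧
    ∀ j ∈ Set.Icc r N, σ.ra .h j = contraction c s m r (r - 1) j)

end MongeProbe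

open MongeProbe

/-! The combinatorial core is one exchange argument, `minLength_exchange`. Take a path with `p`
links and one with `q < p` links from the same start, with suitable ends. Some edge of the second
path encloses an edge of the first. Swapping the tails there moves one link from the first path to
the second, and by the Monge inequality the total length does not grow. Hence `delta` is
nondecreasing in the number of links, nonincreasing in the end node, and nondecreasing along
diagonals (`delta_mono_links`, `delta_anti_end`, `delta_diag_le`). The diagonal inequality shows
that the probe exists.

Since the length is convex in the number of links, the extreme link numbers for a given `lam` tell
where `lam` lies relative to the interval `Lam`. If `dMin` equals `M`, then `lam` is in it; if
`dMin` is larger, then `lam` exceeds its right end; if `dMin` is smaller, then `lam` is at most its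
left end. The samples `delta c s m n` do not increase with `n`, so the last two outcomes put `n`
before the probe `r`, or at or beyond it. This justifies both searches. A sample in `Lam` can only
occur at a node `n ≥ r`, where it is at most the sample at `r`; so a single comparison of `dMax`
with `M` at `r` decides whether there is one.

The subroutines are explicit programs. Row minima are found by SMAWK without recursion: the row
lists of all levels lie one after the other in one array, the column stride doubles from level to
level, and the columns in between are filled in on the way back (`reducePhase_runs`,
`interpPhase_runs`, `smawk_runs`). The extreme link numbers come from an online shortest path
computation that calls SMAWK on batches (`lwsRound_runs`, `depthProg_runs`). Lengths are paired
lexicographically with signed link numbers, which preserves total monotonicity (`totMono_key`) and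
makes ties resolve towards few or many links.

Running times are proved by potentials: every loop invariant carries the budget that is left. The
table costs of the exponential search form a geometric sum bounded by a multiple of `m * (r - s -
m)`, and the number of calls of `dMin` is logarithmic in `r - s - m` (`expSearch_runs`,
`binSearch_runs`). -/

namespace MongeProbe

/-! ### A program logic with running times -/

/-- `p` halts from `σ`, and its running time and its final memory satisfy `Q`. -/
def Runs (B : ℕ) (c : ℕ → ℕ → ℝ) (p : Cmd) (σ : State) (Q : ℕ → State → Prop) : Prop :=
  ∃ t σ', Exec B c p σ t σ' ∧ Q t σ'

variable {B : ℕ} {c : ℕ → ℕ → ℝ} {p q : Cmd} {σ : State} {Q Q' : ℕ → State → Prop}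

theorem Runs.mono (h : Runs B c p σ Q) (hQ : ∀ t σ', Q t σ' → Q' t σ') : Runs B c p σ Q' := by
  obtain ⟨t, σ', he, hq⟩ := h
  exact ⟨t, σ', he, hQ _ _ hq⟩

theorem Runs.skip (h : Q 1 σ) : Runs B c .skip σ Q := ⟨_, _, .skip _, h⟩

theorem Runs.iset {x : IVar} {e : IExp} (he : e.Fits B σ)
    (h : Q (e.cost + 1) (σ.setI x (e.eval σ))) : Runs B c (.iset x e) σ Q :=
  ⟨_, _, .iset _ _ _ he, h⟩

theorem Runs.rset {x : RVar} {e : RExp} (he : e.Fits B σ)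
    (h : Q (e.cost + 1) (σ.setR x (e.eval c σ))) : Runs B c (.rset x e) σ Q :=
  ⟨_, _, .rset _ _ _ he, h⟩

theorem Runs.iput {A : IArr} {i e : IExp} (hi : i.Fits B σ) (hB : i.eval σ ≤ B) (he : e.Fits B σ)
    (h : Q (i.cost + e.cost + 1) (σ.putI A (i.eval σ) (e.eval σ))) : Runs B c (.iput A i e) σ Q :=
  ⟨_, _, .iput _ _ _ _ hi hB he, h⟩

theorem Runs.rput {A : RArr} {i : IExp} {e : RExp} (hi : i.Fits B σ) (hB : i.eval σ ≤ B)
    (he : e.Fits B σ)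
    (h : Q (i.cost + e.cost + 1) (σ.putR A (i.eval σ) (e.eval c σ))) :
    Runs B c (.rput A i e) σ Q :=
  ⟨_, _, .rput _ _ _ _ hi hB he, h⟩

theorem Runs.seq (h : Runs B c p σ fun t σ₁ => Runs B c q σ₁ fun t' σ₂ => Q (t + t') σ₂) :
    Runs B c (.seq p q) σ Q := by
  obtain ⟨t, σ₁, h₁, t', σ₂, h₂, hQ⟩ := h
  exact ⟨_, _, .seq h₁ h₂, hQ⟩

theorem Runs.cond {b : BExp} (hf : b.Fits B σ)
    (h₁ : b.Holds c σ → Runs B c p σ fun t σ' => Q (b.cost + 1 + t) σ')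
    (h₂ : ¬ b.Holds c σ → Runs B c q σ fun t σ' => Q (b.cost + 1 + t) σ') :
    Runs B c (.cond b p q) σ Q := by
  by_cases hb : b.Holds c σ
  · obtain ⟨t, σ', he, hq⟩ := h₁ hb
    exact ⟨_, _, .condTrue hf hb he, hq⟩
  · obtain ⟨t, σ', he, hq⟩ := h₂ hb
    exact ⟨_, _, .condFalse hf hb he, hq⟩

/-- Loops are verified with an invariant `I σ φ`, where `φ` is the budget that is left. -/
theorem Runs.loop {b : BExp} (I : State → ℕ → Prop) {φ : ℕ} (h₀ : I σ φ)
    (hf : ∀ σ φ, I σ φ → b.Fits B σ)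
    (hs : ∀ σ φ, I σ φ → b.Holds c σ → Runs B c p σ fun t σ' =>
      ∃ φ', I σ' φ' ∧ b.cost + 1 + t + φ' ≤ φ)
    (hQ : ∀ σ' φ' t, I σ' φ' → ¬ b.Holds c σ' → t + φ' ≤ φ + (b.cost + 1) → Q t σ') :
    Runs B c (.loop b p) σ Q := by
  -- Testing the guard costs at least one step, so the budget strictly decreases with every
  -- iteration. Induction on it gives termination and the time bound at once.
  induction φ using Nat.strong_induction_on generalizing σ Q with
  | _ φ ih =>
    by_cases hb : b.Holds c σ
    · obtain ⟨t, σ₁, he, φ', hI, hle⟩ := hs σ φ h₀ hb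
      obtain ⟨t', σ₂, he', hq⟩ := ih φ' (by omega) (σ := σ₁)
        (Q := fun t' σ₂ => Q (b.cost + 1 + t + t') σ₂) hI (by
          intro σ' φ'' t' hI' hb' ht'
          exact hQ _ φ'' _ hI' hb' (by omega))
      exact ⟨_, _, .loopTrue (hf _ _ h₀) hb he he', hq⟩
    · exact ⟨_, _, .loopFalse (hf _ _ h₀) hb, hQ _ φ _ h₀ hb (by omega)⟩

/-- The memory regions that a program may write to. -/
def Cmd.writes : Cmd → List Region
  | .skip => []
  | .iset x _ => [.iv x]
  | .rset x _ => [.rv x]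
  | .iput A _ _ => [.ia A]
  | .rput A _ _ => [.ra A]
  | .seq p q => p.writes ++ q.writes
  | .cond _ p q => p.writes ++ q.writes
  | .loop _ p => p.writes

/-- Outside the regions in `l` the memories `σ` and `σ'` agree. -/
structure AgreeOff (l : List Region) (σ σ' : State) : Prop where
  iv : ∀ x, Region.iv x ∉ l → σ'.iv x = σ.iv x
  rv : ∀ x, Region.rv x ∉ l → σ'.rv x = σ.rv x
  ia : ∀ x, Region.ia x ∉ l → σ'.ia x = σ.ia x
  ra : ∀ x, Region.ra x ∉ l → σ'.ra x = σ.ra x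

section
variable {l : List Region} {σ₁ σ₂ : State} (h : AgreeOff l σ₁ σ₂)
include h

/-- For a concrete program the list of written regions evaluates, so the side condition is
discharged by computation. -/
theorem AgreeOff.iv_eq (x : IVar) (hx : decide (Region.iv x ∉ l) = true := by rfl) :
    σ₂.iv x = σ₁.iv x := h.iv x (of_decide_eq_true hx)

theorem AgreeOff.rv_eq (x : RVar) (hx : decide (Region.rv x ∉ l) = true := by rfl) :
    σ₂.rv x = σ₁.rv x := h.rv x (of_decide_eq_true hx)

theorem AgreeOff.ia_eq (x : IArr) (hx : decide (Region.ia x ∉ l) = true := by rfl) :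
    σ₂.ia x = σ₁.ia x := h.ia x (of_decide_eq_true hx)

theorem AgreeOff.ra_eq (x : RArr) (hx : decide (Region.ra x ∉ l) = true := by rfl) :
    σ₂.ra x = σ₁.ra x := h.ra x (of_decide_eq_true hx)

end

theorem AgreeOff.refl (l : List Region) (σ : State) : AgreeOff l σ σ :=
  ⟨fun _ _ => rfl, fun _ _ => rfl, fun _ _ => rfl, fun _ _ => rfl⟩

theorem AgreeOff.trans {l : List Region} {σ₁ σ₂ σ₃ : State} (h : AgreeOff l σ₁ σ₂)
    (h' : AgreeOff l σ₂ σ₃) : AgreeOff l σ₁ σ₃ :=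
  ⟨fun x hx => (h'.iv x hx).trans (h.iv x hx), fun x hx => (h'.rv x hx).trans (h.rv x hx),
    fun x hx => (h'.ia x hx).trans (h.ia x hx), fun x hx => (h'.ra x hx).trans (h.ra x hx)⟩

theorem AgreeOff.mono {l l' : List Region} {σ₁ σ₂ : State} (h : AgreeOff l σ₁ σ₂) (hl : l ⊆ l') :
    AgreeOff l' σ₁ σ₂ :=
  ⟨fun x hx => h.iv x fun h => hx (hl h), fun x hx => h.rv x fun h => hx (hl h),
    fun x hx => h.ia x fun h => hx (hl h), fun x hx => h.ra x fun h => hx (hl h)⟩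

theorem Exec.agreeOff {t : ℕ} {σ' : State} (h : Exec B c p σ t σ') : AgreeOff p.writes σ σ' := by
  induction h with
  | skip σ => exact .refl _ _
  | iset σ x e he =>
    refine ⟨fun y hy => ?_, fun _ _ => rfl, fun _ _ => rfl, fun _ _ => rfl⟩
    exact Function.update_of_ne (by rintro rfl; simp [Cmd.writes] at hy) _ _
  | rset σ x e he =>
    refine ⟨fun _ _ => rfl, fun y hy => ?_, fun _ _ => rfl, fun _ _ => rfl⟩
    exact Function.update_of_ne (by rintro rfl; simp [Cmd.writes] at hy) _ _
  | iput σ x i e =>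
    refine ⟨fun _ _ => rfl, fun _ _ => rfl, fun y hy => ?_, fun _ _ => rfl⟩
    exact Function.update_of_ne (by rintro rfl; simp [Cmd.writes] at hy) _ _
  | rput σ x i e =>
    refine ⟨fun _ _ => rfl, fun _ _ => rfl, fun _ _ => rfl, fun y hy => ?_⟩
    exact Function.update_of_ne (by rintro rfl; simp [Cmd.writes] at hy) _ _
  | seq _ _ h₁ h₂ => exact (h₁.mono (by simp [Cmd.writes])).trans (h₂.mono (by simp [Cmd.writes]))
  | condTrue _ _ _ h => exact h.mono (by simp [Cmd.writes])
  | condFalse _ _ _ h => exact h.mono (by simp [Cmd.writes])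
  | loopTrue _ _ _ _ h₁ h₂ => exact AgreeOff.trans h₁ h₂
  | loopFalse => exact .refl _ _

/-- What a program leaves untouched can be read off its syntax, so specifications need only speak of
what changes. -/
theorem Runs.agree (h : Runs B c p σ Q) :
    Runs B c p σ fun t σ' => Q t σ' ∧ AgreeOff p.writes σ σ' := by
  obtain ⟨t, σ', he, hq⟩ := h
  exact ⟨t, σ', he, hq, he.agreeOff⟩

/-! Reading the memory after a write -/

section Read
variable (σ : State)

@[simp] theorem setI_iv (x y : IVar) (v : ℕ) :
    (σ.setI x v).iv y = if y = x then v else σ.iv y := by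
  simp [State.setI, Function.update_apply]
@[simp] theorem setI_rv (x : IVar) (v : ℕ) : (σ.setI x v).rv = σ.rv := rfl
@[simp] theorem setI_ia (x : IVar) (v : ℕ) : (σ.setI x v).ia = σ.ia := rfl
@[simp] theorem setI_ra (x : IVar) (v : ℕ) : (σ.setI x v).ra = σ.ra := rfl
@[simp] theorem setR_rv (x y : RVar) (v : ℝ) :
    (σ.setR x v).rv y = if y = x then v else σ.rv y := by
  simp [State.setR, Function.update_apply]
@[simp] theorem setR_iv (x : RVar) (v : ℝ) : (σ.setR x v).iv = σ.iv := rfl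
@[simp] theorem setR_ia (x : RVar) (v : ℝ) : (σ.setR x v).ia = σ.ia := rfl
@[simp] theorem setR_ra (x : RVar) (v : ℝ) : (σ.setR x v).ra = σ.ra := rfl
@[simp] theorem putI_ia (A A' : IArr) (i v : ℕ) :
    (σ.putI A i v).ia A' = if A' = A then Function.update (σ.ia A) i v else σ.ia A' := by
  simp [State.putI, Function.update_apply]
@[simp] theorem putI_iv (A : IArr) (i v : ℕ) : (σ.putI A i v).iv = σ.iv := rfl
@[simp] theorem putI_rv (A : IArr) (i v : ℕ) : (σ.putI A i v).rv = σ.rv := rfl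
@[simp] theorem putI_ra (A : IArr) (i v : ℕ) : (σ.putI A i v).ra = σ.ra := rfl
@[simp] theorem putR_ra (A A' : RArr) (i : ℕ) (v : ℝ) :
    (σ.putR A i v).ra A' = if A' = A then Function.update (σ.ra A) i v else σ.ra A' := by
  simp [State.putR, Function.update_apply]
@[simp] theorem putR_iv (A : RArr) (i : ℕ) (v : ℝ) : (σ.putR A i v).iv = σ.iv := rfl
@[simp] theorem putR_rv (A : RArr) (i : ℕ) (v : ℝ) : (σ.putR A i v).rv = σ.rv := rfl
@[simp] theorem putR_ia (A : RArr) (i : ℕ) (v : ℝ) : (σ.putR A i v).ia = σ.ia := rfl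

@[simp] theorem IExp.eval_ofNat (n : ℕ) :
    IExp.eval σ (OfNat.ofNat n : IExp) = (OfNat.ofNat n : ℕ) := rfl
@[simp] theorem IExp.eval_add (e₁ e₂ : IExp) :
    (e₁ + e₂).eval σ = e₁.eval σ + e₂.eval σ := rfl
@[simp] theorem IExp.eval_sub (e₁ e₂ : IExp) :
    (e₁ - e₂).eval σ = e₁.eval σ - e₂.eval σ := rfl
@[simp] theorem IExp.fits_ofNat (n : ℕ) :
    IExp.Fits B σ (OfNat.ofNat n : IExp) ↔ (OfNat.ofNat n : ℕ) ≤ B := Iff.rfl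
@[simp] theorem IExp.fits_add (e₁ e₂ : IExp) :
    (e₁ + e₂).Fits B σ ↔ e₁.Fits B σ ∧ e₂.Fits B σ ∧ e₁.eval σ + e₂.eval σ ≤ B := Iff.rfl
@[simp] theorem IExp.fits_sub (e₁ e₂ : IExp) :
    (e₁ - e₂).Fits B σ ↔ e₁.Fits B σ ∧ e₂.Fits B σ := Iff.rfl
@[simp] theorem RExp.eval_sub (e₁ e₂ : RExp) :
    (e₁ - e₂).eval c σ = e₁.eval c σ - e₂.eval c σ := rfl
@[simp] theorem RExp.fits_sub (e₁ e₂ : RExp) :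
    (e₁ - e₂).Fits B σ ↔ e₁.Fits B σ ∧ e₂.Fits B σ := Iff.rfl
end Read

@[simp] theorem IExp.cost_ofNat (n : ℕ) : IExp.cost (OfNat.ofNat n : IExp) = 1 := rfl
@[simp] theorem IExp.cost_add (e₁ e₂ : IExp) :
    (e₁ + e₂).cost = e₁.cost + e₂.cost + 1 := rfl
@[simp] theorem IExp.cost_sub (e₁ e₂ : IExp) :
    (e₁ - e₂).cost = e₁.cost + e₂.cost + 1 := rfl
@[simp] theorem RExp.cost_sub (e₁ e₂ : RExp) :
    (e₁ - e₂).cost = e₁.cost + e₂.cost + 1 := rfl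

theorem Runs.nil (h : Q 1 σ) : Runs B c (block []) σ Q := .skip h

theorem Runs.cons {ps : List Cmd}
    (h : Runs B c p σ fun t σ₁ => Runs B c (block ps) σ₁ fun t' σ₂ => Q (t + t') σ₂) :
    Runs B c (block (p :: ps)) σ Q := .seq h

/-- The loop rule, where the invariant may use that the body respects its frame. -/
theorem Runs.while {b : BExp} (I : State → ℕ → Prop) (φ : ℕ) (h₀ : I σ φ)
    (hf : ∀ σ' φ, AgreeOff p.writes σ σ' → I σ' φ → b.Fits B σ')
    (hs : ∀ σ' φ, AgreeOff p.writes σ σ' → I σ' φ → b.Holds c σ' → Runs B c p σ' fun t σ'' =>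
      ∃ φ', I σ'' φ' ∧ b.cost + 1 + t + φ' ≤ φ)
    (hQ : ∀ σ' φ' t, AgreeOff p.writes σ σ' → I σ' φ' → ¬ b.Holds c σ' →
      t + φ' ≤ φ + (b.cost + 1) → Q t σ') :
    Runs B c (.loop b p) σ Q :=
  .loop (fun σ' φ => AgreeOff p.writes σ σ' ∧ I σ' φ) ⟨.refl _ _, h₀⟩
    (fun σ' φ h => hf σ' φ h.1 h.2)
    (fun σ' φ h hb => (hs σ' φ h.1 h.2 hb).agree.mono fun _ _ ⟨⟨φ', hI, hle⟩, ha⟩ =>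
      ⟨φ', ⟨h.1.trans ha, hI⟩, hle⟩)
    fun σ' φ' t h hb ht => hQ σ' φ' t h.1 h.2 hb ht

/-- `for x = lo to hi do p`. -/
def forLoop (x : IVar) (lo hi : IExp) (p : Cmd) : Cmd :=
  block [.iset x lo, .loop (.ile x hi) (block [p, .iset x (x + 1)])]

/-- The invariant is required of the memory in which the counter already has its new value. The
counter ends at `H + 1`, which must still fit the capacity. -/
theorem Runs.for {x : IVar} {lo hi : IExp} {L H T : ℕ} (I : ℕ → State → Prop) (hlo : lo.Fits B σ)
    (hL : lo.eval σ = L) (hH : L ≤ H + 1) (h1 : H + 1 ≤ B) (h1B : 1 ≤ B) (h₀ : I L (σ.setI x L))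
    (hh : ∀ i σ', I i σ' → AgreeOff (.iv x :: p.writes) σ σ' → hi.Fits B σ' ∧ hi.eval σ' = H)
    (hs : ∀ i σ', L ≤ i → i ≤ H → σ'.iv x = i → I i σ' → AgreeOff (.iv x :: p.writes) σ σ' →
      Runs B c p σ' fun t σ'' => t ≤ T ∧ σ''.iv x = i ∧ I (i + 1) (σ''.setI x (i + 1)))
    (hQ : ∀ t σ', I (H + 1) σ' → AgreeOff (.iv x :: p.writes) σ σ' →
      t ≤ (T + hi.cost + 8) * (H + 1 - L) + lo.cost + hi.cost + 8 → Q t σ') :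
    Runs B c (forLoop x lo hi p) σ Q := by
  refine .cons (.iset hlo (.cons ?_))
  rw [hL]
  have ag : ∀ σ', AgreeOff (block [p, .iset x (x + 1)]).writes (σ.setI x L) σ' →
      AgreeOff (.iv x :: p.writes) σ σ' := by
    intro σ' h
    refine .trans (?_ : AgreeOff _ σ (σ.setI x L)) (h.mono ?_)
    · refine ⟨fun y hy => ?_, fun _ _ => rfl, fun _ _ => rfl, fun _ _ => rfl⟩
      rw [setI_iv, if_neg]
      rintro rfl
      simp at hy
    · simp [block, Cmd.writes]
  refine .while (fun σ' φ => ∃ i, L ≤ i ∧ i ≤ H + 1 ∧ σ'.iv x = i ∧ I i σ' ∧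
    φ = (T + hi.cost + 8) * (H + 1 - i)) ((T + hi.cost + 8) * (H + 1 - L)) ?_ ?_ ?_ ?_
  · exact ⟨L, le_rfl, hH, by simp, h₀, rfl⟩
  · rintro σ' φ ha ⟨i, h3, h4, h5, h6, -⟩
    exact ⟨trivial, (hh i σ' h6 (ag _ ha)).1⟩
  · rintro σ' φ ha ⟨i, h3, h4, h5, h6, rfl⟩ hb
    have hle : i ≤ H := by
      have : σ'.iv x ≤ hi.eval σ' := hb
      rwa [h5, (hh i σ' h6 (ag _ ha)).2] at this
    refine .cons ((hs i σ' h3 hle h5 h6 (ag _ ha)).mono ?_)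
    rintro t σ'' ⟨ht, hx, hI⟩
    refine .cons (.iset ⟨trivial, h1B, ?_⟩ (.nil ⟨(T + hi.cost + 8) * (H + 1 - (i + 1)),
      ⟨i + 1, by omega, by omega, ?_, ?_, rfl⟩, ?_⟩))
    · show σ''.iv x + 1 ≤ B
      omega
    · show (σ''.setI x (σ''.iv x + 1)).iv x = _
      rw [hx]
      simp
    · show I _ (σ''.setI x (σ''.iv x + 1))
      rwa [hx]
    · obtain ⟨d, rfl⟩ := Nat.exists_eq_add_of_le hle
      rw [show i + d + 1 - (i + 1) = d by omega, show i + d + 1 - i = d + 1 by omega, mul_add]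
      simp only [BExp.cost, IExp.cost]
      omega
  · rintro σ' φ' t ha ⟨i, h3, h4, h5, h6, rfl⟩ hb ht
    have hgt : H < i := by
      have : ¬ σ'.iv x ≤ hi.eval σ' := hb
      rw [h5, (hh i σ' h6 (ag _ ha)).2] at this
      omega
    obtain rfl : i = H + 1 := by omega
    refine .nil (hQ _ _ h6 (ag _ ha) ?_)
    simp only [BExp.cost, IExp.cost, Nat.sub_self, mul_zero] at ht
    omega

attribute [simp] IExp.eval IExp.Fits IExp.cost RExp.eval RExp.Fits RExp.cost BExp.Holds BExp.Fits
  BExp.cost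

end MongeProbe

namespace MongeProbe

/-! ### Paths with a given number of links -/

variable {c : ℕ → ℕ → ℝ} {s n m N : ℕ} {v : ℕ → ℕ}

theorem IsPath.add_le (h : IsPath s n m v) {i j : ℕ} (hij : i ≤ j) (hj : j ≤ m) :
    v i + (j - i) ≤ v j := by
  induction j, hij using Nat.le_induction with
  | base => simp
  | succ j hij ih =>
    have := h.2.2 j (by omega)
    have := ih (by omega)
    omega

theorem IsPath.links_le (h : IsPath s n m v) : s + m ≤ n := by
  have := h.add_le (Nat.zero_le m) le_rfl
  rw [h.1, h.2.1] at this
  omega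

theorem exists_isPath (hm : 1 ≤ m) (hn : s + m ≤ n) : ∃ v, IsPath s n m v := by
  refine ⟨fun i => if i < m then s + i else n, ?_, by simp, fun i hi => ?_⟩
  · simp only [if_pos (show 0 < m by omega), add_zero]
  · simp only [if_pos hi]
    split_ifs <;> omega

theorem isPath_init (h : IsPath s n (m + 1) v) : IsPath s (v m) m v :=
  ⟨h.1, rfl, fun i hi => h.2.2 i (by omega)⟩

theorem pathLength_succ : pathLength c (m + 1) v = pathLength c m v + c (v m) (v (m + 1)) :=
  Finset.sum_range_succ _ _

theorem pathLength_congr {w : ℕ → ℕ} (h : ∀ i ≤ m, v i = w i) :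
    pathLength c m v = pathLength c m w := by
  refine Finset.sum_congr rfl fun i hi => ?_
  rw [Finset.mem_range] at hi
  rw [h i (by omega), h (i + 1) (by omega)]

theorem IsPath.snoc {i : ℕ} (h : IsPath s i m v) (hi : i < n) :
    IsPath s n (m + 1) (Function.update v (m + 1) n) := by
  refine ⟨?_, by simp, fun k hk => ?_⟩
  · rw [Function.update_of_ne (by omega), h.1]
  · rw [Function.update_of_ne (by omega)]
    rcases Nat.lt_succ_iff_lt_or_eq.1 hk with hk | rfl
    · rw [Function.update_of_ne (by omega)]
      exact h.2.2 k hk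
    · simpa [h.2.1] using hi

theorem pathLength_snoc {i : ℕ} (h : IsPath s i m v) :
    pathLength c (m + 1) (Function.update v (m + 1) n) = pathLength c m v + c i n := by
  rw [pathLength_succ, Function.update_self, Function.update_of_ne (by omega), h.2.1]
  congr 1
  exact pathLength_congr fun k hk => Function.update_of_ne (by omega) _ _

/-- Induction on the last inner vertex. Finiteness makes the infimum in `minLength` a minimum. -/
theorem finite_lengths (c : ℕ → ℕ → ℝ) (s m n : ℕ) :
    {x | ∃ v, IsPath s n m v ∧ pathLength c m v = x}.Finite := by
  induction m generalizing n with
  | zero =>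
    refine (Set.finite_singleton (0 : ℝ)).subset ?_
    rintro x ⟨v, -, rfl⟩
    simp [pathLength]
  | succ m ih =>
    refine ((Set.finite_Iio n).biUnion fun i _ => (ih i).image (· + c i n)).subset ?_
    rintro x ⟨v, hv, rfl⟩
    have hlt := hv.2.2 m (by omega)
    rw [hv.2.1] at hlt
    refine Set.mem_biUnion (Set.mem_Iio.2 hlt) ⟨_, ⟨v, isPath_init hv, rfl⟩, ?_⟩
    rw [pathLength_succ, hv.2.1]

theorem isLeast_minLength (hm : 1 ≤ m) (hn : s + m ≤ n) :
    IsLeast {x | ∃ v, IsPath s n m v ∧ pathLength c m v = x} (minLength c s m n) := by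
  obtain ⟨v, hv⟩ := exists_isPath hm hn
  have hne : {x | ∃ v, IsPath s n m v ∧ pathLength c m v = x}.Nonempty := ⟨_, v, hv, rfl⟩
  exact ⟨hne.csInf_mem (finite_lengths c s m n),
    fun x hx => csInf_le (finite_lengths c s m n).bddBelow hx⟩

theorem exists_shortest (c : ℕ → ℕ → ℝ) (hm : 1 ≤ m) (hn : s + m ≤ n) :
    ∃ v, IsPath s n m v ∧ pathLength c m v = minLength c s m n := (isLeast_minLength hm hn).1

theorem minLength_le_pathLength (h : IsPath s n m v) : minLength c s m n ≤ pathLength c m v :=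
  csInf_le (finite_lengths c s m n).bddBelow ⟨v, h, rfl⟩

theorem minLength_one (h : s < n) : minLength c s 1 n = c s n := by
  obtain ⟨v, hv, hl⟩ := exists_shortest c (s := s) (n := n) le_rfl h
  rw [← hl]
  simp [pathLength, hv.1, hv.2.1]

/-- The dynamic programming recursion. -/
theorem isLeast_minLength_succ (hm : 1 ≤ m) (hn : s + m < n) :
    IsLeast ((fun i => minLength c s m i + c i n) '' {i | s + m ≤ i ∧ i < n})
      (minLength c s (m + 1) n) := by
  have lower : ∀ i, s + m ≤ i → i < n → minLength c s (m + 1) n ≤ minLength c s m i + c i n := by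
    intro i hi hin
    obtain ⟨v, hv, hl⟩ := exists_shortest c hm hi
    rw [← hl, ← pathLength_snoc hv]
    exact minLength_le_pathLength (hv.snoc hin)
  constructor
  · obtain ⟨v, hv, hl⟩ := exists_shortest c (m := m + 1) (s := s) (n := n) (by omega) (by omega)
    have hlt := hv.2.2 m (by omega)
    rw [hv.2.1] at hlt
    have hi := (isPath_init hv).links_le
    refine ⟨v m, ⟨hi, hlt⟩, (lower _ hi hlt).antisymm' ?_⟩
    rw [← hl, pathLength_succ, hv.2.1]
    exact add_le_add_left (minLength_le_pathLength (isPath_init hv)) _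
  · rintro _ ⟨i, ⟨hi, hin⟩, rfl⟩
    exact lower i hi hin

/-- Follow `w` for `t` links, and then `v` from its vertex `u + 1` on. -/
theorem IsPath.splice {n' p q t u : ℕ} {w : ℕ → ℕ} (hv : IsPath s n p v) (hw : IsPath s n' q w)
    (ht : t ≤ q) (hu : u < p) (hlt : w t < v (u + 1)) :
    IsPath s n (t + (p - u)) (fun i => if i ≤ t then w i else v (i - t + u)) := by
  refine ⟨by simpa using hw.1, ?_, fun i hi => ?_⟩
  · simp only
    rw [if_neg (by omega), show t + (p - u) - t + u = p by omega, hv.2.1]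
  · simp only
    rcases lt_trichotomy i t with h | rfl | h
    · rw [if_pos (by omega), if_pos (by omega)]
      exact hw.2.2 i (by omega)
    · rw [if_pos (by omega), if_neg (by omega), show i + 1 - i + u = u + 1 by omega]
      exact hlt
    · rw [if_neg (by omega), if_neg (by omega), show i + 1 - t + u = (i - t + u) + 1 by omega]
      exact hv.2.2 _ (by omega)

theorem pathLength_splice {p t u : ℕ} {w : ℕ → ℕ} (hu : u < p) :
    pathLength c (t + (p - u)) (fun i => if i ≤ t then w i else v (i - t + u)) =
      pathLength c t w + c (w t) (v (u + 1)) + (pathLength c p v - pathLength c (u + 1) v) := by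
  obtain ⟨d, rfl⟩ := Nat.exists_eq_add_of_lt hu
  rw [show t + (u + d + 1 - u) = t + 1 + d by omega, show u + d + 1 = u + 1 + d by omega]
  simp only [pathLength]
  rw [Finset.sum_range_add _ (t + 1) d, Finset.sum_range_add _ (u + 1) d, Finset.sum_range_succ _ t,
    add_sub_cancel_left]
  congr 1
  · congr 1
    · refine Finset.sum_congr rfl fun i hi => ?_
      rw [Finset.mem_range] at hi
      rw [if_pos (by omega), if_pos (by omega)]
    · rw [if_pos le_rfl, if_neg (by omega), show t + 1 - t + u = u + 1 by omega]
  · refine Finset.sum_congr rfl fun i hi => ?_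
    rw [if_neg (by omega), if_neg (by omega), show t + 1 + i - t + u = u + 1 + i by omega,
      show t + 1 + i + 1 - t + u = u + 1 + i + 1 by omega]

/-- Exchanging the ends of two paths at a nested pair of edges. -/
theorem minLength_exchange (hc : IsMongeDAG s N c) {p q n₁ n₂ : ℕ} (hq : 1 ≤ q) (hqp : q < p)
    (h₁ : s + p ≤ n₁) (h₂ : s + q ≤ n₂) (hN₂ : n₂ ≤ N)
    (h : n₁ + (q + 1) ≤ n₂ + p) :
    minLength c s (p - 1) n₁ + minLength c s (q + 1) n₂ ≤
      minLength c s p n₁ + minLength c s q n₂ := by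
  obtain ⟨v, hv, hvl⟩ := exists_shortest c (m := p) (s := s) (n := n₁) (by omega) h₁
  obtain ⟨w, hw, hwl⟩ := exists_shortest c hq h₂
  -- The inequality holds at `q`: the vertex `v (q + 1)` is `p - (q + 1)` links before `n₁`, hence
  -- at most `n₂ = w q`.
  have hex : ∃ t, v (t + 1) ≤ w t := by
    refine ⟨q, ?_⟩
    have := hv.add_le (i := q + 1) (j := p) (by omega) le_rfl
    rw [hv.2.1] at this
    rw [hw.2.1]
    omega
  classical
  obtain ⟨t, ht⟩ : ∃ t, Nat.find hex = t + 1 := by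
    refine Nat.exists_eq_succ_of_ne_zero fun h0 => ?_
    have h1 := Nat.find_spec hex
    have h2 := hv.2.2 0 (by omega)
    rw [h0, hw.1] at h1
    rw [hv.1] at h2
    omega
  -- At the first such index, `w t < v (t + 1) < v (t + 2) ≤ w (t + 1)`: an edge of `w` encloses an
  -- edge of `v`.
  have h1 : v (t + 2) ≤ w (t + 1) := by
    have := Nat.find_spec hex
    rwa [ht] at this
  have h2 : w t < v (t + 1) := by
    have := Nat.find_min hex (m := t) (by omega)
    omega
  have htq : t + 1 ≤ q := by
    rw [← ht]
    refine Nat.find_min' hex ?_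
    have := hv.add_le (i := q + 1) (j := p) (by omega) le_rfl
    rw [hv.2.1] at this
    rw [hw.2.1]
    omega
  have h3 : v (t + 1) < v (t + 2) := hv.2.2 _ (by omega)
  -- The new paths are `w` up to `w t` continued by `v` from `v (t + 2)`, and `v` up to `v (t + 1)`
  -- continued by `w` from `w (t + 1)`. The first has lost a link against `v`, the second has gained
  -- one against `w`.
  have hP := hv.splice hw (t := t) (u := t + 1) (by omega) (by omega) (by show _ < v (t + 2); omega)
  have hQ := hw.splice hv (t := t + 1) (u := t) (by omega) (by omega) (by omega)
  have lP := minLength_le_pathLength (c := c) hP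
  have lQ := minLength_le_pathLength (c := c) hQ
  rw [pathLength_splice (by omega)] at lP lQ
  rw [show t + (p - (t + 1)) = p - 1 by omega] at lP
  rw [show t + 1 + (q - t) = q + 1 by omega] at lQ
  have hs : s ≤ w t := by
    have := hw.add_le (Nat.zero_le t) (by omega)
    rw [hw.1] at this
    omega
  have hwN : w (t + 1) ≤ N := by
    have := hw.add_le htq le_rfl
    rw [hw.2.1] at this
    omega
  have hM : c (w t) (v (t + 2)) + c (v (t + 1)) (w (t + 1)) ≤
      c (w t) (w (t + 1)) + c (v (t + 1)) (v (t + 2)) := by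
    -- If the two edges end at the same node, swapping the tails changes nothing; otherwise they are
    -- properly nested.
    rcases h1.eq_or_lt with h1 | h1
    · rw [h1]
    · exact hc.2 _ _ _ _ ⟨hs, by omega, hwN⟩ ⟨by show s ≤ v (t + 1); omega, h3, by
        show v (t + 2) ≤ N; omega⟩ h2 h1
  have e1 := pathLength_succ (c := c) (m := t + 1) (v := v)
  have e2 := pathLength_succ (c := c) (m := t) (v := w)
  simp only [show t + 1 + 1 = t + 2 from rfl] at lP lQ e1
  linarith

/-! ### Monotonicity of `delta` and existence of the probe -/

variable (hc : IsMongeDAG s N c)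
include hc

/-- Convexity in the number of links: exchange paths with `k + 2` and `k` links to the same end. -/
theorem delta_mono_links {k : ℕ} (hm : 1 ≤ m) (hmk : m ≤ k) (hk : s + k + 1 ≤ n) (hn : n ≤ N) :
    delta c s m n ≤ delta c s k n := by
  induction k, hmk using Nat.le_induction with
  | base => rfl
  | succ k hmk ih =>
    refine (ih (by omega)).trans ?_
    have := minLength_exchange hc (p := k + 2) (q := k) (n₁ := n) (n₂ := n) (by omega) (by omega)
      (by omega) (by omega) hn (by omega)
    simp only [show k + 2 - 1 = k + 1 by omega] at this
    simp only [delta]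
    linarith

/-- Exchange an `(m + 1)`-link path to the nearer end with an `m`-link path to the farther end;
their link numbers swap. -/
theorem delta_anti_end {n' : ℕ} (hm : 1 ≤ m) (hn : s + m + 1 ≤ n) (hnn : n ≤ n') (hN : n' ≤ N) :
    delta c s m n' ≤ delta c s m n := by
  have := minLength_exchange hc (p := m + 1) (q := m) (n₁ := n) (n₂ := n') (by omega) (by omega)
      (by omega) (by omega) hN (by omega)
  simp only [delta]
  simp only [Nat.add_sub_cancel] at this
  linarith

/-- Each diagonal step exchanges paths whose link numbers differ by two and whose ends differ by
one; the hypothesis of `minLength_exchange` on the ends then holds with equality. -/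
theorem delta_diag_le (k : ℕ) (hm : 1 ≤ m) (hn : s + m + 1 ≤ n) (hN : n + k ≤ N) :
    delta c s m n ≤ delta c s (m + k) (n + k) := by
  induction k with
  | zero => rfl
  | succ k ih =>
    refine (ih (by omega)).trans ?_
    have := minLength_exchange hc (p := m + k + 2) (q := m + k) (n₁ := n + k + 1) (n₂ := n + k)
      (by omega) (by omega) (by omega) (by omega) (by omega) (by omega)
    simp only [show m + k + 2 - 1 = m + k + 1 by omega] at this
    simp only [delta, ← add_assoc]
    linarith

omit hc

/-- The right end `N - M + m` qualifies, because it lies on the diagonal through `(M, N)`. -/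
theorem exists_isProbe {M : ℕ} (hc : IsMongeDAG s N c) (hm : 1 ≤ m) (hM : m ≤ M)
    (hN : M + s + 1 ≤ N) : ∃ r, IsProbe c s N M m r := by
  classical
  have hex : ∃ n, n ∈ Set.Icc (s + m + 1) (N - M + m) ∧ delta c s m n ≤ delta c s M N := by
    refine ⟨N - M + m, ⟨by omega, le_rfl⟩, ?_⟩
    have := delta_diag_le hc (m := m) (n := N - M + m) (M - m) hm (by omega) (by omega)
    rwa [show m + (M - m) = M by omega, show N - M + m + (M - m) = N by omega] at this
  exact ⟨Nat.find hex, Nat.find_spec hex, fun n hn => Nat.find_min' hex hn⟩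

/-! ### Link numbers of the shortest paths after a shift of the lengths -/

theorem pathLength_shift (lam : ℝ) : pathLength (shift c lam) m v = pathLength c m v - m * lam := by
  simp [pathLength, shift, Finset.sum_sub_distrib]

/-- Shifting every edge by `lam` turns shortest paths into minimizers of `minLength c s k n - k *
lam`. This reduces statements on paths to statements on a convex function of `k`. -/
theorem mem_linkCounts {lam : ℝ} (hn : s < n) : m ∈ linkCounts (shift c lam) s n ↔
    (1 ≤ m ∧ s + m ≤ n) ∧ ∀ k, 1 ≤ k → s + k ≤ n →
      minLength c s m n - m * lam ≤ minLength c s k n - k * lam := by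
  have pos : ∀ {k v}, IsPath s n k v → 1 ≤ k := by
    intro k v hv
    rcases Nat.eq_zero_or_pos k with rfl | h
    · have := hv.1.symm.trans hv.2.1
      omega
    · exact h
  constructor
  · rintro ⟨v, hv, hmin⟩
    refine ⟨⟨pos hv, hv.links_le⟩, fun k hk hkn => ?_⟩
    obtain ⟨w, hw, hl⟩ := exists_shortest c hk hkn
    have h1 := hmin k w hw
    rw [pathLength_shift, pathLength_shift, hl] at h1
    have h2 := minLength_le_pathLength (c := c) hv
    linarith
  · rintro ⟨⟨hm, hmn⟩, hmin⟩
    obtain ⟨v, hv, hl⟩ := exists_shortest c hm hmn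
    refine ⟨v, hv, fun k w hw => ?_⟩
    rw [pathLength_shift, pathLength_shift, hl]
    have h1 := hmin k (pos hw) hw.links_le
    have h2 := minLength_le_pathLength (c := c) hw
    linarith

theorem linkCounts_nonempty (lam : ℝ) (hn : s < n) : (linkCounts (shift c lam) s n).Nonempty := by
  obtain ⟨m, hm, h⟩ := Finset.exists_min_image (Finset.Icc 1 (n - s))
    (fun k => minLength c s k n - k * lam) ⟨1, by simp; omega⟩
  rw [Finset.mem_Icc] at hm
  exact ⟨m, (mem_linkCounts hn).2 ⟨⟨hm.1, by omega⟩, fun k hk hkn => h k (by simp; omega)⟩⟩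

theorem bddAbove_linkCounts (lam : ℝ) (hn : s < n) : BddAbove (linkCounts (shift c lam) s n) :=
  ⟨n, fun m hm => by have := ((mem_linkCounts hn).1 hm).1; omega⟩

theorem minLength_sub_le_of_le_delta {lam : ℝ} {k : ℕ} (hmk : m ≤ k)
    (h : ∀ i, m ≤ i → i < k → lam ≤ delta c s i n) :
    minLength c s m n - m * lam ≤ minLength c s k n - k * lam := by
  induction k, hmk using Nat.le_induction with
  | base => rfl
  | succ k hmk ih =>
    have h1 := ih fun i hi hik => h i hi (by omega)
    have h2 := h k hmk (by omega)
    simp only [delta] at h2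
    push_cast
    linarith

theorem minLength_sub_le_of_delta_le {lam : ℝ} {k : ℕ} (hmk : m ≤ k)
    (h : ∀ i, m ≤ i → i < k → delta c s i n ≤ lam) :
    minLength c s k n - k * lam ≤ minLength c s m n - m * lam := by
  induction k, hmk using Nat.le_induction with
  | base => rfl
  | succ k hmk ih =>
    have h1 := ih fun i hi hik => h i hi (by omega)
    have h2 := h k hmk (by omega)
    simp only [delta] at h2
    push_cast
    linarith

section Depth
variable {M : ℕ} {lam : ℝ} (hc : IsMongeDAG s N c) (hM : 2 ≤ M) (hN : M + s + 1 ≤ N)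
include hc hM hN

/-- If `lam` were at most this increment, all later increments would be at least `lam` by convexity,
and `M` links would do as well as the least optimal number. -/
theorem delta_lt_of_lt_dMin (h : M < dMin c s lam N) : delta c s M N < lam := by
  have hmem := Nat.sInf_mem (linkCounts_nonempty (c := c) lam hc.1)
  rw [← dMin] at hmem
  have hk := (mem_linkCounts hc.1).1 hmem
  by_contra! hle
  have h1 := minLength_sub_le_of_le_delta (c := c) (s := s) (n := N) (lam := lam) h.le
    fun i hi hik => hle.trans (delta_mono_links hc (by omega) hi (by omega) le_rfl)
  have : M ∈ linkCounts (shift c lam) s N := (mem_linkCounts hc.1).2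
    ⟨⟨by omega, by omega⟩, fun k h2 h3 => h1.trans (hk.2 k h2 h3)⟩
  have := Nat.sInf_le this
  rw [← dMin] at this
  omega

/-- If the increment were below `lam`, so would be all earlier ones. Going on to `M - 1` links would
lose nothing and the next link would be a strict gain. -/
theorem le_delta_of_dMin_lt (h : dMin c s lam N < M) : lam ≤ delta c s (M - 1) N := by
  have hmem := Nat.sInf_mem (linkCounts_nonempty (c := c) lam hc.1)
  rw [← dMin] at hmem
  have hk := (mem_linkCounts hc.1).1 hmem
  by_contra! hle
  have h1 := minLength_sub_le_of_delta_le (c := c) (s := s) (n := N) (lam := lam)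
    (m := dMin c s lam N) (k := M - 1) (by omega)
    fun i hi hik => (delta_mono_links hc (by omega) (by omega) (by omega) le_rfl).trans hle.le
  have h2 := hk.2 M (by omega) (by omega)
  obtain ⟨M, rfl⟩ := Nat.exists_eq_add_of_le' (show 1 ≤ M by omega)
  simp only [Nat.add_sub_cancel, delta] at h1 hle
  push_cast at h2
  linarith

/-- Compare the optimal number `M` with its neighbours `M - 1` and `M + 1`. -/
theorem mem_Lam_of_dMin_eq (h : dMin c s lam N = M) : lam ∈ Lam c s M N := by
  have hmem := Nat.sInf_mem (linkCounts_nonempty (c := c) lam hc.1)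
  rw [← dMin, h] at hmem
  have hk := (mem_linkCounts hc.1).1 hmem
  have h1 := hk.2 (M - 1) (by omega) (by omega)
  have h2 := hk.2 (M + 1) (by omega) (by omega)
  obtain ⟨M, rfl⟩ := Nat.exists_eq_add_of_le' (show 1 ≤ M by omega)
  simp only [Nat.add_sub_cancel] at h1
  push_cast at h1 h2
  constructor <;> simp only [delta, Nat.add_sub_cancel] <;> linarith

theorem le_dMax_iff : M ≤ dMax c s lam N ↔ delta c s (M - 1) N ≤ lam := by
  have hmem := Nat.sSup_mem (linkCounts_nonempty (c := c) lam hc.1) (bddAbove_linkCounts lam hc.1)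
  rw [← dMax] at hmem
  have hk := (mem_linkCounts hc.1).1 hmem
  constructor
  · intro h
    by_contra! hlt
    have h1 := minLength_sub_le_of_le_delta (c := c) (s := s) (n := N) (lam := lam) h
      fun i hi hik => hlt.le.trans (delta_mono_links hc (by omega) (by omega) (by omega) le_rfl)
    have h2 := hk.2 (M - 1) (by omega) (by omega)
    obtain ⟨M, rfl⟩ := Nat.exists_eq_add_of_le' (show 1 ≤ M by omega)
    simp only [Nat.add_sub_cancel, delta] at h2 hlt
    push_cast at h1
    linarith
  · intro hle
    by_contra! h
    have h1 := minLength_sub_le_of_delta_le (c := c) (s := s) (n := N) (lam := lam)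
      (m := dMax c s lam N) (k := M) (by omega)
      fun i hi hik => (delta_mono_links hc (by omega) (by omega) (by omega) le_rfl).trans hle
    have : M ∈ linkCounts (shift c lam) s N := (mem_linkCounts hc.1).2
      ⟨⟨by omega, by omega⟩, fun k h2 h3 => h1.trans (hk.2 k h2 h3)⟩
    have := le_csSup (bddAbove_linkCounts lam hc.1) this
    rw [← dMax] at this
    omega

end Depth

end MongeProbe

namespace MongeProbe

/-! ### Totally monotone arrays: reduction and interpolation -/

section TotallyMonotone
variable {V : Type*} [LinearOrder V]

/-- The array `A i j`, `lo ≤ i < j ≤ N`, is totally monotone, in the strict and in the weak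
sense. -/
structure TotMono (A : ℕ → ℕ → V) (lo N : ℕ) : Prop where
  lt : ∀ i i' j j', lo ≤ i → i < i' → i' < j → j ≤ j' → j' ≤ N → A i' j < A i j → A i' j' < A i j'
  le : ∀ i i' j j', lo ≤ i → i < i' → i' < j → j ≤ j' → j' ≤ N → A i' j ≤ A i j → A i' j' ≤ A i j'

/-- In column `j`, the row `x` is at least as good as `y`. -/
def Dom (A : ℕ → ℕ → V) (x y j : ℕ) : Prop := y < j → x < j ∧ A x j ≤ A y j

/-- In column `j`, the row `x` is strictly better than `y`. -/
def Win (A : ℕ → ℕ → V) (x y j : ℕ) : Prop := x < j ∧ A x j < A y j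

variable {A : ℕ → ℕ → V} {lo N x y z j j' : ℕ}

theorem Dom.refl (A : ℕ → ℕ → V) (x j : ℕ) : Dom A x x j := fun h => ⟨h, le_rfl⟩

theorem Dom.trans (h₁ : Dom A x y j) (h₂ : Dom A y z j) : Dom A x z j := fun h =>
  ⟨(h₁ (h₂ h).1).1, (h₁ (h₂ h).1).2.trans (h₂ h).2⟩

theorem Win.dom (h : Win A x y j) : Dom A x y j := fun _ => ⟨h.1, h.2.le⟩

theorem Win.dom_later (hA : TotMono A lo N) (hy : lo ≤ y) (hyx : y < x) (hj : j ≤ j') (hN : j' ≤ N)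
    (h : Win A x y j) : Dom A x y j' := fun _ =>
  ⟨h.1.trans_le hj, (hA.lt y x j j' hy hyx h.1 hj hN h.2).le⟩

/-- A strict advantage of the later row `y` persists to the right, so if it is absent in column `j`
it is absent before. -/
theorem dom_earlier (hA : TotMono A lo N) (hx : lo ≤ x) (hxy : x < y) (hj : j' ≤ j) (hN : j ≤ N)
    (h : ¬ Win A y x j) : Dom A x y j' := fun hy => by
  refine ⟨hxy.trans hy, ?_⟩
  by_contra! hlt
  exact h ⟨hy.trans_le hj, hA.lt x y j' j hx hxy hy hj hN hlt⟩

theorem Dom.not_win (h : Dom A x y j) : ¬ Win A y x j := fun hw => (h hw.1).2.not_gt hw.2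

theorem Dom.later (hA : TotMono A lo N) (hy : lo ≤ y) (hyx : y < x) (hxj : x < j) (hj : j ≤ j')
    (hN : j' ≤ N) (h : Dom A x y j) : Dom A x y j' := fun _ =>
  ⟨hxj.trans_le hj, hA.le y x j j' hy hyx hxj hj hN (h (hyx.trans hxj)).2⟩

/-- The columns with stride `st`. -/
def tgt (jl st v : ℕ) : ℕ := jl + (v + 1) * st - 1

variable {jl jh st v w : ℕ}

theorem tgt_add_one (hst : 1 ≤ st) : tgt jl st v + 1 = jl + (v + 1) * st := by
  have : 1 ≤ (v + 1) * st := Nat.mul_pos (by omega) hst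
  simp only [tgt]
  omega

theorem tgt_zero : tgt jl st 0 = jl + st - 1 := by simp [tgt]

theorem tgt_succ (hst : 1 ≤ st) : tgt jl st (v + 1) = tgt jl st v + st := by
  have h1 := tgt_add_one (jl := jl) (v := v) hst
  have h2 := tgt_add_one (jl := jl) (v := v + 1) hst
  have : (v + 1 + 1) * st = (v + 1) * st + st := by ring
  omega

theorem le_tgt (hst : 1 ≤ st) : jl ≤ tgt jl st v := by
  have h1 := tgt_add_one (jl := jl) (v := v) hst
  have : 1 ≤ (v + 1) * st := Nat.mul_pos (by omega) hst
  omega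

theorem tgt_mono (h : v ≤ w) : tgt jl st v ≤ tgt jl st w := by
  have : (v + 1) * st ≤ (w + 1) * st := Nat.mul_le_mul_right _ (by omega)
  simp only [tgt]
  omega

theorem tgt_lt (hst : 1 ≤ st) (h : v < w) : tgt jl st v < tgt jl st w :=
  (Nat.lt_of_lt_of_le (by rw [tgt_succ hst]; omega) (tgt_mono (Nat.succ_le_of_lt h)))

/-- The columns of the doubled stride are the odd-numbered ones of the present stride, which leaves
the even-numbered ones to interpolation. -/
theorem tgt_double : tgt jl (2 * st) v = tgt jl st (2 * v + 1) := by
  simp only [tgt]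
  congr 2
  ring

theorem tgt_le_iff (hst : 1 ≤ st) (hjl : jl ≤ jh) :
    tgt jl st v ≤ jh ↔ v + 1 ≤ (jh + 1 - jl) / st := by
  have h1 := tgt_add_one (jl := jl) (v := v) hst
  rw [Nat.le_div_iff_mul_le hst]
  omega

/-- The stack `L base, …, L (top - 1)` of the reduction, when the rows in `X` have been examined
and those in `E` are still to be pushed. -/
structure Stack (A : ℕ → ℕ → V) (jl jh st : ℕ) (L : ℕ → ℕ) (base top : ℕ) (X E : Set ℕ) :
    Prop where
  mono : ∀ k k', base ≤ k → k < k' → k' < top → L k < L k'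
  mem : ∀ k, base ≤ k → k < top → L k ∈ X
  chain : ∀ k, base ≤ k → k + 1 < top → ¬ Win A (L (k + 1)) (L k) (tgt jl st (k - base))
  cover : ∀ v, tgt jl st v ≤ jh → ∀ y ∈ X,
    ∃ z, (z ∈ E ∨ ∃ k, base ≤ k ∧ k < top ∧ L k = z) ∧ Dom A z y (tgt jl st v)

variable {L : ℕ → ℕ} {base top : ℕ} {X E : Set ℕ}

theorem Stack.empty (A : ℕ → ℕ → V) (jl jh st : ℕ) (L : ℕ → ℕ) (base : ℕ) :
    Stack A jl jh st L base base ∅ ∅ :=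
  ⟨fun _ _ _ _ _ => by omega, fun _ _ _ => by omega, fun _ _ _ => by omega, fun _ _ _ h => h.elim⟩

theorem Stack.start (h : Stack A jl jh st L base top X ∅) (x : ℕ) :
    Stack A jl jh st L base top (insert x X) {x} := by
  refine ⟨h.mono, fun k h1 h2 => .inr (h.mem k h1 h2), h.chain, ?_⟩
  rintro v hv y (rfl | hy)
  · exact ⟨y, .inl rfl, .refl _ _ _⟩
  · obtain ⟨z, hz, hd⟩ := h.cover v hv y hy
    exact ⟨z, .inr (hz.resolve_left id), hd⟩

/-- The top row is superfluous. From its own column on, `x` is at least as good; before that, the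
chain condition makes the row beneath it at least as good. -/
theorem Stack.pop (hA : TotMono A lo N) (hN : jh ≤ N) (hX : ∀ y ∈ X, lo ≤ y)
    (h : Stack A jl jh st L base (top + 1) X {x}) (hb : base ≤ top) (hx : L top < x)
    (hw : Win A x (L top) (tgt jl st (top - base))) (ht : tgt jl st (top - base) ≤ jh) :
    Stack A jl jh st L base top X {x} := by
  refine ⟨fun k k' h1 h2 h3 => h.mono k k' h1 h2 (by omega), fun k h1 h2 => h.mem k h1 (by omega),
    fun k h1 h2 => h.chain k h1 (by omega), fun v hv y hy => ?_⟩
  obtain ⟨z, hz | ⟨k, hk, hkt, rfl⟩, hd⟩ := h.cover v hv y hy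
  · exact ⟨z, .inl hz, hd⟩
  rcases Nat.lt_succ_iff_lt_or_eq.1 hkt with hkt | rfl
  · exact ⟨_, .inr ⟨k, hk, hkt, rfl⟩, hd⟩
  rcases le_or_gt (k - base) v with hv' | hv'
  · exact ⟨x, .inl rfl, (hw.dom_later hA (hX _ (h.mem k hk hkt)) hx
      (tgt_mono hv') (hv.trans hN)).trans hd⟩
  · obtain ⟨k, rfl⟩ := Nat.exists_eq_add_of_le' (show 1 ≤ k by omega)
    refine ⟨L k, .inr ⟨k, by omega, by omega, rfl⟩, Dom.trans ?_ hd⟩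
    refine dom_earlier hA (hX _ (h.mem k (by omega) (by omega)))
      (h.mono k (k + 1) (by omega) (by omega) (by omega)) (tgt_mono (by omega)) ?_
      (h.chain k (by omega) (by omega))
    exact (tgt_mono (by omega)).trans (ht.trans hN)

theorem Stack.push (h : Stack A jl jh st L base top X {x}) (hb : base ≤ top)
    (hlt : ∀ k, base ≤ k → k < top → L k < x) (hxX : x ∈ X)
    (hw : base < top → ¬ Win A x (L (top - 1)) (tgt jl st (top - 1 - base))) :
    Stack A jl jh st (Function.update L top x) base (top + 1) X ∅ := by
  have old : ∀ k, k < top → Function.update L top x k = L k := fun k hk =>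
    Function.update_of_ne (by omega) _ _
  refine ⟨fun k k' h1 h2 h3 => ?_, fun k h1 h2 => ?_, fun k h1 h2 => ?_, fun v hv y hy => ?_⟩
  · rw [old k (by omega)]
    rcases Nat.lt_succ_iff_lt_or_eq.1 h3 with h3 | rfl
    · rw [old k' h3]
      exact h.mono _ _ h1 h2 h3
    · rw [Function.update_self]
      exact hlt k h1 h2
  · rcases Nat.lt_succ_iff_lt_or_eq.1 h2 with h2 | rfl
    · rw [old k h2]
      exact h.mem _ h1 h2
    · rwa [Function.update_self]
  · rw [old k (by omega)]
    rcases Nat.lt_succ_iff_lt_or_eq.1 h2 with h2 | rfl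
    · rw [old _ h2]
      exact h.chain _ h1 h2
    · rw [Function.update_self]
      exact hw (by omega)
  · obtain ⟨z, hz | ⟨k, hk, hkt, rfl⟩, hd⟩ := h.cover v hv y hy
    · exact ⟨z, .inr ⟨top, hb, by omega, by rw [Function.update_self]; exact hz.symm⟩, hd⟩
    · exact ⟨_, .inr ⟨k, hk, by omega, old k hkt⟩, hd⟩

/-- The stack already has a row for every column. Since `x` does not win in the last of them, it
does not win in any earlier one. -/
theorem Stack.discard (hA : TotMono A lo N) (hN : jh ≤ N) (hX : ∀ y ∈ X, lo ≤ y)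
    (h : Stack A jl jh st L base top X {x}) (hb : base < top)
    (hlt : ∀ k, base ≤ k → k < top → L k < x)
    (hw : ¬ Win A x (L (top - 1)) (tgt jl st (top - 1 - base)))
    (ht : tgt jl st (top - 1 - base) ≤ jh) (hfull : jh < tgt jl st (top - base)) :
    Stack A jl jh st L base top X ∅ := by
  refine ⟨h.mono, h.mem, h.chain, fun v hv y hy => ?_⟩
  obtain ⟨z, rfl | hz, hd⟩ := h.cover v hv y hy
  · refine ⟨L (top - 1), .inr ⟨top - 1, by omega, by omega, rfl⟩, Dom.trans ?_ hd⟩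
    refine dom_earlier hA (hX _ (h.mem _ (by omega) (by omega))) (hlt _ (by omega) (by omega))
      (tgt_mono ?_) (ht.trans hN) hw
    by_contra! hcon
    have := tgt_mono (jl := jl) (st := st) (show top - base ≤ v by omega)
    omega
  · exact ⟨z, .inr hz, hd⟩

/-- The rows `L p, …, L (q - 1)` suffice for the columns of stride `st`. -/
structure Level (A : ℕ → ℕ → V) (ca cb jl jh : ℕ) (L : ℕ → ℕ) (p q st : ℕ) : Prop where
  mono : ∀ k k', p ≤ k → k < k' → k' < q → L k < L k'
  mem : ∀ k, p ≤ k → k < q → ca ≤ L k ∧ L k ≤ cb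
  cover : ∀ v, tgt jl st v ≤ jh → ∀ i, ca ≤ i → i ≤ cb →
    ∃ k, p ≤ k ∧ k < q ∧ Dom A (L k) i (tgt jl st v)

variable {ca cb p q : ℕ}

theorem Level.double (h : Level A ca cb jl jh L p q st) : Level A ca cb jl jh L p q (2 * st) :=
  ⟨h.mono, h.mem, fun v hv i h1 h2 => by
    rw [tgt_double] at hv ⊢
    exact h.cover _ hv i h1 h2⟩

theorem Level.congr {L' : ℕ → ℕ} (h : Level A ca cb jl jh L p q st)
    (hL : ∀ k, k < q → L' k = L k) : Level A ca cb jl jh L' p q st := by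
  refine ⟨fun k k' h1 h2 h3 => ?_, fun k h1 h2 => ?_, fun v hv i h1 h2 => ?_⟩
  · rw [hL _ (by omega), hL _ h3]
    exact h.mono k k' h1 h2 h3
  · rw [hL _ h2]
    exact h.mem k h1 h2
  · obtain ⟨k, h3, h4, hd⟩ := h.cover v hv i h1 h2
    exact ⟨k, h3, h4, by rwa [hL _ h4]⟩

theorem Level.le_of_le (h : Level A ca cb jl jh L p q st) {k k' : ℕ} (hp : p ≤ k) (hk : k ≤ k')
    (hq : k' < q) : L k ≤ L k' := by
  rcases hk.eq_or_lt with rfl | hk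
  · rfl
  · exact (h.mono k k' hp hk hq).le

theorem Stack.level (h : Stack A jl jh st L base top X ∅) (hlev : Level A ca cb jl jh L p q st)
    (hX : ∀ y, y ∈ X ↔ ∃ k, p ≤ k ∧ k < q ∧ L k = y) : Level A ca cb jl jh L base top st := by
  refine ⟨h.mono, fun k h1 h2 => ?_, fun v hv i h1 h2 => ?_⟩
  · obtain ⟨k', h3, h4, h5⟩ := (hX _).1 (h.mem k h1 h2)
    rw [← h5]
    exact hlev.mem k' h3 h4
  · obtain ⟨k, h3, h4, hd⟩ := hlev.cover v hv i h1 h2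
    obtain ⟨z, hz, hd'⟩ := h.cover v hv _ ((hX _).2 ⟨k, h3, h4, rfl⟩)
    obtain ⟨k', h5, h6, rfl⟩ := hz.resolve_left id
    exact ⟨k', h5, h6, hd'.trans hd⟩

/-- The lists of all levels, one after the other in `L`; the list of level `t + 1` starts at
`off (t + 1)`. -/
inductive Tower (A : ℕ → ℕ → V) (ca cb jl jh : ℕ) (L off : ℕ → ℕ) : ℕ → ℕ → ℕ → Prop
  | zero (q : ℕ) : Tower A ca cb jl jh L off 0 q 1
  | succ {lev p q st : ℕ} (h : Tower A ca cb jl jh L off lev p st) (hpq : p ≤ q)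
      (hoff : off (lev + 1) = p) (hlev : Level A ca cb jl jh L p q st)
      (hsub : 1 ≤ lev → ∀ k, p ≤ k → k < q → ∃ k', off lev ≤ k' ∧ k' < p ∧ L k' = L k) :
      Tower A ca cb jl jh L off (lev + 1) q (2 * st)

theorem Tower.congr {off L' off' : ℕ → ℕ} {lev : ℕ} (h : Tower A ca cb jl jh L off lev q st)
    (hL : ∀ k, k < q → L' k = L k) (ho : ∀ t, t ≤ lev → off' t = off t) :
    Tower A ca cb jl jh L' off' lev q st := by
  induction h with
  | zero q => exact .zero q
  | succ h hpq hoff hlev hsub ih =>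
    refine .succ (ih (fun k hk => hL k (by omega)) fun t ht => ho t (by omega)) hpq
      ((ho _ le_rfl).trans hoff) (hlev.congr hL) fun h1 k h2 h3 => ?_
    obtain ⟨k', h4, h5, h6⟩ := hsub h1 k h2 h3
    exact ⟨k', by rwa [ho _ (by omega)], h5, by rw [hL _ (by omega), hL _ h3, h6]⟩

/-- `b` is an optimal row in column `j`. -/
def Opt (A : ℕ → ℕ → V) (ca cb b j : ℕ) : Prop :=
  (ca ≤ b ∧ b ≤ cb) ∧ ∀ i, ca ≤ i → i ≤ cb → Dom A b i j

/-- `P` holds optimal rows of the columns of stride `st`, taken from the list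
`L p, …, L (q - 1)`. -/
structure Solved (A : ℕ → ℕ → V) (ca cb jl jh : ℕ) (L : ℕ → ℕ) (p q : ℕ) (P : ℕ → ℕ) (st : ℕ) :
    Prop where
  mem : ∀ v, tgt jl st v ≤ jh → ∃ k, p ≤ k ∧ k < q ∧ L k = P (tgt jl st v)
  opt : ∀ v, tgt jl st v ≤ jh → Opt A ca cb (P (tgt jl st v)) (tgt jl st v)
  mono : ∀ v, tgt jl st (v + 1) ≤ jh → P (tgt jl st v) ≤ P (tgt jl st (v + 1))

variable {P : ℕ → ℕ}

theorem Solved.of_sub {p' q' : ℕ} (h : Solved A ca cb jl jh L p q P st)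
    (hs : ∀ k, p ≤ k → k < q → ∃ k', p' ≤ k' ∧ k' < q' ∧ L k' = L k) :
    Solved A ca cb jl jh L p' q' P st := by
  refine ⟨fun v hv => ?_, h.opt, h.mono⟩
  obtain ⟨k, h1, h2, h3⟩ := h.mem v hv
  obtain ⟨k', h4, h5, h6⟩ := hs k h1 h2
  exact ⟨k', h4, h5, h6.trans h3⟩

/-- The interpolation of the columns `2 * w`, `w < u`, of stride `st`. -/
structure Interp (A : ℕ → ℕ → V) (ca cb jl jh : ℕ) (L : ℕ → ℕ) (p q : ℕ) (P : ℕ → ℕ) (st u : ℕ) :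
    Prop where
  solved : Solved A ca cb jl jh L p q P (2 * st)
  mem : ∀ w, w < u → tgt jl st (2 * w) ≤ jh → ∃ k, p ≤ k ∧ k < q ∧ L k = P (tgt jl st (2 * w))
  opt : ∀ w, w < u → tgt jl st (2 * w) ≤ jh →
    Opt A ca cb (P (tgt jl st (2 * w))) (tgt jl st (2 * w))
  next : ∀ w, w < u → tgt jl st (2 * w + 1) ≤ jh →
    P (tgt jl st (2 * w)) ≤ P (tgt jl st (2 * w + 1))
  prev : ∀ w, w + 1 < u → tgt jl st (2 * (w + 1)) ≤ jh →
    P (tgt jl st (2 * w + 1)) ≤ P (tgt jl st (2 * (w + 1)))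

variable {u : ℕ}

theorem Solved.interp (h : Solved A ca cb jl jh L p q P (2 * st)) :
    Interp A ca cb jl jh L p q P st 0 :=
  ⟨h, fun _ _ => by omega, fun _ _ => by omega, fun _ _ => by omega, fun _ _ => by omega⟩

/-- Even-numbered columns have been interpolated, odd-numbered ones were solved with the doubled
stride. -/
theorem Interp.solved_of (h : Interp A ca cb jl jh L p q P st u)
    (hu : jh < tgt jl st (2 * u)) : Solved A ca cb jl jh L p q P st := by
  have key : ∀ w, tgt jl st (2 * w) ≤ jh → w < u := fun w hw => by
    by_contra! hcon
    have := tgt_mono (jl := jl) (st := st) (show 2 * u ≤ 2 * w by omega)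
    omega
  refine ⟨fun v hv => ?_, fun v hv => ?_, fun v hv => ?_⟩
  · rcases Nat.even_or_odd' v with ⟨w, rfl | rfl⟩
    · exact h.mem w (key w hv) hv
    · have := h.solved.mem w
      rw [tgt_double] at this
      exact this hv
  · rcases Nat.even_or_odd' v with ⟨w, rfl | rfl⟩
    · exact h.opt w (key w hv) hv
    · have := h.solved.opt w
      rw [tgt_double] at this
      exact this hv
  · rcases Nat.even_or_odd' v with ⟨w, rfl | rfl⟩
    · exact h.next w (key w ((tgt_mono (by omega)).trans hv)) hv
    · exact h.prev w (key (w + 1) hv) hv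

theorem Interp.update {b : ℕ} (h : Interp A ca cb jl jh L p q P st u) (hst : 1 ≤ st)
    (hmem : ∃ k, p ≤ k ∧ k < q ∧ L k = b) (hopt : Opt A ca cb b (tgt jl st (2 * u)))
    (hnext : tgt jl st (2 * u + 1) ≤ jh → b ≤ P (tgt jl st (2 * u + 1)))
    (hprev : ∀ w, w + 1 = u → P (tgt jl st (2 * w + 1)) ≤ b) :
    Interp A ca cb jl jh L p q (Function.update P (tgt jl st (2 * u)) b) st (u + 1) := by
  have inj : ∀ v w, v ≠ w → tgt jl st v ≠ tgt jl st w := fun v w hvw => by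
    rcases lt_or_gt_of_ne hvw with h | h
    · exact (tgt_lt hst h).ne
    · exact (tgt_lt hst h).ne'
  have old : ∀ v, v ≠ 2 * u →
      Function.update P (tgt jl st (2 * u)) b (tgt jl st v) = P (tgt jl st v) := fun v hv =>
    Function.update_of_ne (inj _ _ hv) _ _
  refine ⟨⟨fun v hv => ?_, fun v hv => ?_, fun v hv => ?_⟩, fun w hw hj => ?_, fun w hw hj => ?_,
    fun w hw hj => ?_, fun w hw hj => ?_⟩
  · have := h.solved.mem v hv
    rw [tgt_double] at this ⊢
    rwa [old _ (by omega)]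
  · have := h.solved.opt v hv
    rw [tgt_double] at this ⊢
    rwa [old _ (by omega)]
  · have := h.solved.mono v hv
    rw [tgt_double, tgt_double] at this ⊢
    rwa [old _ (by omega), old _ (by omega)]
  · rcases Nat.lt_succ_iff_lt_or_eq.1 hw with hw | rfl
    · rw [old _ (by omega)]
      exact h.mem w hw hj
    · rwa [Function.update_self]
  · rcases Nat.lt_succ_iff_lt_or_eq.1 hw with hw | rfl
    · rw [old _ (by omega)]
      exact h.opt w hw hj
    · rwa [Function.update_self]
  · rw [old (2 * w + 1) (by omega)]
    rcases Nat.lt_succ_iff_lt_or_eq.1 hw with hw | rfl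
    · rw [old _ (by omega)]
      exact h.next w hw hj
    · rw [Function.update_self]
      exact hnext hj
  · rw [old (2 * w + 1) (by omega)]
    rcases Nat.lt_succ_iff_lt_or_eq.1 hw with hw | rfl
    · rw [old _ (by omega)]
      exact h.prev w hw hj
    · rw [Function.update_self]
      exact hprev w rfl

/-- A row that is the best between the optimal rows of the neighbouring columns is optimal. -/
theorem opt_of_scan (hA : TotMono A lo N) (hca : lo ≤ ca) (hcajl : ca < jl) (hcb : ca ≤ cb)
    (hst : 1 ≤ st) (hN : jh ≤ N)
    (hlev : Level A ca cb jl jh L p q st) (hP : Solved A ca cb jl jh L p q P (2 * st))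
    {x₀ x b : ℕ} (hu : tgt jl st (2 * u) ≤ jh) (hpx : p ≤ x₀) (hxx : x₀ ≤ x) (hxq : x < q)
    (hx₀ : (u = 0 ∧ x₀ = p) ∨ ∃ w, u = w + 1 ∧ L x₀ = P (tgt jl st (2 * w + 1)))
    (hx : (tgt jl st (2 * u + 1) ≤ jh ∧ L x = P (tgt jl st (2 * u + 1))) ∨ x + 1 = q)
    (hbm : ca ≤ b ∧ b ≤ cb) (hb : ∀ k, x₀ ≤ k → k ≤ x → Dom A b (L k) (tgt jl st (2 * u))) :
    Opt A ca cb b (tgt jl st (2 * u)) := by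
  refine ⟨hbm, fun i hi hib => ?_⟩
  obtain ⟨k, hk, hkq, hd⟩ := hlev.cover _ hu i hi hib
  refine Dom.trans ?_ hd
  -- A row before `x₀` is no better than `L x₀` in the preceding solved column, hence none here by
  -- weak total monotonicity.
  rcases lt_or_ge k x₀ with hkx | hkx
  · refine (hb x₀ le_rfl hxx).trans ?_
    obtain ⟨w, rfl, hw⟩ := hx₀.resolve_left (by omega)
    have hj : tgt jl st (2 * w + 1) ≤ jh := (tgt_mono (by omega)).trans hu
    have ho := hP.opt w
    rw [tgt_double, ← hw] at ho
    have hlt : L x₀ < tgt jl st (2 * w + 1) :=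
      ((ho hj).2 ca le_rfl hcb (hcajl.trans_le (le_tgt hst))).1
    exact Dom.later hA (hca.trans (hlev.mem k hk hkq).1) (hlev.mono _ _ hk hkx (by omega)) hlt
      (tgt_mono (by omega)) (hu.trans hN)
      ((ho hj).2 _ (hlev.mem k hk hkq).1 (hlev.mem k hk hkq).2)
  rcases le_or_gt k x with hkx' | hkx'
  · exact hb k hkx hkx'
  -- A row after `x` does not beat `L x` in the next solved column, hence not in this earlier
  -- column.
  · refine (hb x hxx le_rfl).trans ?_
    obtain ⟨hj, hw⟩ := hx.resolve_right (by omega)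
    have ho := hP.opt u
    rw [tgt_double, ← hw] at ho
    exact dom_earlier hA (hca.trans (hlev.mem x (by omega) hxq).1)
      (hlev.mono _ _ (by omega) hkx' hkq) (tgt_mono (by omega)) (hj.trans hN)
      ((ho hj).2 _ (hlev.mem k hk hkq).1 (hlev.mem k hk hkq).2).not_win

end TotallyMonotone

/-- The entries of the arrays that are searched: lengths, and link numbers to break the ties. -/
noncomputable def key (mx : Bool) (c : ℕ → ℕ → ℝ) (F : ℕ → ℝ) (C : ℕ → ℕ) (i j : ℕ) : ℝ ×ₗ ℤ :=
  toLex (F i + c i j, if mx then -(C i : ℤ) else C i)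

/-- The Monge inequality bounds the difference of two rows in a later column by that in an earlier
one. If the lengths tie in the earlier column and the later row is not strictly shorter in the later
one, they tie there too. The second component does not depend on the column and decides both times
alike. -/
theorem totMono_key {s N : ℕ} {c : ℕ → ℕ → ℝ} (hc : IsMongeDAG s N c) (mx : Bool) (F : ℕ → ℝ)
    (C : ℕ → ℕ) : TotMono (key mx c F C) s N := by
  have monge : ∀ i i' j j', s ≤ i → i < i' → i' < j → j ≤ j' → j' ≤ N →
      c i j + c i' j' ≤ c i j' + c i' j := by
    intro i i' j j' hs hii hij hjj hN
    rcases hjj.eq_or_lt with rfl | hjj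
    · rfl
    · exact hc.2 i j' i' j ⟨hs, by show i < j'; omega, hN⟩
        ⟨by show s ≤ i'; omega, hij, by show j ≤ N; omega⟩ hii hjj
  constructor
  · intro i i' j j' hs hii hij hjj hN h
    have hm := monge i i' j j' hs hii hij hjj hN
    simp only [key, Prod.Lex.toLex_lt_toLex] at h ⊢
    rcases h with h | ⟨h, h'⟩
    · left
      linarith
    · rcases lt_or_ge (F i' + c i' j') (F i + c i j') with h1 | h1
      · exact .inl h1
      · exact .inr ⟨by linarith, h'⟩
  · intro i i' j j' hs hii hij hjj hN h
    have hm := monge i i' j j' hs hii hij hjj hN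
    simp only [key, Prod.Lex.toLex_le_toLex] at h ⊢
    rcases h with h | ⟨h, h'⟩
    · left
      linarith
    · rcases lt_or_ge (F i' + c i' j') (F i + c i j') with h1 | h1
      · exact .inl h1
      · exact .inr ⟨by linarith, h'⟩

end MongeProbe

namespace MongeProbe

/-! ### The row-minima program -/

notation "vA" => IVar.tmp 0
notation "vB" => IVar.tmp 1
notation "vJl" => IVar.tmp 2
notation "vJh" => IVar.tmp 3
notation "vLev" => IVar.tmp 4
notation "vP" => IVar.tmp 5
notation "vQ" => IVar.tmp 6
notation "vTop" => IVar.tmp 7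
notation "vX" => IVar.tmp 8
notation "vSt" => IVar.tmp 9
notation "vJt" => IVar.tmp 10
notation "vE" => IVar.tmp 11
notation "vBest" => IVar.tmp 12
notation "vCur" => IVar.tmp 13
notation "aF" => RArr.tmp 0
notation "aC" => IArr.tmp 0
notation "aP" => IArr.tmp 1
notation "aL" => IArr.tmp 2
notation "aO" => IArr.tmp 3

/-- The comparison of the entries in the rows `x` and `y` of column `j`. -/
def winTest (mx : Bool) (x y j : IExp) : BExp :=
  .and (.ilt x j) (.or
    (.rlt (.add (.get aF x) (.edge x j)) (.add (.get aF y) (.edge y j)))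
    (.and (.rle (.add (.get aF x) (.edge x j)) (.add (.get aF y) (.edge y j)))
      (.ilt (.get aC (if mx then y else x)) (.get aC (if mx then x else y)))))

variable {B : ℕ} {c : ℕ → ℕ → ℝ} {σ : State} {mx : Bool}

/-- The array that is searched. -/
noncomputable def State.key (σ : State) (mx : Bool) (c : ℕ → ℕ → ℝ) : ℕ → ℕ → ℝ ×ₗ ℤ :=
  MongeProbe.key mx c (σ.ra aF) (σ.ia aC)

theorem key_lt {F : ℕ → ℝ} {C : ℕ → ℕ} {x y j : ℕ} :
    key mx c F C x j < key mx c F C y j ↔ F x + c x j < F y + c y j ∨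
      (F x + c x j ≤ F y + c y j ∧ C (if mx then y else x) < C (if mx then x else y)) := by
  simp only [key, Prod.Lex.toLex_lt_toLex]
  have : ((if mx then -(C x : ℤ) else C x) < if mx then -(C y : ℤ) else C y) ↔
      C (if mx then y else x) < C (if mx then x else y) := by
    cases mx <;> simp
  rw [this]
  constructor
  · rintro (h | ⟨h, h'⟩)
    · exact .inl h
    · exact .inr ⟨h.le, h'⟩
  · rintro (h | ⟨h, h'⟩)
    · exact .inl h
    · exact h.lt_or_eq.imp id fun h => ⟨h, h'⟩

/-- The test is applied only with the later row as `x`, so `x < j` guarantees that both compared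
entries belong to edges. -/
theorem winTest_holds {x y j : IExp} : (winTest mx x y j).Holds c σ ↔
    Win (σ.key mx c) (x.eval σ) (y.eval σ) (j.eval σ) := by
  simp only [winTest, Win, State.key, key_lt, BExp.Holds, RExp.eval, IExp.eval]
  cases mx <;> rfl

theorem winTest_fits {x y j : IExp} (hx : x.Fits B σ) (hy : y.Fits B σ) (hj : j.Fits B σ)
    (hxB : x.eval σ ≤ B) (hyB : y.eval σ ≤ B) : (winTest mx x y j).Fits B σ := by
  cases mx <;> simp [winTest, *]

theorem winTest_cost {x y j : IExp} :
    (winTest mx x y j).cost = 6 * x.cost + 5 * y.cost + 5 * j.cost + 21 := by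
  cases mx <;> simp only [winTest, BExp.cost, RExp.cost, IExp.cost] <;> simp <;> ring

theorem AgreeOff.key_eq {l : List Region} {σ σ' : State} (h : AgreeOff l σ σ')
    (h₁ : decide (Region.ra aF ∉ l) = true := by rfl)
    (h₂ : decide (Region.ia aC ∉ l) = true := by rfl) : σ'.key mx c = σ.key mx c := by
  rw [State.key, State.key, h.ra_eq _ h₁, h.ia_eq _ h₂]

@[simp] theorem key_setI (x : IVar) (v : ℕ) : (σ.setI x v).key mx c = σ.key mx c := rfl

/-- Examine the next row of the list. -/
def reduceStep (mx : Bool) : Cmd := block [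
  .iset vCur (.get aL vX),
  .loop (.and (.ilt vQ vTop) (winTest mx vCur (.get aL (vTop - 1)) vJt)) (block [
    .iset vTop (vTop - 1), .iset vJt (vJt - vSt)]),
  .cond (.ile (vJt + vSt) vJh) (block [
    .iput aL vTop vCur, .iset vTop (vTop + 1), .iset vJt (vJt + vSt)]) .skip,
  .iset vX (vX + 1)]

/-- Thin out the list `p, …, q - 1` for the columns of the present stride. -/
def reduceLevel (mx : Bool) : Cmd := block [
  .iset vTop vQ, .iset vX vP, .iset vJt (vJl - 1),
  .loop (.ilt vX vQ) (reduceStep mx),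
  .iset vLev (vLev + 1), .iput aO vLev vQ, .iset vP vQ, .iset vQ vTop, .iset vSt (vSt + vSt)]

def reducePhase (mx : Bool) : Cmd := block [
  .iset vP 0, .iset vLev 0, .iset vSt 1,
  .loop (.ile (vJl + vSt) (vJh + 1)) (reduceLevel mx)]

/-- Solve the next column by a scan between the solutions of its neighbours. -/
def interpStep (mx : Bool) : Cmd := block [
  .cond (.ile (vJt + vSt) vJh) (.iset vE (.get aP (vJt + vSt))) (.iset vE (.get aL (vQ - 1))),
  .iset vBest (.get aL vX),
  .loop (.not (.ieq (.get aL vX) vE)) (block [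
    .iset vX (vX + 1),
    .cond (winTest mx (.get aL vX) vBest vJt) (.iset vBest (.get aL vX)) .skip]),
  .iput aP vJt vBest,
  .iset vJt (vJt + vSt + vSt)]

def interpLevel (mx : Bool) : Cmd := block [
  .iset vSt (.half vSt), .iset vX vP, .iset vJt (vJl + vSt - 1),
  .loop (.ile vJt vJh) (interpStep mx),
  .iset vQ vP, .iset vLev (vLev - 1), .iset vP (.get aO vLev)]

def interpPhase (mx : Bool) : Cmd := .loop (.ilt 0 vLev) (interpLevel mx)

def initList : Cmd := block [
  .iset vQ 0,
  forLoop vX vA vB (block [.iput aL vQ vX, .iset vQ (vQ + 1)])]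

/-- For each column `j` in `vJl, …, vJh`, find the best row in `vA, …, vB`. -/
def smawk (mx : Bool) : Cmd := block [initList, reducePhase mx, interpPhase mx]

/-- The memory in the course of the reduction of the list `L₀ p, …, L₀ (base - 1)`. -/
structure Reducing (A : ℕ → ℕ → ℝ ×ₗ ℤ) (jl jh st p base : ℕ) (L₀ : ℕ → ℕ) (x top : ℕ) (E : Set ℕ)
    (σ : State) : Prop where
  vTop_eq : σ.iv vTop = top
  jt_eq : σ.iv vJt + 1 = jl + (top - base) * st
  jt_le : σ.iv vJt ≤ jh
  base_le : base ≤ top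
  le_x : p ≤ x
  x_le : x ≤ base
  old : ∀ k, k < base → σ.ia aL k = L₀ k
  stack : Stack A jl jh st (σ.ia aL) base top {y | (∃ k, p ≤ k ∧ k < x ∧ L₀ k = y) ∨ y ∈ E} E

/-- The program variable `vJt` is the column attached to the top of the stack; with an empty stack
it is `jl - 1`, which is why the invariant adds one. -/
theorem Reducing.jt_eq_tgt {A : ℕ → ℕ → ℝ ×ₗ ℤ} {jl jh st p base : ℕ} {L₀ : ℕ → ℕ} {x top : ℕ}
    {E : Set ℕ} (h : Reducing A jl jh st p base L₀ x (top + 1) E σ) (hb : base ≤ top) :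
    σ.iv vJt = tgt jl st (top - base) := by
  have := h.jt_eq
  rw [tgt, show top - base + 1 = top + 1 - base by omega]
  omega

theorem Reducing.lt_of_mem {A : ℕ → ℕ → ℝ ×ₗ ℤ} {jl jh st p base ca cb k' : ℕ} {L₀ : ℕ → ℕ}
    {x top : ℕ} {E : Set ℕ} (h : Reducing A jl jh st p base L₀ x top E σ)
    (hL : Level A ca cb jl jh L₀ p base st) (hx : x < base) (hE : E ⊆ {L₀ x})
    (hk : base ≤ k') (hkt : k' < top) : σ.ia aL k' ≤ L₀ x := by
  rcases h.stack.mem k' hk hkt with ⟨k, h1, h2, h3⟩ | h3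
  · rw [← h3]
    exact (hL.mono k x h1 h2 hx).le
  · rw [hE h3]

/-- A step pushes at most one row, so the term `top + 1 - top'` counts the pops, up to one; the
caller charges them to earlier pushes. -/
theorem reduceStep_runs {A : ℕ → ℕ → ℝ ×ₗ ℤ} {s N ca cb jl jh st p base x top : ℕ} {L₀ : ℕ → ℕ}
    (hA : TotMono A s N) (hkey : σ.key mx c = A) (hca : s ≤ ca) (hcb : cb ≤ N) (hN : jh ≤ N)
    (hjl : 1 ≤ jl) (hst : 1 ≤ st) (hroom : jl + st ≤ jh + 1)
    (hL : Level A ca cb jl jh L₀ p base st)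
    (hJh : σ.iv vJh = jh) (hSt : σ.iv vSt = st) (hQ : σ.iv vQ = base)
    (hX : σ.iv vX = x) (hx : x < base) (hB : 4 * N ≤ B) (hB1 : 1 ≤ B) (htop : top + 1 ≤ B)
    (h : Reducing A jl jh st p base L₀ x top ∅ σ) :
    Runs B c (reduceStep mx) σ fun t σ' => ∃ top', Reducing A jl jh st p base L₀ (x + 1) top' ∅ σ' ∧
      top' ≤ top + 1 ∧ σ'.iv vX = x + 1 ∧ t ≤ 80 * (top + 1 - top') + 100 := by
  have hcur : σ.ia aL x = L₀ x := h.old x hx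
  have hmemx := hL.mem x h.le_x hx
  have htb := h.base_le
  have hlx := h.le_x
  refine .cons (.iset (by simp; omega) (.cons (.while
    (fun σ' φ => ∃ tp, Reducing A jl jh st p base L₀ x tp {L₀ x} σ' ∧
      (∀ k, base ≤ k → k < tp → σ'.ia aL k < L₀ x) ∧ tp ≤ top ∧ φ = 80 * tp)
    (80 * top) ?_ ?_ ?_ ?_)))
  · refine ⟨top, ⟨by simpa using h.vTop_eq, by simpa using h.jt_eq, by simpa using h.jt_le, h.base_le,
      h.le_x, h.x_le, h.old, ?_⟩, fun k h1 h2 => ?_, le_rfl, rfl⟩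
    · have := h.stack.start (L₀ x)
      refine cast (congrArg (fun S => Stack A jl jh st _ base top S _) ?_) this
      ext y
      simp [or_comm]
    · rcases h.stack.mem k h1 h2 with ⟨k', h3, h4, h5⟩ | h5
      · show σ.ia aL k < _
        rw [← h5]
        exact hL.mono k' x h3 h4 hx
      · exact h5.elim
  · rintro σ' φ ha ⟨tp, hr, hlt, htp, rfl⟩
    have e1 : σ'.iv vCur = L₀ x := by
      rw [ha.iv_eq vCur]
      simp [hX, hcur]
    have e2 : σ'.iv vTop = tp := hr.vTop_eq
    have hb := hr.base_le
    -- Capacity is required of both conjuncts of the guard, even when the stack is empty. The cell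
    -- read then is the last one of the old list.
    have hlast : σ'.ia aL (tp - 1) ≤ B := by
      rcases hb.eq_or_lt with h1 | h1
      · rw [← h1, hr.old _ (by omega)]
        have := hL.mem (base - 1) (by omega) (by omega)
        omega
      · have := hr.lt_of_mem hL hx subset_rfl (k' := tp - 1) (by omega) (by omega)
        omega
    refine ⟨by simp, winTest_fits (by simp) (by simp [e2]; omega) (by simp) ?_ ?_⟩
    · simp [e1]
      omega
    · simpa [e2] using hlast
  · rintro σ' φ ha ⟨tp, hr, hlt, htp, rfl⟩ ⟨hb, hw⟩
    rw [winTest_holds, (ha.key_eq : σ'.key mx c = _)] at hw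
    have e1 : σ'.iv vCur = L₀ x := by
      rw [ha.iv_eq vCur]
      simp [hX, hcur]
    have e2 : σ'.iv vTop = tp := hr.vTop_eq
    have e3 : σ'.iv vQ = base := (ha.iv_eq _).trans hQ
    have e4 : σ'.iv vSt = st := (ha.iv_eq _).trans hSt
    simp only [BExp.Holds, IExp.eval, e2, e3] at hb
    obtain ⟨tp, rfl⟩ := Nat.exists_eq_add_of_lt hb
    have hjt := hr.jt_eq_tgt (by omega)
    have hkey' : (σ.setI vCur ((IExp.get aL vX).eval σ)).key mx c = A := hkey
    rw [hkey'] at hw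
    simp only [IExp.eval, IExp.eval_sub, e1, e2, Nat.add_sub_cancel, hjt] at hw
    refine .cons (.iset (by simp; omega) (.cons (.iset (by simp) (.nil ⟨_, ⟨base + tp, ?_, ?_,
      by omega, rfl⟩, ?_⟩))))
    · refine ⟨by simp [e2], ?_, ?_, by omega, hr.le_x, hr.x_le, hr.old, ?_⟩
      · have := hr.jt_eq
        rw [show base + tp + 1 - base = tp + 1 by omega, add_mul, one_mul] at this
        simp [e4]
        omega
      · have := hr.jt_le
        simp
        omega
      · exact hr.stack.pop hA hN (by
          rintro y (⟨k, h1, h2, rfl⟩ | rfl)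
          · exact hca.trans (hL.mem k h1 (by omega)).1
          · omega) (by omega) (hlt _ (by omega) (by omega)) (by exact hw) (hjt ▸ hr.jt_le)
    · exact fun k h1 h2 => hlt k h1 (by omega)
    · simp [winTest_cost]
      omega
  · rintro σ' φ t ha ⟨tp, hr, hlt, htp, rfl⟩ hnb ht
    have e1 : σ'.iv vCur = L₀ x := by
      rw [ha.iv_eq vCur]
      simp [hX, hcur]
    have e2 : σ'.iv vTop = tp := hr.vTop_eq
    have e3 : σ'.iv vQ = base := (ha.iv_eq _).trans hQ
    have e4 : σ'.iv vSt = st := (ha.iv_eq _).trans hSt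
    have e5 : σ'.iv vX = x := (ha.iv_eq _).trans hX
    have e6 : σ'.iv vJh = jh := (ha.iv_eq _).trans hJh
    have hkey' : (σ.setI vCur ((IExp.get aL vX).eval σ)).key mx c = A := hkey
    have hb := hr.base_le
    have hjt := hr.jt_eq
    have hjtl := hr.jt_le
    have hnw : base < tp →
        ¬ Win A (L₀ x) (σ'.ia aL (tp - 1)) (tgt jl st (tp - 1 - base)) := by
      intro hlt' hw
      refine hnb ⟨by simpa [e2, e3] using hlt', ?_⟩
      rw [winTest_holds, (ha.key_eq : σ'.key mx c = _), hkey']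
      obtain ⟨tp, rfl⟩ := Nat.exists_eq_add_of_le' (show 1 ≤ tp by omega)
      have := hr.jt_eq_tgt (by omega)
      simpa [e1, e2, this] using hw
    have hX' : {y | (∃ k, p ≤ k ∧ k < x ∧ L₀ k = y) ∨ y ∈ ({L₀ x} : Set ℕ)} =
        {y | (∃ k, p ≤ k ∧ k < x + 1 ∧ L₀ k = y) ∨ y ∈ (∅ : Set ℕ)} := by
      ext y
      simp only [Set.mem_ofPred_eq, Set.mem_singleton_iff, Set.mem_empty_iff_false, or_false]
      constructor
      · rintro (⟨k, h1, h2, h3⟩ | rfl)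
        · exact ⟨k, h1, by omega, h3⟩
        · exact ⟨x, by omega, by omega, rfl⟩
      · rintro ⟨k, h1, h2, h3⟩
        rcases Nat.lt_succ_iff_lt_or_eq.1 h2 with h2 | rfl
        · exact .inl ⟨k, h1, h2, h3⟩
        · exact .inr h3.symm
    have hstack := hr.stack
    rw [hX'] at hstack
    have cost : (BExp.and (.ilt vQ vTop) (winTest mx vCur (.get aL (vTop - 1)) vJt)).cost = 56 := by
      simp [winTest_cost]
    rw [cost] at ht
    refine .cons (.cond (by simp [e4]; omega) (fun hc => ?_) fun hc => ?_)
    · simp only [BExp.Holds, IExp.eval, e4, e6] at hc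
      refine .cons (.iput (by simp) (by simp; omega) (by simp) ?_)
      refine .cons (.iset (by simp; omega) (.cons (.iset (by simp [e4]; omega) (.nil ?_))))
      refine .cons (.iset (by simp [e5]; omega) (.nil ⟨tp + 1, ?_, by omega, by simp [e5], ?_⟩))
      · have es : (tp + 1 - base) * st = (tp - base) * st + st := by
          rw [show tp + 1 - base = tp - base + 1 by omega]
          ring
        refine ⟨by simp [e2], by simp [e4]; omega, by simp [e4]; omega, by omega, by omega, by omega,
          fun k hk => ?_, ?_⟩
        · simp [e2, Function.update_of_ne (show k ≠ tp by omega), hr.old k hk]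
        · have := hstack.push (x := L₀ x) (by omega) hlt (.inl ⟨x, by omega, by omega, rfl⟩) hnw
          simpa [e1, e2] using this
      · simp
        omega
    · simp only [BExp.Holds, IExp.eval, e4, e6] at hc
      refine .skip (.cons (.iset (by simp [e5]; omega) (.nil
        ⟨tp, ?_, by omega, by simp [e5], ?_⟩)))
      · have hlt' : base < tp := by
          rcases hb.lt_or_eq with h1 | rfl
          · exact h1
          · simp at hjt
            omega
        obtain ⟨tp, rfl⟩ := Nat.exists_eq_add_of_le' (show 1 ≤ tp by omega)
        have hj := hr.jt_eq_tgt (by omega)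
        refine ⟨by simpa using e2, by simpa using hjt, by simpa using hjtl, by omega, by omega,
          by omega, hr.old, ?_⟩
        refine hstack.discard (x := L₀ x) hA hN ?_ (by omega) hlt (hnw (by omega)) ?_ ?_
        · rintro y (⟨k, h1, h2, rfl⟩ | h1)
          · exact hca.trans (hL.mem k h1 (by omega)).1
          · exact h1.elim
        · rw [Nat.add_sub_cancel, ← hj]
          exact hjtl
        · rw [show tp + 1 - base = tp - base + 1 by omega, tgt_succ hst, ← hj]
          omega
      · simp
        omega

end MongeProbe

/-! ### Reduction: levels of doubling stride -/

namespace MongeProbe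
variable {B : ℕ} {c : ℕ → ℕ → ℝ} {σ : State} {mx : Bool}

/-- Potential: 190 per row still to be examined and 80 per row on the stack, so that pops are paid
for by pushes. The stack never holds more rows than there are columns of the present stride. -/
theorem reduceLevel_runs {A : ℕ → ℕ → ℝ ×ₗ ℤ} {s N ca cb jl jh st p q lev : ℕ}
    (hA : TotMono A s N) (hkey : σ.key mx c = A) (hca : s ≤ ca) (hcb : cb ≤ N) (hN : jh ≤ N)
    (hjl : 1 ≤ jl) (hst : 1 ≤ st) (hroom : jl + st ≤ jh + 1)
    (hL : Level A ca cb jl jh (σ.ia aL) p q st) (hpq : p ≤ q)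
    (hT : Tower A ca cb jl jh (σ.ia aL) (σ.ia aO) lev q st) (hoff : 1 ≤ lev → σ.ia aO lev = p)
    (hJl : σ.iv vJl = jl) (hJh : σ.iv vJh = jh) (hSt : σ.iv vSt = st) (hP : σ.iv vP = p)
    (hQ : σ.iv vQ = q) (hLev : σ.iv vLev = lev) (hB : 4 * N ≤ B) (hB1 : 1 ≤ B)
    (hqB : q + (jh + 1 - jl) / st + 1 ≤ B) (hlevB : lev + 1 ≤ B) :
    Runs B c (reduceLevel mx) σ fun t σ' => ∃ q', q ≤ q' ∧ q' ≤ q + (jh + 1 - jl) / st ∧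
      σ'.iv vSt = 2 * st ∧ σ'.iv vP = q ∧ σ'.iv vQ = q' ∧ σ'.iv vLev = lev + 1 ∧
      Level A ca cb jl jh (σ'.ia aL) q q' st ∧ σ'.ia aO (lev + 1) = q ∧
      Tower A ca cb jl jh (σ'.ia aL) (σ'.ia aO) (lev + 1) q' (2 * st) ∧
      t ≤ 190 * (q - p) + 50 := by
  have hR : ∀ {top : ℕ}, q ≤ top → (top - q) * st ≤ jh + 1 - jl →
      top ≤ q + (jh + 1 - jl) / st := by
    intro top h1 h2
    have := (Nat.le_div_iff_mul_le hst).2 h2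
    omega
  refine .cons (.iset (by simp) (.cons (.iset (by simp) (.cons (.iset (by simp; omega) (.cons
    (.while (fun σ' φ => ∃ x top, Reducing A jl jh st p q (σ.ia aL) x top ∅ σ' ∧ σ'.iv vX = x ∧
      φ = 190 * (q - x) + 80 * (top - q)) (190 * (q - p)) ?_ ?_ ?_ ?_)))))))
  · refine ⟨p, q, ⟨by simp [hQ], by simp [hJl]; omega, by simp [hJl]; omega, le_rfl, le_rfl, hpq,
      fun _ _ => rfl, ?_⟩, by simp [hP], by simp⟩
    refine cast (congrArg (fun S => Stack A jl jh st _ q q S _) ?_) (Stack.empty A jl jh st _ q)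
    ext y
    simp only [Set.mem_empty_iff_false, Set.mem_ofPred_eq, or_false, false_iff]
    rintro ⟨k, h1, h2, -⟩
    omega
  · rintro σ' φ ha -
    simp
  · rintro σ' φ ha ⟨x, top, hr, hx, rfl⟩ hb
    have e1 : σ'.iv vJh = jh := (ha.iv_eq _).trans hJh
    have e2 : σ'.iv vSt = st := (ha.iv_eq _).trans hSt
    have e3 : σ'.iv vQ = q := (ha.iv_eq _).trans hQ
    simp only [BExp.Holds, IExp.eval, hx, e3] at hb
    have hk : σ'.key mx c = A := ha.key_eq.trans hkey
    have htop := hR hr.base_le (by have := hr.jt_eq; have := hr.jt_le; omega)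
    refine (reduceStep_runs hA hk hca hcb hN hjl hst hroom hL e1 e2 e3 hx hb hB hB1 (by omega)
      hr).mono ?_
    rintro t σ'' ⟨top', hr', htop', hx', ht⟩
    refine ⟨_, ⟨x + 1, top', hr', hx', rfl⟩, ?_⟩
    have := hr'.base_le
    have := hr.base_le
    simp
    omega
  · rintro σ' φ t ha ⟨x, top, hr, hx, rfl⟩ hb ht
    have e2 : σ'.iv vSt = st := (ha.iv_eq _).trans hSt
    have e3 : σ'.iv vQ = q := (ha.iv_eq _).trans hQ
    have e4 : σ'.iv vLev = lev := (ha.iv_eq _).trans hLev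
    have e5 : σ'.iv vTop = top := hr.vTop_eq
    have e6 : σ'.ia aO = σ.ia aO := ha.ia_eq _
    simp only [BExp.Holds, IExp.eval, hx, e3] at hb
    obtain rfl : x = q := by have := hr.x_le; omega
    have htop := hR hr.base_le (by have := hr.jt_eq; have := hr.jt_le; omega)
    have hb := hr.base_le
    have hstB : st + st ≤ B := by omega
    refine .cons (.iset (by simp [e4]; omega) (.cons (.iput (by simp) (by simp [e4]; omega) (by simp)
      (.cons (.iset (by simp) (.cons (.iset (by simp) ?_)))))))
    refine .cons (.iset (by simp [e2]; omega) (.nil ?_))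
    have hlev' : Level A ca cb jl jh (σ'.ia aL) x top st :=
      hr.stack.level (hL.congr hr.old) fun y => by
        simp only [Set.mem_empty_iff_false, Set.mem_ofPred_eq, or_false]
        refine exists_congr fun k => and_congr_right fun _ => and_congr_right fun h => ?_
        rw [hr.old k h]
    have hT' : Tower A ca cb jl jh (σ'.ia aL) (Function.update (σ.ia aO) (lev + 1) x) lev x st :=
      hT.congr hr.old fun t ht => Function.update_of_ne (by omega) _ _
    refine ⟨top, hb, htop, by simp [e2]; omega, by simp [e3], by simp [e5], by simp [e4],
      by simpa using hlev', by simp [e4, e3], ?_, ?_⟩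
    · simp [e3, e4, e6]
      refine .succ hT' hb (by simp) hlev' fun h1 k h2 h3 => ?_
      obtain ⟨k', h4, h5, h6⟩ | h := hr.stack.mem k h2 h3
      · refine ⟨k', ?_, h5, ?_⟩
        · rw [Function.update_of_ne (by omega), hoff h1]
          exact h4
        · rw [hr.old _ h5, h6]
      · exact h.elim
    · simp at ht ⊢
      omega

theorem level_full {A : ℕ → ℕ → ℝ ×ₗ ℤ} {ca cb jl jh : ℕ} {L : ℕ → ℕ}
    (hL : ∀ k, k < cb + 1 - ca → L k = ca + k) : Level A ca cb jl jh L 0 (cb + 1 - ca) 1 := by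
  refine ⟨fun k k' _ h1 h2 => ?_, fun k _ h => ?_, fun v _ i h1 h2 => ⟨i - ca, by omega, by omega, ?_⟩⟩
  · rw [hL _ (by omega), hL _ h2]
    omega
  · rw [hL _ h]
    omega
  · rw [hL _ (by omega), Nat.add_sub_cancel' h1]
    exact .refl _ _ _

/-- After the first level a list has at most as many rows as the columns of the preceding stride,
and this number halves. The total time and the total length of all lists are therefore linear; the
term `600 * ((jh + 1 - jl) / st)` prepays the shorter lists. -/
theorem reducePhase_runs {A : ℕ → ℕ → ℝ ×ₗ ℤ} {s N ca cb jl jh : ℕ}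
    (hA : TotMono A s N) (hkey : σ.key mx c = A) (hca : s ≤ ca) (hcab : ca ≤ cb) (hcb : cb ≤ N)
    (hN : jh ≤ N) (hjl : ca < jl) (hjh : jl ≤ jh) (hJl : σ.iv vJl = jl) (hJh : σ.iv vJh = jh)
    (hQ : σ.iv vQ = cb + 1 - ca) (hB : 8 * N ≤ B)
    (hL : ∀ k, k < cb + 1 - ca → σ.ia aL k = ca + k) :
    Runs B c (reducePhase mx) σ fun t σ' => ∃ lev q st,
      Tower A ca cb jl jh (σ'.ia aL) (σ'.ia aO) lev q st ∧ σ'.iv vLev = lev ∧ σ'.iv vQ = q ∧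
      σ'.iv vSt = st ∧ (1 ≤ lev → σ'.ia aO lev = σ'.iv vP) ∧ jh < tgt jl st 0 ∧
      st ≤ 2 * (jh + 1 - jl) ∧ q ≤ (cb + 1 - ca) + 2 * (jh + 1 - jl) ∧
      t ≤ 200 * (cb + 1 - ca) + 600 * (jh + 1 - jl) + 50 := by
  refine .cons (.iset (by simp) (.cons (.iset (by simp) (.cons (.iset (by simp; omega) (.cons
    (.while (fun σ' φ => ∃ lev p q st, Level A ca cb jl jh (σ'.ia aL) p q st ∧
      Tower A ca cb jl jh (σ'.ia aL) (σ'.ia aO) lev q st ∧ (1 ≤ lev → σ'.ia aO lev = p) ∧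
      σ'.iv vLev = lev ∧ σ'.iv vP = p ∧ σ'.iv vQ = q ∧ σ'.iv vSt = st ∧ p ≤ q ∧ lev + 1 ≤ st ∧
      st ≤ 2 * (jh + 1 - jl) ∧
      q + 2 * ((jh + 1 - jl) / st) ≤ (cb + 1 - ca) + 2 * (jh + 1 - jl) ∧
      φ = 200 * (q - p) + 600 * ((jh + 1 - jl) / st))
      (200 * (cb + 1 - ca) + 600 * (jh + 1 - jl)) ?_ ?_ ?_ ?_)))))))
  · exact ⟨0, 0, cb + 1 - ca, 1, level_full hL, .zero _, by omega, by simp, by simp, by simpa using hQ,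
      by simp, by omega, by omega, by omega, by simp, by simp⟩
  · rintro σ' φ ha ⟨lev, p, q, st, h1, h2, h3, h4, h5, h6, h7, h8, h9, h10, h11, -⟩
    have e1 : σ'.iv vJl = jl := (ha.iv_eq _).trans hJl
    have e2 : σ'.iv vJh = jh := (ha.iv_eq _).trans hJh
    simp [e1, e2, h7]
    omega
  · rintro σ' φ ha ⟨lev, p, q, st, h1, h2, h3, h4, h5, h6, h7, h8, h9, h10, h11, rfl⟩ hb
    have e1 : σ'.iv vJl = jl := (ha.iv_eq _).trans hJl
    have e2 : σ'.iv vJh = jh := (ha.iv_eq _).trans hJh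
    simp only [BExp.Holds, IExp.eval, e1, e2, h7] at hb
    have hk : σ'.key mx c = A := ha.key_eq.trans hkey
    have hR : 1 ≤ (jh + 1 - jl) / st := (Nat.le_div_iff_mul_le (by omega)).2 (by omega)
    refine (reduceLevel_runs hA hk hca hcb hN (by omega) (by omega) hb h1 h8 h2 h3 e1 e2 h7 h5 h6 h4
      (by omega) (by omega) (by omega) (by omega)).mono ?_
    rintro t σ'' ⟨q', g1, g2, g3, g4, g5, g6, g7, g8, g9, g10⟩
    have hdiv : (jh + 1 - jl) / (2 * st) = (jh + 1 - jl) / st / 2 := by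
      rw [Nat.div_div_eq_div_mul, mul_comm]
    refine ⟨_, ⟨lev + 1, q, q', 2 * st, g7.double, g9, fun _ => g8, g6, g4, g5, g3, g1, by omega,
      by omega, ?_, rfl⟩, ?_⟩
    · rw [hdiv]
      omega
    · rw [hdiv]
      simp
      omega
  · rintro σ' φ t ha ⟨lev, p, q, st, h1, h2, h3, h4, h5, h6, h7, h8, h9, h10, h11, rfl⟩ hb ht
    have e1 : σ'.iv vJl = jl := (ha.iv_eq _).trans hJl
    have e2 : σ'.iv vJh = jh := (ha.iv_eq _).trans hJh
    simp only [BExp.Holds, IExp.eval, e1, e2, h7] at hb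
    refine .nil ⟨lev, q, st, h2, h4, h6, h7, fun h => (h3 h).trans h5.symm, ?_, h10,
      by omega, ?_⟩
    · rw [tgt_zero]
      omega
    · simp at ht ⊢
      omega

end MongeProbe

/-! ### Interpolation on the way back -/

namespace MongeProbe
variable {B : ℕ} {c : ℕ → ℕ → ℝ} {σ : State} {mx : Bool}

theorem interpStep_runs {A : ℕ → ℕ → ℝ ×ₗ ℤ} {s N ca cb jl jh st p q u x : ℕ}
    (hA : TotMono A s N) (hkey : σ.key mx c = A) (hca : s ≤ ca) (hcab : ca ≤ cb) (hcb : cb ≤ N)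
    (hN : jh ≤ N) (hjl : ca < jl) (hst : 1 ≤ st) (hstN : st ≤ 2 * N)
    (hL : Level A ca cb jl jh (σ.ia aL) p q st)
    (hI : Interp A ca cb jl jh (σ.ia aL) p q (σ.ia aP) st u)
    (hJh : σ.iv vJh = jh) (hSt : σ.iv vSt = st) (hQ : σ.iv vQ = q) (hX : σ.iv vX = x)
    (hJt : σ.iv vJt = tgt jl st (2 * u)) (hu : tgt jl st (2 * u) ≤ jh) (hpx : p ≤ x) (hxq : x < q)
    (hx : (u = 0 ∧ x = p) ∨ ∃ w, u = w + 1 ∧ σ.ia aL x = σ.ia aP (tgt jl st (2 * w + 1)))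
    (hB : 8 * N ≤ B) (hB1 : 1 ≤ B) (hqB : q ≤ B) :
    Runs B c (interpStep mx) σ fun t σ' => ∃ x', x ≤ x' ∧ x' < q ∧ σ'.iv vX = x' ∧
      Interp A ca cb jl jh (σ'.ia aL) p q (σ'.ia aP) st (u + 1) ∧
      σ'.iv vJt = tgt jl st (2 * (u + 1)) ∧
      (tgt jl st (2 * (u + 1)) ≤ jh → σ'.ia aL x' = σ'.ia aP (tgt jl st (2 * u + 1))) ∧
      t ≤ 80 * (x' - x) + 50 := by
  have hnext : tgt jl st (2 * u + 1) = tgt jl st (2 * u) + st := tgt_succ hst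
  have hnext' : tgt jl st (2 * (u + 1)) = tgt jl st (2 * u) + st + st := by
    rw [show 2 * (u + 1) = 2 * u + 1 + 1 by ring, tgt_succ hst, tgt_succ hst]
  have hLB : ∀ k, p ≤ k → k < q → σ.ia aL k ≤ B := fun k h1 h2 => by
    have := hL.mem k h1 h2
    omega
  -- The scan stops at the optimal row of the next solved column, or at the last row of the list
  -- when no such column exists.
  obtain ⟨e, xe, hxe, hxeq, hLe, hor, hrun⟩ : ∃ e xe, x ≤ xe ∧ xe < q ∧ σ.ia aL xe = e ∧
      ((tgt jl st (2 * u + 1) ≤ jh ∧ e = σ.ia aP (tgt jl st (2 * u + 1))) ∨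
        (jh < tgt jl st (2 * u + 1) ∧ xe + 1 = q)) ∧
      Runs B c (.cond (.ile (vJt + vSt) vJh) (.iset vE (.get aP (vJt + vSt)))
        (.iset vE (.get aL (vQ - 1)))) σ fun t σ' => σ' = σ.setI vE e ∧ t ≤ 12 := by
    rcases le_or_gt (tgt jl st (2 * u + 1)) jh with hj | hj
    · have hm := hI.solved.mem u
      rw [tgt_double] at hm
      obtain ⟨k, h1, h2, h3⟩ := hm hj
      refine ⟨_, k, ?_, h2, h3, .inl ⟨hj, rfl⟩, .cond ?_ (fun hb => ?_) fun hb => ?_⟩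
      · rcases hx with ⟨-, rfl⟩ | ⟨w, rfl, hw⟩
        · exact h1
        · by_contra! hlt
          have h4 := hL.mono _ _ h1 hlt hxq
          have h5 := hI.solved.mono w
          rw [tgt_double, tgt_double, ← h3, ← hw] at h5
          have := h5 hj
          omega
      · simp [hJt, hSt]
        omega
      · refine .iset (by simp [hJt, hSt]; omega) ⟨?_, by simp⟩
        simp [hJt, hSt, hnext]
      · exfalso
        simp [hJt, hSt, hJh] at hb
        omega
    · refine ⟨_, q - 1, by omega, by omega, rfl, .inr ⟨hj, by omega⟩, .cond ?_ (fun hb => ?_)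
        fun hb => ?_⟩
      · simp [hJt, hSt]
        omega
      · exfalso
        simp [hJt, hSt, hJh] at hb
        omega
      · exact .iset (by simp [hQ]; omega) ⟨by simp [hQ], by simp⟩
  refine .cons (hrun.mono ?_)
  rintro t₀ _ ⟨rfl, ht₀⟩
  refine .cons (.iset (by simp [hX]; omega) (.cons (.while (fun σ' φ => ∃ x' b, σ'.iv vX = x' ∧
    σ'.iv vBest = b ∧ x ≤ x' ∧ x' ≤ xe ∧ (∃ k, x ≤ k ∧ k ≤ x' ∧ σ.ia aL k = b) ∧
    (∀ k, x ≤ k → k ≤ x' → Dom A b (σ.ia aL k) (tgt jl st (2 * u))) ∧ φ = 80 * (xe - x'))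
    (80 * (xe - x)) ?_ ?_ ?_ ?_)))
  · refine ⟨x, σ.ia aL x, by simp [hX], by simp [hX], le_rfl, hxe, ⟨x, le_rfl, le_rfl, rfl⟩,
      fun k h1 h2 => ?_, rfl⟩
    obtain rfl : x = k := by omega
    exact .refl _ _ _
  · rintro σ' φ ha ⟨x', b, h1, h2, h3, h4, h5, h6, rfl⟩
    simp [h1]
    omega
  · rintro σ' φ ha ⟨x', b, h1, h2, h3, h4, ⟨kb, h5, h5', h5''⟩, h6, rfl⟩ hb
    have e1 : σ'.ia aL = σ.ia aL := ha.ia_eq _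
    have e2 : σ'.iv vE = e := ha.iv_eq _
    have e3 : σ'.iv vJt = tgt jl st (2 * u) := (ha.iv_eq _).trans hJt
    have hk : σ'.key mx c = A := ha.key_eq.trans hkey
    have hlt : x' < xe := by
      rcases h4.lt_or_eq with h | rfl
      · exact h
      · exact absurd (by simp [e1, e2, h1, hLe]) hb
    have hbB : b ≤ B := h5'' ▸ hLB kb (by omega) (by omega)
    have hbL : b < σ.ia aL (x' + 1) := by
      rw [← h5'']
      exact hL.mono _ _ (by omega) (by omega) (by omega)
    have hbm : s ≤ b := by
      have := hL.mem kb (by omega) (by omega)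
      omega
    have hLB' := hLB (x' + 1) (by omega) (by omega)
    refine .cons (.iset (by simp [h1]; omega) (.cons (.cond (winTest_fits (by simp [h1]; omega)
      (by simp) (by simp) (by simpa [h1, e1] using hLB') (by simpa [h2] using hbB))
      (fun hw => ?_) fun hw => ?_)))
    · rw [winTest_holds] at hw
      have hw' : Win A (σ.ia aL (x' + 1)) b (tgt jl st (2 * u)) := by
        rw [← hk]
        simpa [h1, h2, e1, e3] using hw
      refine .iset (by simp [h1]; omega) (.nil ⟨_, ⟨x' + 1, σ.ia aL (x' + 1), by simp [h1],
        by simp [h1, e1], by omega, by omega, ⟨x' + 1, by omega, by omega, rfl⟩, fun k g1 g2 => ?_,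
        rfl⟩, ?_⟩)
      · rcases Nat.lt_succ_iff_lt_or_eq.1 (Nat.lt_succ_of_le g2) with g2 | rfl
        · exact hw'.dom.trans (h6 k g1 (by omega))
        · exact .refl _ _ _
      · simp [winTest_cost]
        omega
    · rw [winTest_holds] at hw
      have hw' : ¬ Win A (σ.ia aL (x' + 1)) b (tgt jl st (2 * u)) := by
        rw [← hk]
        simpa [h1, h2, e1, e3] using hw
      refine .skip (.nil ⟨_, ⟨x' + 1, b, by simp [h1],
        by simp [h2], by omega, by omega, ⟨kb, by omega, by omega, h5''⟩, fun k g1 g2 => ?_,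
        rfl⟩, ?_⟩)
      · rcases Nat.lt_succ_iff_lt_or_eq.1 (Nat.lt_succ_of_le g2) with g2 | rfl
        · exact h6 k g1 (by omega)
        · exact dom_earlier hA hbm hbL le_rfl (hu.trans hN) hw'
      · simp [winTest_cost]
        omega
  · rintro σ' φ t ha ⟨x', b, h1, h2, h3, h4, ⟨kb, h5, h5', h5''⟩, h6, rfl⟩ hb ht
    have e1 : σ'.ia aL = σ.ia aL := ha.ia_eq _
    have e2 : σ'.iv vE = e := ha.iv_eq _
    have e3 : σ'.iv vJt = tgt jl st (2 * u) := (ha.iv_eq _).trans hJt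
    have e4 : σ'.iv vSt = st := (ha.iv_eq _).trans hSt
    have e5 : σ'.ia aP = σ.ia aP := ha.ia_eq _
    -- The rows of a list are strictly increasing, so equal row numbers mean equal positions.
    have hxe' : x' = xe := by
      rcases h4.lt_or_eq with h | h
      · have hlt := hL.mono _ _ (by omega) h hxeq
        simp [e1, e2, h1] at hb
        omega
      · exact h
    subst hxe'
    refine .cons (.iput (by simp) (by simp [e3]; omega) (by simp) (.cons (.iset (by
      simp [e3, e4]; omega) (.nil ?_))))
    refine ⟨x', h3, hxeq, by simp [h1], ?_, ?_, fun hj => ?_, ?_⟩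
    · have := hI.update (b := b) hst ⟨kb, by omega, by omega, h5''⟩ ?_ ?_ ?_
      · simpa [e1, e3, e5, h2] using this
      · exact opt_of_scan hA hca hjl hcab hst hN hL hI.solved hu hpx h3 hxeq hx
          (hor.imp (fun h => ⟨h.1, hLe.trans h.2⟩) (·.2))
          (h5'' ▸ hL.mem kb (by omega) (by omega)) h6
      · intro hj
        rw [← (hor.resolve_right fun h => by omega).2, ← hLe, ← h5'']
        exact hL.le_of_le (by omega) h5' hxeq
      · rintro w rfl
        obtain ⟨w', hw', hw⟩ := hx.resolve_left fun h => by omega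
        obtain rfl : w = w' := by omega
        rw [← hw, ← h5'']
        exact hL.le_of_le hpx h5 (by omega)
    · simp [e3, e4, hnext']
    · have : tgt jl st (2 * u + 1) ≠ tgt jl st (2 * u) := by omega
      simp only [setI_ia, putI_ia, if_true, IExp.eval, e3]
      rw [Function.update_of_ne this, if_neg (by simp), e1, e5, hLe]
      exact (hor.resolve_right fun h => by omega).2
    · simp at ht ⊢
      omega

/-- Consecutive scans share only an end point, because the optimal rows of the solved columns are
monotone. Their total length is thus at most the number of rows, with constant overhead per
interpolated column. -/
theorem interpLevel_runs {A : ℕ → ℕ → ℝ ×ₗ ℤ} {s N ca cb jl jh st p q lev : ℕ}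
    (hA : TotMono A s N) (hkey : σ.key mx c = A) (hca : s ≤ ca) (hcab : ca ≤ cb) (hcb : cb ≤ N)
    (hN : jh ≤ N) (hjl : ca < jl) (hjh : jl ≤ jh) (hst : 1 ≤ st) (hroom : jl + st ≤ jh + 1)
    (hL : Level A ca cb jl jh (σ.ia aL) p q st)
    (hP : Solved A ca cb jl jh (σ.ia aL) p q (σ.ia aP) (2 * st))
    (hJl : σ.iv vJl = jl) (hJh : σ.iv vJh = jh) (hSt : σ.iv vSt = 2 * st) (hQ : σ.iv vQ = q)
    (hp : σ.iv vP = p) (hLev : σ.iv vLev = lev + 1)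
    (hB : 8 * N ≤ B) (hB1 : 1 ≤ B) (hqB : q ≤ B) (hlB : lev ≤ B) :
    Runs B c (interpLevel mx) σ fun t σ' => Solved A ca cb jl jh (σ'.ia aL) p q (σ'.ia aP) st ∧
      σ'.iv vSt = st ∧ σ'.iv vQ = p ∧ σ'.iv vLev = lev ∧ σ'.iv vP = σ.ia aO lev ∧
      t ≤ 80 * (q - p) + 60 * ((jh + 1 - jl) / st) + 50 := by
  have hu0 : tgt jl st 0 ≤ jh := by
    rw [tgt_zero]
    omega
  have hpq : p < q := by
    obtain ⟨k, h1, h2, -⟩ := hL.cover 0 hu0 ca le_rfl hcab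
    omega
  have e0 : ∀ τ : State, τ.iv vSt = 2 * st → (IExp.half vSt).eval τ = st := fun τ h => by
    simp [h]
  refine .cons (.iset (by simp) (.cons (.iset (by simp) (.cons (.iset (by
    simp [hJl, hSt]; omega) (.cons ?_))))))
  rw [e0 σ hSt]
  refine .while (fun σ' φ => ∃ u x, σ'.iv vX = x ∧ p ≤ x ∧ x < q ∧
    σ'.iv vJt = tgt jl st (2 * u) ∧ Interp A ca cb jl jh (σ'.ia aL) p q (σ'.ia aP) st u ∧
    (tgt jl st (2 * u) ≤ jh → (u = 0 ∧ x = p) ∨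
      ∃ w, u = w + 1 ∧ σ'.ia aL x = σ'.ia aP (tgt jl st (2 * w + 1))) ∧
    φ = 80 * (q - x) + 60 * ((jh + 1 - jl) / st - 2 * u))
    (80 * (q - p) + 60 * ((jh + 1 - jl) / st)) ?_ ?_ ?_ ?_
  · refine ⟨0, p, by simp [hp], le_rfl, hpq, ?_, hP.interp, fun _ => .inl ⟨rfl, rfl⟩, by simp⟩
    simp [tgt_zero, hJl]
  · rintro σ' φ ha -
    simp
  · rintro σ' φ ha ⟨u, x, h1, h2, h3, h4, h5, h6, rfl⟩ hb
    have e1 : σ'.iv vJh = jh := (ha.iv_eq _).trans hJh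
    have e2 : σ'.iv vSt = st := ha.iv_eq _
    have e3 : σ'.iv vQ = q := (ha.iv_eq _).trans hQ
    have e4 : σ'.ia aL = σ.ia aL := ha.ia_eq _
    have hk : σ'.key mx c = A := ha.key_eq.trans hkey
    simp only [BExp.Holds, IExp.eval, h4, e1] at hb
    have hR := (tgt_le_iff hst hjh).1 hb
    refine (interpStep_runs hA hk hca hcab hcb hN hjl hst (by omega) (e4 ▸ hL) h5 e1 e2 e3 h1 h4 hb
      h2 h3 (h6 hb) hB hB1 hqB).mono ?_
    rintro t σ'' ⟨x', g1, g2, g3, g4, g5, g6, g7⟩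
    refine ⟨_, ⟨u + 1, x', g3, by omega, g2, g5, g4, fun h => .inr ⟨u, rfl, g6 h⟩, rfl⟩, ?_⟩
    simp
    omega
  · rintro σ' φ t ha ⟨u, x, h1, h2, h3, h4, h5, h6, rfl⟩ hb ht
    have e1 : σ'.iv vJh = jh := (ha.iv_eq _).trans hJh
    have e2 : σ'.iv vSt = st := ha.iv_eq _
    have e3 : σ'.iv vP = p := (ha.iv_eq _).trans hp
    have e4 : σ'.iv vLev = lev + 1 := (ha.iv_eq _).trans hLev
    have e5 : σ'.ia aO = σ.ia aO := ha.ia_eq _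
    simp only [BExp.Holds, IExp.eval, h4, e1, not_le] at hb
    refine .cons (.iset (by simp) (.cons (.iset (by simp; omega) (.cons (.iset (by
      simp [e4]; omega) (.nil ?_))))))
    refine ⟨h5.solved_of hb, by simp [e2], by simp [e3], by simp [e4], by simp [e4, e5], ?_⟩
    simp at ht ⊢
    omega

/-- Keeps the level number within the capacity and the stride positive. -/
theorem tower_lev {A : ℕ → ℕ → ℝ ×ₗ ℤ} {ca cb jl jh lev q st : ℕ} {L off : ℕ → ℕ}
    (h : Tower A ca cb jl jh L off lev q st) : lev + 1 ≤ st := by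
  induction h <;> omega

/-- The number of columns grows by at least half of its new value when the stride is halved. This
growth pays for the columns of a level, while the consumed part of the list array pays for its rows.
-/
theorem interpPhase_runs {A : ℕ → ℕ → ℝ ×ₗ ℤ} {s N ca cb jl jh st q lev : ℕ}
    (hA : TotMono A s N) (hkey : σ.key mx c = A) (hca : s ≤ ca) (hcab : ca ≤ cb) (hcb : cb ≤ N)
    (hN : jh ≤ N) (hjl : ca < jl) (hjh : jl ≤ jh)
    (hT : Tower A ca cb jl jh (σ.ia aL) (σ.ia aO) lev q st) (hend : jh < tgt jl st 0)
    (hstR : st ≤ 2 * (jh + 1 - jl))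
    (hJl : σ.iv vJl = jl) (hJh : σ.iv vJh = jh) (hSt : σ.iv vSt = st) (hQ : σ.iv vQ = q)
    (hLev : σ.iv vLev = lev) (hoff : 1 ≤ lev → σ.ia aO lev = σ.iv vP)
    (hB : 8 * N ≤ B) (hB1 : 1 ≤ B) (hqB : q ≤ B) :
    Runs B c (interpPhase mx) σ fun t σ' => (∃ p' q',
      Solved A ca cb jl jh (σ'.ia aL) p' q' (σ'.ia aP) 1) ∧
      t ≤ 80 * q + 400 * (jh + 1 - jl) + 10 := by
  refine .while (fun σ' φ => ∃ lev q st p' q', Tower A ca cb jl jh (σ'.ia aL) (σ'.ia aO) lev q st ∧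
    Solved A ca cb jl jh (σ'.ia aL) p' q' (σ'.ia aP) st ∧ σ'.iv vSt = st ∧ σ'.iv vQ = q ∧
    σ'.iv vLev = lev ∧ (1 ≤ lev → σ'.ia aO lev = σ'.iv vP) ∧ (1 ≤ lev → p' = σ'.iv vP ∧ q' = q) ∧
    q ≤ B ∧ lev + 1 ≤ st ∧ st ≤ 2 * (jh + 1 - jl) ∧
    φ = 80 * q + 200 * (2 * (jh + 1 - jl) - (jh + 1 - jl) / st))
    (80 * q + 400 * (jh + 1 - jl)) ?_ ?_ ?_ ?_
  · have hst : 1 ≤ st := le_trans (by omega) (tower_lev hT)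
    -- At the final stride of the reduction there is no column left, so the innermost problem is
    -- solved vacuously.
    have hno : ∀ v, ¬ tgt jl st v ≤ jh := fun v hv => by
      have := tgt_mono (jl := jl) (st := st) (Nat.zero_le v)
      omega
    refine ⟨lev, q, st, σ.iv vP, q, hT, ⟨fun v hv => (hno v hv).elim, fun v hv => (hno v hv).elim,
      fun v hv => (hno _ hv).elim⟩, hSt, hQ, hLev, hoff, fun _ => ⟨rfl, rfl⟩, hqB, tower_lev hT, hstR,
      ?_⟩
    have : (jh + 1 - jl) / st = 0 := by
      by_contra h
      exact hno 0 ((tgt_le_iff hst hjh).2 (Nat.pos_of_ne_zero h))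
    rw [this]
    omega
  · rintro σ' φ ha -
    simp
  · rintro σ' φ ha ⟨lev, q, st, p', q', h1, h2, h3, h4, h5, h6, h7, h8, h9, h10, rfl⟩ hb
    simp only [BExp.Holds, IExp.eval, h5] at hb
    cases h1 with
    | zero => omega
    | @succ lev p _ st hT' hpq hoff' hlev hsub =>
    have e1 : σ'.iv vJl = jl := (ha.iv_eq _).trans hJl
    have e2 : σ'.iv vJh = jh := (ha.iv_eq _).trans hJh
    have hk : σ'.key mx c = A := ha.key_eq.trans hkey
    have hl := tower_lev hT'
    obtain ⟨rfl, rfl⟩ := h7 (by omega)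
    have hp : σ'.iv vP = p := (h6 (by omega)).symm.trans hoff'
    rw [hp] at h2
    refine (interpLevel_runs hA hk hca hcab hcb hN hjl hjh (by omega) (by omega) hlev h2 e1 e2 h3
      h4 hp h5 hB hB1 h8 (by omega)).agree.mono ?_
    rintro t σ'' ⟨⟨g1, g2, g3, g4, g5, g6⟩, ha'⟩
    have e3 : σ''.ia aL = σ'.ia aL := ha'.ia_eq _
    have e4 : σ''.ia aO = σ'.ia aO := ha'.ia_eq _
    have hdiv : (jh + 1 - jl) / (2 * st) = (jh + 1 - jl) / st / 2 := by
      rw [Nat.div_div_eq_div_mul, mul_comm]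
    have hR : 1 ≤ (jh + 1 - jl) / st := (Nat.le_div_iff_mul_le (by omega)).2 (by omega)
    have hR' : (jh + 1 - jl) / st ≤ jh + 1 - jl := Nat.div_le_self _ _
    have hcost : (BExp.ilt 0 vLev).cost + 1 + t + (80 * p + 200 * (2 * (jh + 1 - jl) -
        (jh + 1 - jl) / st)) ≤ 80 * q' + 200 * (2 * (jh + 1 - jl) - (jh + 1 - jl) / (2 * st)) := by
      rw [hdiv]
      simp
      omega
    rcases Nat.eq_zero_or_pos lev with rfl | hlev1
    · exact ⟨_, ⟨0, p, st, p, q', by rwa [e3, e4], g1, g2, g3, g4, by omega, by omega, by omega,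
        by omega, by omega, rfl⟩, hcost⟩
    -- The optimal rows found so far also occur in the longer list of the next level, from which the
    -- present list was thinned out.
    · refine ⟨_, ⟨lev, p, st, σ'.ia aO lev, p, by rwa [e3, e4], g1.of_sub ?_, g2, g3, g4,
        fun _ => by rw [e4, g5], fun _ => ⟨g5.symm, rfl⟩, by omega, by omega, by omega, rfl⟩, hcost⟩
      rw [e3]
      exact hsub hlev1
  · rintro σ' φ t ha ⟨lev, q, st, p', q', h1, h2, h3, h4, h5, h6, h7, h8, h9, h10, rfl⟩ hb ht
    simp only [BExp.Holds, IExp.eval, h5] at hb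
    obtain rfl : lev = 0 := by omega
    cases h1
    refine ⟨⟨p', q', h2⟩, ?_⟩
    simp at ht
    omega

/-- The specification of the row-minima program. -/
theorem smawk_runs {s N ca cb jl jh : ℕ} (hc : IsMongeDAG s N c) (hca : s ≤ ca) (hcab : ca ≤ cb)
    (hcb : cb ≤ N) (hjl : ca < jl) (hjh : jl ≤ jh) (hN : jh ≤ N) (hB : 8 * N ≤ B)
    (hA : σ.iv vA = ca) (hb : σ.iv vB = cb) (hJl : σ.iv vJl = jl) (hJh : σ.iv vJh = jh) :
    Runs B c (smawk mx) σ fun t σ' =>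
      (∀ j, jl ≤ j → j ≤ jh → Opt (σ.key mx c) ca cb (σ'.ia aP j) j) ∧
      t ≤ 320 * (cb + 1 - ca) + 1200 * (jh + 1 - jl) + 100 := by
  refine .cons (.cons (.iset (by simp) (.cons (.for (L := ca) (H := cb) (T := 12)
    (fun i σ' => σ'.iv vQ = i - ca ∧ ∀ k, k < i - ca → σ'.ia aL k = ca + k)
    (by simp) (by simp [hA]) (by omega) (by omega) (by omega) ?_ ?_ ?_ ?_))))
  · simp
  · rintro i σ' - ha
    have : σ'.iv vB = cb := (ha.iv_eq _).trans hb
    simp [this]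
  · rintro i σ' h1 h2 h3 ⟨h4, h5⟩ ha
    refine .cons (.iput (by simp) (by simp [h4]; omega) (by simp) (.cons (.iset (by
      simp [h4]; omega) (.nil ⟨by simp, by simp [h3], by simp [h4]; omega, fun k hk => ?_⟩))))
    rcases Nat.lt_or_ge k (i - ca) with hk' | hk'
    · simp [h4, Function.update_of_ne (show k ≠ i - ca by omega), h5 k hk']
    · obtain rfl : k = i - ca := by omega
      simp [h4, h3]
      omega
  · rintro t σ₁ ⟨h1, h2⟩ ha₁ ht
    have hk₁ : σ₁.key mx c = σ.key mx c := ha₁.key_eq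
    have hTM : TotMono (σ.key mx c) s N := totMono_key hc _ _ _
    refine .nil (.cons ((reducePhase_runs hTM hk₁ hca hcab hcb hN hjl hjh
      ((ha₁.iv_eq _).trans hJl) ((ha₁.iv_eq _).trans hJh) h1 hB h2).agree.mono ?_))
    rintro t₂ σ₂ ⟨⟨lev, q, st, g1, g2, g3, g4, g5, g6, g7, g8, g9⟩, ha₂⟩
    refine .cons ((interpPhase_runs hTM (ha₂.key_eq.trans hk₁) hca hcab hcb hN hjl hjh g1 g6 g7
      ((ha₂.iv_eq _).trans ((ha₁.iv_eq _).trans hJl)) ((ha₂.iv_eq _).trans ((ha₁.iv_eq _).trans hJh))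
      g4 g3 g2 g5 hB (by omega) (by omega)).mono ?_)
    rintro t₃ σ₃ ⟨⟨p', q', g10⟩, g11⟩
    refine .nil ⟨fun j hj hj' => ?_, ?_⟩
    · have e : tgt jl 1 (j - jl) = j := by
        simp only [tgt]
        omega
      have := g10.opt (j - jl)
      rw [e] at this
      exact this hj'
    · simp at ht ⊢
      omega

end MongeProbe

namespace MongeProbe

/-! ### Shortest paths over all numbers of links

The least weight subsequence problem `E j = min_{s ≤ i < j} (E i + w i j)` is solved online, with
lengths and link numbers compared lexicographically. -/

section Lws
variable {G : Type*} [AddCommGroup G] [LinearOrder G]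

/-- `E j` is the minimum of `E i + w i j` over `s ≤ i < j`. -/
def LeastAt (E : ℕ → G) (w : ℕ → ℕ → G) (s j : ℕ) : Prop :=
  (∃ i, s ≤ i ∧ i < j ∧ E j = E i + w i j) ∧ ∀ i, s ≤ i → i < j → E j ≤ E i + w i j

/-- `E` is known up to `k`, and the rows `r, …, k` suffice for the columns beyond `k`. -/
structure Lws (E : ℕ → G) (w : ℕ → ℕ → G) (s N r k : ℕ) : Prop where
  le_r : s ≤ r
  r_le : r ≤ k
  k_le : k ≤ N
  zero : E s = 0
  least : ∀ j, s < j → j ≤ k → LeastAt E w s j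
  dom : ∀ i, s ≤ i → i < r → ∀ j, k < j → j ≤ N → ∃ i', r ≤ i' ∧ i' ≤ k ∧ E i' + w i' j ≤ E i + w i j

variable {E E₁ E₂ : ℕ → G} {w : ℕ → ℕ → G} {s N r k p q : ℕ}

theorem LeastAt.congr {j : ℕ} (h : LeastAt E w s j) (hE : ∀ i, i ≤ j → E₁ i = E i) :
    LeastAt E₁ w s j := by
  obtain ⟨⟨i, h1, h2, h3⟩, h4⟩ := h
  refine ⟨⟨i, h1, h2, ?_⟩, fun i h1 h2 => ?_⟩
  · rw [hE j le_rfl, hE i h2.le, h3]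
  · rw [hE j le_rfl, hE i h2.le]
    exact h4 i h1 h2

/-- `E₁` extends `E` beyond `k`, up to `p`, by the minima over the rows up to `k`. -/
structure Extends (E E₁ : ℕ → G) (w : ℕ → ℕ → G) (r k p : ℕ) : Prop where
  old : ∀ j, j ≤ k → E₁ j = E j
  attained : ∀ j, k < j → j ≤ p → ∃ i, r ≤ i ∧ i ≤ k ∧ E₁ j = E i + w i j
  le : ∀ j, k < j → j ≤ p → ∀ i, r ≤ i → i ≤ k → E₁ j ≤ E i + w i j

/-- Rows before `r` may be ignored, since every later column has a row among `r, …, k` that is at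
least as good. -/
theorem Extends.le_all (hx : Extends E E₁ w r k p) (h : Lws E w s N r k) (hp : p ≤ N) {i j : ℕ}
    (hj : k < j) (hjp : j ≤ p) (hi : s ≤ i) (hik : i ≤ k) : E₁ j ≤ E₁ i + w i j := by
  rw [hx.old i hik]
  rcases lt_or_ge i r with hir | hir
  · obtain ⟨i', h1, h2, h3⟩ := h.dom i hi hir j hj (hjp.trans hp)
    exact (hx.le j hj hjp i' h1 h2).trans h3
  · exact hx.le j hj hjp i hir hik

theorem Extends.least (hx : Extends E E₁ w r k p) (h : Lws E w s N r k) (hp : p ≤ N)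
    (hq : q ≤ p + 1) (hbest : ∀ j, k + 1 < j → j < q → ∀ i, k < i → i < j → E₁ j ≤ E₁ i + w i j)
    {j : ℕ} (hj : s < j) (hjq : j < q) : LeastAt E₁ w s j := by
  rcases le_or_gt j k with hjk | hjk
  · exact (h.least j hj hjk).congr fun i hi => hx.old i (hi.trans hjk)
  · obtain ⟨i, h1, h2, h3⟩ := hx.attained j hjk (by omega)
    refine ⟨⟨i, h.le_r.trans h1, by omega, by rw [h3, hx.old i h2]⟩, fun i hi hij => ?_⟩
    rcases le_or_gt i k with hik | hik
    · exact hx.le_all h hp hjk (by omega) hi hik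
    · exact hbest j (by omega) hjq i hik hij

/-- No row beyond `k` improves the tentative values, so the whole batch is final. The active rows
still begin at `r`. -/
theorem Extends.advance (hx : Extends E E₁ w r k p) (h : Lws E w s N r k) (hp : p ≤ N) (hkp : k < p)
    (hbest : ∀ j, k + 1 < j → j < p + 1 → ∀ i, k < i → i < j → E₁ j ≤ E₁ i + w i j) :
    Lws E₁ w s N r p := by
  refine ⟨h.le_r, by have := h.r_le; omega, hp,
    (hx.old s (by have := h.le_r; have := h.r_le; omega)).trans h.zero,
    fun j h1 h2 => hx.least h hp le_rfl hbest h1 (by omega), fun i h1 h2 j h3 h4 => ?_⟩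
  obtain ⟨i', g1, g2, g3⟩ := h.dom i h1 h2 j (by omega) h4
  have := h.r_le
  exact ⟨i', g1, by omega, by rwa [hx.old i (by omega), hx.old i' g2]⟩

/-- Column `q` is the first one improved by a row beyond `k`. There the row `b` strictly beats every
row up to `k`, and by total monotonicity it stays ahead in all later columns, so these rows can be
dropped. Total monotonicity may be used on the tentative values because it holds for any row
offsets. -/
theorem Extends.restart (hx : Extends E E₁ w r k p) (h : Lws E w s N r k) (hp : p ≤ N)
    (hA : TotMono (fun i j => E₁ i + w i j) s N) (hkq : k + 1 < q) (hqp : q ≤ p)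
    (hbest : ∀ j, k + 1 < j → j < q → ∀ i, k < i → i < j → E₁ j ≤ E₁ i + w i j)
    {b : ℕ} (hkb : k < b) (hbq : b < q) (hopt : ∀ i, k < i → i < q → E₁ b + w b q ≤ E₁ i + w i q)
    (hlt : E₁ b + w b q < E₁ q) (hE₂ : ∀ j, j ≠ q → E₂ j = E₁ j) (hE₂q : E₂ q = E₁ b + w b q) :
    Lws E₂ w s N (k + 1) q := by
  have hsr := h.le_r
  have hrk := h.r_le
  refine ⟨by omega, by omega, by omega, ?_, fun j h1 h2 => ?_, fun i h1 h2 j h3 h4 => ?_⟩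
  · rw [hE₂ s (by omega), hx.old s (by omega), h.zero]
  · rcases h2.lt_or_eq with h2 | rfl
    · exact (hx.least h hp (by omega) hbest h1 h2).congr fun i hi => hE₂ i (by omega)
    · refine ⟨⟨b, by omega, hbq, by rw [hE₂q, hE₂ b (by omega)]⟩, fun i hi hij => ?_⟩
      rw [hE₂q, hE₂ i (by omega)]
      rcases le_or_gt i k with hik | hik
      · exact hlt.le.trans (hx.le_all h hp (by omega) hqp hi hik)
      · exact hopt i hik hij
  · refine ⟨b, by omega, by omega, ?_⟩
    rw [hE₂ i (by omega), hE₂ b (by omega)]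
    exact (hA.lt i b q j h1 (by omega) hbq h3.le h4
      (hlt.trans_le (hx.le_all h hp (by omega) hqp h1 (by omega)))).le

end Lws

/-- The sign of the link numbers in the tie-breaking. -/
def linkSign (mx : Bool) : ℤ := if mx then -1 else 1

/-- The weight of an edge: its shifted length and one link. -/
noncomputable def edgeWeight (mx : Bool) (c : ℕ → ℕ → ℝ) (lam : ℝ) (i j : ℕ) : ℝ ×ₗ ℤ :=
  toLex (c i j - lam, linkSign mx)

/-- The value of a node with the distance `x` by `m` links. -/
noncomputable def nodeVal (mx : Bool) (x : ℝ) (m : ℕ) : ℝ ×ₗ ℤ := toLex (x, linkSign mx * m)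

variable {mx : Bool} {c : ℕ → ℕ → ℝ} {lam : ℝ} {s N : ℕ}

theorem nodeVal_add_edgeWeight (x : ℝ) (m i j : ℕ) :
    nodeVal mx x m + edgeWeight mx c lam i j = nodeVal mx (x + c i j - lam) (m + 1) := by
  rw [nodeVal, nodeVal, edgeWeight, ← toLex_add, Prod.mk_add_mk]
  congr 2
  · ring
  · push_cast
    ring

/-- The shift by `lam` and the additional link change all entries by one constant, so the unshifted
array may be searched instead. -/
theorem key_add (F : ℕ → ℝ) (C : ℕ → ℕ) (i j : ℕ) :
    key mx c F C i j + toLex (-lam, linkSign mx) =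
      nodeVal mx (F i) (C i) + edgeWeight mx c lam i j := by
  rw [nodeVal, edgeWeight, key, ← toLex_add, ← toLex_add, Prod.mk_add_mk, Prod.mk_add_mk]
  congr 2
  · ring
  · cases mx <;> simp [linkSign]

theorem key_le_key {F : ℕ → ℝ} {C : ℕ → ℕ} {i i' j : ℕ} (lam : ℝ) :
    key mx c F C i j ≤ key mx c F C i' j ↔
      nodeVal mx (F i) (C i) + edgeWeight mx c lam i j ≤
        nodeVal mx (F i') (C i') + edgeWeight mx c lam i' j := by
  rw [← key_add, ← key_add, add_le_add_iff_right]

theorem totMono_nodeVal (hc : IsMongeDAG s N c) (F : ℕ → ℝ) (C : ℕ → ℕ) :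
    TotMono (fun i j => nodeVal mx (F i) (C i) + edgeWeight mx c lam i j) s N := by
  have h := totMono_key hc mx F C
  constructor
  · intro i i' j j' h1 h2 h3 h4 h5 h6
    rw [← not_le, ← key_le_key lam, not_le] at h6 ⊢
    exact h.lt i i' j j' h1 h2 h3 h4 h5 h6
  · intro i i' j j' h1 h2 h3 h4 h5 h6
    rw [← key_le_key lam] at h6 ⊢
    exact h.le i i' j j' h1 h2 h3 h4 h5 h6

theorem pathVal_zero {v : ℕ → ℕ} : nodeVal mx (pathLength c 0 v) 0 = 0 := by
  simp only [nodeVal, pathLength, Finset.range_zero, Finset.sum_empty, Nat.cast_zero, mul_zero]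
  rfl

theorem pathVal_succ {m : ℕ} {v : ℕ → ℕ} :
    nodeVal mx (pathLength (shift c lam) (m + 1) v) (m + 1) =
      nodeVal mx (pathLength (shift c lam) m v) m + edgeWeight mx c lam (v m) (v (m + 1)) := by
  rw [nodeVal_add_edgeWeight, pathLength_succ]
  simp only [shift]
  congr 1
  ring

variable {E : ℕ → ℝ ×ₗ ℤ} {r k : ℕ}

theorem Lws.le_path (h : Lws E (edgeWeight mx c lam) s N r k) {j m : ℕ} {v : ℕ → ℕ}
    (hv : IsPath s j m v) (hj : j ≤ k) : E j ≤ nodeVal mx (pathLength (shift c lam) m v) m := by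
  induction m generalizing j with
  | zero =>
    obtain rfl : s = j := hv.1.symm.trans hv.2.1
    rw [h.zero, pathVal_zero]
  | succ m ih =>
    have hlt := hv.2.2 m (by omega)
    rw [hv.2.1] at hlt
    have hi := (isPath_init hv).links_le
    rw [pathVal_succ, hv.2.1]
    refine ((h.least j (by omega) hj).2 (v m) (by omega) hlt).trans ?_
    exact add_le_add_left (ih (isPath_init hv) (by omega)) _

theorem Lws.exists_path (h : Lws E (edgeWeight mx c lam) s N r k) (j : ℕ) (hs : s ≤ j)
    (hj : j ≤ k) :
    ∃ m v, IsPath s j m v ∧ E j = nodeVal mx (pathLength (shift c lam) m v) m := by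
  induction j using Nat.strong_induction_on with
  | _ j ih =>
    rcases hs.eq_or_lt with rfl | hs
    · refine ⟨0, fun _ => s, ⟨rfl, rfl, by simp⟩, ?_⟩
      rw [h.zero, pathVal_zero]
    · obtain ⟨i, h1, h2, h3⟩ := (h.least j hs hj).1
      obtain ⟨m, v, hv, he⟩ := ih i h2 h1 (by omega)
      refine ⟨m + 1, _, hv.snoc h2, ?_⟩
      rw [h3, he, pathLength_snoc hv, nodeVal_add_edgeWeight]
      simp only [shift]
      congr 1
      ring

/-- The lexicographic minimum is attained by a path: its first component is the shortest length, and
among shortest paths the signed number of links is least. -/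
theorem Lws.linkCounts (h : Lws E (edgeWeight mx c lam) s N r N) {x : ℝ} {m : ℕ}
    (hE : E N = nodeVal mx x m) :
    m ∈ linkCounts (shift c lam) s N ∧
      ∀ m' ∈ linkCounts (shift c lam) s N, linkSign mx * m ≤ linkSign mx * m' := by
  have hsN : s ≤ N := h.le_r.trans (h.r_le.trans h.k_le)
  obtain ⟨m₀, v, hv, he⟩ := h.exists_path N hsN le_rfl
  rw [hE] at he
  have h0 : linkSign mx ≠ 0 := by cases mx <;> simp [linkSign]
  have he' := toLex_inj.1 he
  simp only [Prod.mk.injEq] at he'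
  obtain ⟨rfl, hm⟩ := he'
  obtain rfl : m = m₀ := by exact_mod_cast mul_left_cancel₀ h0 hm
  have key : ∀ m' v', IsPath s N m' v' → nodeVal mx (pathLength (shift c lam) m v) m ≤
      nodeVal mx (pathLength (shift c lam) m' v') m' := fun m' v' hv' => hE ▸ h.le_path hv' le_rfl
  simp only [nodeVal, Prod.Lex.toLex_le_toLex] at key
  refine ⟨⟨v, hv, fun m' v' hv' => ?_⟩, ?_⟩
  · exact (key m' v' hv').elim le_of_lt fun h => h.1.le
  · rintro m' ⟨v', hv', hmin⟩
    rcases key m' v' hv' with h | h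
    · exact absurd (hmin m v hv) (not_le.2 h)
    · exact h.2

theorem Lws.dMin_eq (h : Lws E (edgeWeight false c lam) s N r N) {x : ℝ} {m : ℕ}
    (hE : E N = nodeVal false x m) : m = dMin c s lam N := by
  obtain ⟨h1, h2⟩ := h.linkCounts hE
  refine (IsLeast.csInf_eq ⟨h1, fun m' hm' => ?_⟩).symm
  simpa [linkSign] using h2 m' hm'

theorem Lws.dMax_eq (h : Lws E (edgeWeight true c lam) s N r N) {x : ℝ} {m : ℕ}
    (hE : E N = nodeVal true x m) : m = dMax c s lam N := by
  obtain ⟨h1, h2⟩ := h.linkCounts hE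
  refine (IsGreatest.csSup_eq ⟨h1, fun m' hm' => ?_⟩).symm
  simpa [linkSign] using h2 m' hm'

end MongeProbe

namespace MongeProbe

/-! ### The subroutines -/

notation "vK" => IVar.tmp 14
notation "vR" => IVar.tmp 15
notation "vPp" => IVar.tmp 16
notation "vJ" => IVar.tmp 17

/-- The length of the best extension to `vJ`. -/
def newLen : RExp :=
  .sub (.add (.get aF (.get aP vJ)) (.edge (.get aP vJ) vJ)) (.var .lam)

def newLinks : IExp := .get aC (.get aP vJ) + 1

/-- Store the best extension to `vJ`. -/
def lwsStore : Cmd := block [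
  .rset (.tmp 0) newLen, .iput aC vJ newLinks, .rput aF vJ (.var (.tmp 0))]

/-- Is the best extension to `vJ` better than the stored one? -/
def betterTest (mx : Bool) : BExp :=
  .or (.rlt newLen (.get aF vJ)) (.and (.rle newLen (.get aF vJ))
    (if mx then .ilt (.get aC vJ) newLinks else .ilt newLinks (.get aC vJ)))

def lwsScan (mx : Bool) : Cmd := block [
  .iset vA (vK + 1), .iset vB (vPp - 1), .iset vJl (vK + 2), .iset vJh vPp, smawk mx,
  .iset vJ (vK + 2), .iset vE (vPp + 1),
  .loop (.ilt vJ vE) (.cond (betterTest mx) (.iset vE vJ) (.iset vJ (vJ + 1)))]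

def lwsClip : Cmd := block [
  .iset vPp (vK + vK + 1 - vR), .cond (.ilt IVar.N vPp) (.iset vPp IVar.N) .skip]

def lwsFill (mx : Bool) : Cmd := block [
  .iset vA vR, .iset vB vK, .iset vJl (vK + 1), .iset vJh vPp, smawk mx,
  forLoop vJ (vK + 1) vPp lwsStore]

def lwsRound (mx : Bool) : Cmd := block [
  lwsClip, lwsFill mx,
  .cond (.ilt (vK + 1) vPp) (lwsScan mx) (.iset vJ (vPp + 1)),
  .cond (.ile vJ vPp) (block [lwsStore, .iset vR (vK + 1), .iset vK vJ]) (.iset vK vPp)]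

/-- Compute the extreme number of links of the shortest paths. -/
def depthProg (mx : Bool) : Cmd := block [
  .iset vK IVar.s, .iset vR IVar.s, .rput aF IVar.s .zero, .iput aC IVar.s 0,
  .loop (.ilt vK IVar.N) (lwsRound mx),
  .iset .d (.get aC IVar.N)]

variable {B : ℕ} {c : ℕ → ℕ → ℝ} {σ : State} {mx : Bool}

noncomputable def State.val (σ : State) (mx : Bool) (j : ℕ) : ℝ ×ₗ ℤ :=
  nodeVal mx (σ.ra aF j) (σ.ia aC j)

noncomputable def State.ext (σ : State) (mx : Bool) (c : ℕ → ℕ → ℝ) (i j : ℕ) : ℝ ×ₗ ℤ :=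
  σ.val mx i + edgeWeight mx c (σ.rv .lam) i j

theorem ext_eq (i j : ℕ) : σ.ext mx c i j =
    nodeVal mx (σ.ra aF i + c i j - σ.rv .lam) (σ.ia aC i + 1) := nodeVal_add_edgeWeight _ _ _ _

theorem key_le_key_ext {i i' j : ℕ} :
    σ.key mx c i j ≤ σ.key mx c i' j ↔ σ.ext mx c i j ≤ σ.ext mx c i' j := key_le_key _

theorem betterTest_holds : (betterTest mx).Holds c σ ↔
    σ.ext mx c (σ.ia aP (σ.iv vJ)) (σ.iv vJ) < σ.val mx (σ.iv vJ) := by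
  rw [ext_eq, State.val, nodeVal, nodeVal, Prod.Lex.toLex_lt_toLex]
  have h : ∀ {x y : ℝ} {P : Prop}, (x < y ∨ x ≤ y ∧ P) ↔ (x < y ∨ x = y ∧ P) := by
    intro x y P
    constructor
    · rintro (h | ⟨h, h'⟩)
      · exact .inl h
      · exact h.lt_or_eq.imp id fun h => ⟨h, h'⟩
    · rintro (h | ⟨h, h'⟩)
      · exact .inl h
      · exact .inr ⟨h.le, h'⟩
  rw [← h]
  cases mx
  · simp [betterTest, newLen, newLinks, linkSign]
    norm_cast
  · simp [betterTest, newLen, newLinks, linkSign]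

theorem lwsStore_runs {N j : ℕ} (hN : N + 1 ≤ B) (hJ : σ.iv vJ = j) (hjN : j ≤ N)
    (hP : σ.ia aP j ≤ N) (hC : σ.ia aC (σ.ia aP j) + 1 ≤ B) :
    Runs B c lwsStore σ fun t σ' => t ≤ 30 ∧
      (∀ i, i ≠ j → σ'.val mx i = σ.val mx i ∧ σ'.ia aC i = σ.ia aC i) ∧
      σ'.val mx j = σ.ext mx c (σ.ia aP j) j ∧ σ'.ia aC j = σ.ia aC (σ.ia aP j) + 1 := by
  refine .cons (.rset (by simp [newLen, hJ]; omega) (.cons (.iput (by simp) (by simp [hJ]; omega)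
    (by simp [newLinks, hJ]; omega) (.cons (.rput (by simp) (by simp [hJ]; omega) (by simp)
    (.nil ⟨?_, fun i hi => ?_, ?_, ?_⟩))))))
  · simp [newLen, newLinks]
  · simp [State.val, hJ, Function.update_of_ne hi]
  · rw [ext_eq]
    simp [State.val, newLen, newLinks, hJ]
  · simp [newLinks, hJ]

theorem AgreeOff.val_eq {l : List Region} {σ σ' : State} (h : AgreeOff l σ σ')
    (h₁ : decide (Region.ra aF ∉ l) = true := by rfl)
    (h₂ : decide (Region.ia aC ∉ l) = true := by rfl) : σ'.val mx = σ.val mx := by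
  funext j
  rw [State.val, State.val, h.ra_eq _ h₁, h.ia_eq _ h₂]

/-- A batch has as many new columns as there are active rows, `k + 1 - r`, unless the end `N` cuts
it short. -/
theorem lwsClip_runs {N r k : ℕ} (hN : σ.iv .N = N) (hK : σ.iv vK = k) (hR : σ.iv vR = r)
    (hk : k < N) (hB : 8 * N ≤ B) :
    Runs B c lwsClip σ fun t σ' => t ≤ 30 ∧ σ'.iv vPp = min N (k + k + 1 - r) := by
  refine .cons (.iset (by simp [hK]; omega) (.cons (.cond (by simp) (fun hb => ?_) fun hb => ?_)))
  · simp [hN, hK, hR] at hb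
    exact .iset (by simp) (.nil ⟨by simp, by simp [hN]; omega⟩)
  · simp [hN, hK, hR] at hb
    exact .skip (.nil ⟨by simp, by simp [hK, hR]; omega⟩)

theorem lwsFill_runs {s N r k p : ℕ} (hc : IsMongeDAG s N c) (hB : 8 * N ≤ B)
    (hK : σ.iv vK = k) (hR : σ.iv vR = r) (hp : σ.iv vPp = p) (hkp : k < p) (hpN : p ≤ N)
    (hL : Lws (σ.val mx) (edgeWeight mx c (σ.rv .lam)) s N r k)
    (hC : ∀ j, s ≤ j → j ≤ k → σ.ia aC j ≤ j) :
    Runs B c (lwsFill mx) σ fun t σ' =>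
      Extends (σ.val mx) (σ'.val mx) (edgeWeight mx c (σ.rv .lam)) r k p ∧
      (∀ j, s ≤ j → j ≤ p → σ'.ia aC j ≤ j) ∧
      t ≤ 320 * (k + 1 - r) + 1300 * (p - k) + 200 := by
  have hsr := hL.le_r
  have hrk := hL.r_le
  have hB8 : 8 ≤ B := by have := hc.1; omega
  refine .cons (.iset (by simp) (.cons (.iset (by simp) (.cons (.iset (by
    simp [hK]; omega) (.cons (.iset (by simp) (.cons ?_))))))))
  refine (smawk_runs hc hsr hrk (by omega) (show r < k + 1 by omega) hkp hpN hB (by simp [hR])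
    (by simp [hK]) (by simp [hK]) (by simp [hp])).agree.mono ?_
  rintro t₁ σ₁ ⟨⟨hopt, ht₁⟩, ha₁⟩
  have eK : σ₁.iv vK = k := (ha₁.iv_eq _).trans hK
  have eP : σ₁.iv vPp = p := (ha₁.iv_eq _).trans hp
  have eV : σ₁.val mx = σ.val mx := ha₁.val_eq
  have eC : σ₁.ia aC = σ.ia aC := ha₁.ia_eq _
  have eLam : σ₁.rv .lam = σ.rv .lam := ha₁.rv_eq _
  have hPlt : ∀ j, k < j → j ≤ p → r ≤ σ₁.ia aP j ∧ σ₁.ia aP j ≤ k := fun j h1 h2 =>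
    (hopt j h1 h2).1
  refine .cons (.for (L := k + 1) (H := p) (T := 30) (fun i τ =>
    (∀ j, k < j → j < i → τ.val mx j = σ.ext mx c (σ₁.ia aP j) j ∧
      τ.ia aC j = σ.ia aC (σ₁.ia aP j) + 1) ∧
    ∀ j, j ≤ k → τ.val mx j = σ.val mx j ∧ τ.ia aC j = σ.ia aC j)
    (by simp [eK]; omega) (by simp [eK]) (by omega) (by omega) (by omega) ?_ ?_ ?_ ?_)
  · refine ⟨fun j h1 h2 => by omega, fun j hj => ⟨?_, ?_⟩⟩
    · rw [← eV]
      rfl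
    · rw [← eC]
      rfl
  · rintro i τ - ha
    have : τ.iv vPp = p := (ha.iv_eq _).trans eP
    simp [this]
  · rintro i τ h1 h2 h3 ⟨h4, h5⟩ ha
    have hP := hPlt i (by omega) h2
    have e1 : τ.ia aP = σ₁.ia aP := ha.ia_eq _
    have e2 : τ.rv .lam = σ.rv .lam := (ha.rv_eq _).trans eLam
    have hCP : τ.ia aC (σ₁.ia aP i) ≤ σ₁.ia aP i := by
      rw [(h5 _ hP.2).2]
      exact hC _ (by omega) hP.2
    refine (lwsStore_runs (mx := mx) (N := N) (by omega) h3 (by omega) (by rw [e1]; omega)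
      (by rw [e1]; omega)).agree.mono ?_
    rintro t τ' ⟨⟨g1, g2, g3, g4⟩, ha'⟩
    refine ⟨g1, (ha'.iv_eq _).trans h3, fun j hj hji => ?_, fun j hj => ?_⟩
    · rcases Nat.lt_succ_iff_lt_or_eq.1 hji with hji | rfl
      · obtain ⟨g5, g6⟩ := g2 j (by omega)
        exact ⟨g5.trans (h4 j hj hji).1, g6.trans (h4 j hj hji).2⟩
      · refine ⟨g3.trans ?_, g4.trans ?_⟩
        · rw [e1, State.ext, State.ext, e2, (h5 _ hP.2).1]
        · rw [e1, (h5 _ hP.2).2]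
    · obtain ⟨g5, g6⟩ := g2 j (by omega)
      exact ⟨g5.trans (h5 j hj).1, g6.trans (h5 j hj).2⟩
  · rintro t τ ⟨h1, h2⟩ - ht
    refine .nil ⟨⟨fun j hj => (h2 j hj).1, fun j hj hjp => ?_, fun j hj hjp i hi hik => ?_⟩,
      fun j hj hjp => ?_, ?_⟩
    · exact ⟨_, (hPlt j hj hjp).1, (hPlt j hj hjp).2, (h1 j hj (by omega)).1⟩
    · rw [(h1 j hj (by omega)).1]
      have := (hopt j hj hjp).2 i hi hik (by omega)
      exact key_le_key_ext.1 this.2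
    · rcases le_or_gt j k with hjk | hjk
      · rw [(h2 j hjk).2]
        exact hC j hj hjk
      · rw [(h1 j hjk (by omega)).2]
        have hP := hPlt j hjk hjp
        have := hC _ (hsr.trans hP.1) hP.2
        omega
    · simp at ht ⊢
      omega

theorem lwsScan_runs {s N k p : ℕ} (hc : IsMongeDAG s N c) (hB : 8 * N ≤ B)
    (hK : σ.iv vK = k) (hp : σ.iv vPp = p) (hs : s ≤ k) (hkp : k + 1 < p) (hpN : p ≤ N)
    (hC : ∀ j, s ≤ j → j ≤ p → σ.ia aC j ≤ j) :
    Runs B c (lwsScan mx) σ fun t σ' => ∃ q, σ'.iv vJ = q ∧ k + 1 < q ∧ q ≤ p + 1 ∧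
      (∀ j, k + 1 < j → j < q → ∀ i, k < i → i < j → σ.val mx j ≤ σ.ext mx c i j) ∧
      (q ≤ p → (k < σ'.ia aP q ∧ σ'.ia aP q < q) ∧
        (∀ i, k < i → i < q → σ.ext mx c (σ'.ia aP q) q ≤ σ.ext mx c i q) ∧
        σ.ext mx c (σ'.ia aP q) q < σ.val mx q) ∧
      t ≤ 1600 * (p - k) + 200 := by
  have hB8 : 8 ≤ B := by have := hc.1; omega
  refine .cons (.iset (by simp [hK]; omega) (.cons (.iset (by simp; omega) (.cons (.iset (by
    simp [hK]; omega) (.cons (.iset (by simp) (.cons ?_))))))))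
  refine (smawk_runs hc (show s ≤ k + 1 by omega) (show k + 1 ≤ p - 1 by omega) (by omega)
    (show k + 1 < k + 2 by omega) (by omega) hpN hB (by simp [hK])
    (by simp [hp]) (by simp [hK]) (by simp [hp])).agree.mono ?_
  rintro t₁ σ₁ ⟨⟨hopt, ht₁⟩, ha₁⟩
  have eK : σ₁.iv vK = k := (ha₁.iv_eq _).trans hK
  have eP : σ₁.iv vPp = p := (ha₁.iv_eq _).trans hp
  have eV : σ₁.val mx = σ.val mx := ha₁.val_eq
  have eC : σ₁.ia aC = σ.ia aC := ha₁.ia_eq _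
  have eLam : σ₁.rv .lam = σ.rv .lam := ha₁.rv_eq _
  have hP : ∀ j, k + 1 < j → j ≤ p → (k < σ₁.ia aP j ∧ σ₁.ia aP j < j) ∧
      ∀ i, k < i → i < j → σ.ext mx c (σ₁.ia aP j) j ≤ σ.ext mx c i j := by
    intro j h1 h2
    obtain ⟨⟨h3, h4⟩, h5⟩ := hopt j h1 h2
    refine ⟨⟨by omega, (h5 (k + 1) le_rfl (by omega) h1).1⟩, fun i hi hij => ?_⟩
    exact key_le_key_ext.1 (h5 i hi (by omega) hij).2
  -- A value `e ≤ p` of `vE` signals that an improvable column has been found; setting `vE` to `vJ`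
  -- also ends the loop.
  refine .cons (.iset (by simp [eK]; omega) (.cons (.iset (by simp [eP]; omega) (.cons (.while
    (fun τ φ => ∃ q e, τ.iv vJ = q ∧ τ.iv vE = e ∧ k + 1 < q ∧ q ≤ e ∧ e ≤ p + 1 ∧
      (e ≤ p → q = e ∧ σ.ext mx c (σ₁.ia aP q) q < σ.val mx q) ∧
      (∀ j, k + 1 < j → j < q → σ.val mx j ≤ σ.ext mx c (σ₁.ia aP j) j) ∧
      φ = 80 * (e - q)) (80 * (p + 1 - (k + 2))) ?_ ?_ ?_ ?_)))))
  · exact ⟨k + 2, p + 1, by simp [eK], by simp [eP], by omega, by omega, le_rfl, by omega,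
      fun j h1 h2 => by omega, rfl⟩
  · rintro τ φ ha -
    simp
  · rintro τ φ ha ⟨q, e, h1, h2, h3, h4, h5, h6, h7, rfl⟩ hb
    simp only [BExp.Holds, IExp.eval, h1, h2] at hb
    have e1 : τ.ia aP = σ₁.ia aP := ha.ia_eq _
    have e2 : τ.rv .lam = σ.rv .lam := (ha.rv_eq _).trans eLam
    have e3 : τ.ia aC = σ.ia aC := (ha.ia_eq _).trans eC
    have e4 : τ.val mx = σ.val mx := ha.val_eq.trans eV
    have hq := hP q h3 (by omega)
    have hCP := hC (σ₁.ia aP q) (by omega) (by omega)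
    have hext : τ.ext mx c = σ.ext mx c := by
      funext i j
      rw [State.ext, State.ext, e2, e4]
    refine .cond ?_ (fun hw => ?_) fun hw => ?_
    · cases mx <;> simp [betterTest, newLen, newLinks, h1, e1, e3] <;> omega
    · rw [betterTest_holds, h1, e1, hext, e4] at hw
      refine .iset (by simp) ⟨0, ⟨q, q, by simp [h1], by simp [h1], h3, le_rfl, by omega,
        fun _ => ⟨rfl, hw⟩, h7, by simp⟩, ?_⟩
      cases mx <;> simp [betterTest, newLen, newLinks] <;> omega
    · rw [betterTest_holds, h1, e1, hext, e4, not_lt] at hw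
      refine .iset (by simp [h1]; omega) ⟨_, ⟨q + 1, e, by simp [h1], by simp [h2], by omega, hb, h5,
        fun h => by have := (h6 h).1; omega, fun j g1 g2 => ?_, rfl⟩, ?_⟩
      · rcases Nat.lt_succ_iff_lt_or_eq.1 g2 with g2 | rfl
        · exact h7 j g1 g2
        · exact hw
      · cases mx <;> simp [betterTest, newLen, newLinks] <;> omega
  · rintro τ φ t ha ⟨q, e, h1, h2, h3, h4, h5, h6, h7, rfl⟩ hb ht
    simp only [BExp.Holds, IExp.eval, h1, h2] at hb
    obtain rfl : q = e := by omega
    have e1 : τ.ia aP = σ₁.ia aP := ha.ia_eq _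
    refine .nil ⟨q, h1, h3, h5, fun j g1 g2 i g3 g4 => ?_, fun hq => ?_, ?_⟩
    · exact (h7 j g1 g2).trans ((hP j g1 (by omega)).2 i g3 g4)
    · rw [e1]
      exact ⟨(hP q h3 hq).1, (hP q h3 hq).2, (h6 hq).2⟩
    · simp at ht ⊢
      omega

/-- A round costs a multiple of `k + 1 - r`. A restart advances `r` by that much, and a full batch
advances `k` by that much; only a batch cut off at `N` may advance less, and it is the last. -/
theorem lwsRound_runs {s N r k : ℕ} (hc : IsMongeDAG s N c) (hB : 8 * N ≤ B)
    (hN : σ.iv .N = N) (hK : σ.iv vK = k) (hR : σ.iv vR = r) (hk : k < N)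
    (hL : Lws (σ.val mx) (edgeWeight mx c (σ.rv .lam)) s N r k)
    (hC : ∀ j, s ≤ j → j ≤ k → σ.ia aC j ≤ j) :
    Runs B c (lwsRound mx) σ fun t σ' => ∃ r' k', σ'.iv vK = k' ∧ σ'.iv vR = r' ∧
      Lws (σ'.val mx) (edgeWeight mx c (σ.rv .lam)) s N r' k' ∧
      (∀ j, s ≤ j → j ≤ k' → σ'.ia aC j ≤ j) ∧ r ≤ r' ∧ k < k' ∧
      (k' = N ∨ r + k + (k + 1 - r) ≤ r' + k') ∧ t ≤ 4000 * (k + 1 - r) := by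
  have hsr := hL.le_r
  have hrk := hL.r_le
  obtain ⟨p, hp⟩ : ∃ p, p = min N (k + k + 1 - r) := ⟨_, rfl⟩
  have hkp : k < p := by omega
  have hpN : p ≤ N := by omega
  refine .cons ((lwsClip_runs hN hK hR hk hB).agree.mono ?_)
  rintro t₁ σ₁ ⟨⟨ht₁, hp₁⟩, ha₁⟩
  rw [← hp] at hp₁
  have eLam₁ : σ₁.rv .lam = σ.rv .lam := ha₁.rv_eq _
  refine .cons ((lwsFill_runs (mx := mx) hc hB ((ha₁.iv_eq _).trans hK) ((ha₁.iv_eq _).trans hR) hp₁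
    hkp hpN (by rw [ha₁.val_eq, eLam₁]; exact hL) (by rw [ha₁.ia_eq]; exact hC)).agree.mono ?_)
  rintro t₂ σ₂ ⟨⟨hx, hC₂, ht₂⟩, ha₂⟩
  rw [ha₁.val_eq, eLam₁] at hx
  have eLam₂ : σ₂.rv .lam = σ.rv .lam := (ha₂.rv_eq _).trans eLam₁
  have eK₂ : σ₂.iv vK = k := (ha₂.iv_eq _).trans ((ha₁.iv_eq _).trans hK)
  have eR₂ : σ₂.iv vR = r := (ha₂.iv_eq _).trans ((ha₁.iv_eq _).trans hR)
  have eP₂ : σ₂.iv vPp = p := (ha₂.iv_eq _).trans hp₁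
  have hscan : Runs B c (.cond (.ilt (vK + 1) vPp) (lwsScan mx) (.iset vJ (vPp + 1))) σ₂
      fun t σ' => ∃ q, σ'.iv vJ = q ∧ k + 1 < q ∧ q ≤ p + 1 ∧
      (∀ j, k + 1 < j → j < q → ∀ i, k < i → i < j → σ₂.val mx j ≤ σ₂.ext mx c i j) ∧
      (q ≤ p → (k < σ'.ia aP q ∧ σ'.ia aP q < q) ∧
        (∀ i, k < i → i < q → σ₂.ext mx c (σ'.ia aP q) q ≤ σ₂.ext mx c i q) ∧
        σ₂.ext mx c (σ'.ia aP q) q < σ₂.val mx q) ∧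
      t ≤ 1600 * (p - k) + 220 := by
    refine .cond (by simp [eK₂]; omega) (fun hb => ?_) fun hb => ?_
    · simp [eK₂, eP₂] at hb
      refine (lwsScan_runs hc hB eK₂ eP₂ (by omega) hb hpN hC₂).mono ?_
      rintro t τ ⟨q, h1, h2, h3, h4, h5, h6⟩
      exact ⟨q, h1, h2, h3, h4, h5, by simp; omega⟩
    · simp [eK₂, eP₂] at hb
      exact .iset (by simp [eP₂]; omega) ⟨p + 1, by simp [eP₂], by omega, le_rfl,
        fun j h1 h2 => by omega, by omega, by simp⟩
  refine .cons (hscan.agree.mono ?_)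
  rintro t₃ σ₃ ⟨⟨q, hJ, hkq, hqp, hbest, hfound, ht₃⟩, ha₃⟩
  have eLam₃ : σ₃.rv .lam = σ.rv .lam := (ha₃.rv_eq _).trans eLam₂
  have eK₃ : σ₃.iv vK = k := (ha₃.iv_eq _).trans eK₂
  have eR₃ : σ₃.iv vR = r := (ha₃.iv_eq _).trans eR₂
  have eP₃ : σ₃.iv vPp = p := (ha₃.iv_eq _).trans eP₂
  have eV₃ : σ₃.val mx = σ₂.val mx := ha₃.val_eq
  have eC₃ : σ₃.ia aC = σ₂.ia aC := ha₃.ia_eq _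
  have eE : ∀ i j, σ₂.ext mx c i j = σ₂.val mx i + edgeWeight mx c (σ.rv .lam) i j := fun i j => by
    rw [State.ext, eLam₂]
  have eE₃ : σ₃.ext mx c = σ₂.ext mx c := by
    funext i j
    rw [State.ext, State.ext, eLam₂, eLam₃, eV₃]
  simp only [eE] at hbest hfound
  refine .cons (.cond (by simp) (fun hb => ?_) fun hb => ?_)
  · simp only [BExp.Holds, IExp.eval, hJ, eP₃] at hb
    obtain ⟨⟨hb1, hb2⟩, hopt, hlt⟩ := hfound hb
    have hCb := hC₂ _ (by omega) ((hb2.le).trans hb)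
    refine .cons ((lwsStore_runs (mx := mx) (N := N) (by omega) hJ (by omega) (by omega)
      (by rw [eC₃]; omega)).agree.mono ?_)
    rintro t₄ σ₄ ⟨⟨ht₄, hne, hqv, hqC⟩, ha₄⟩
    rw [eE₃, eE] at hqv
    rw [eC₃] at hqC
    have eK₄ : σ₄.iv vK = k := (ha₄.iv_eq _).trans eK₃
    have eJ₄ : σ₄.iv vJ = q := (ha₄.iv_eq _).trans hJ
    refine .cons (.iset (by simp [eK₄]; omega) (.cons (.iset (by simp) (.nil (.nil
      ⟨k + 1, q, by simp [eJ₄], by simp [eK₄], ?_, fun j h1 h2 => ?_, by omega, by omega, .inr (by omega),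
      ?_⟩)))))
    · refine hx.restart hL hpN (totMono_nodeVal hc _ _) hkq hb hbest hb1 hb2 hopt hlt
        (fun j hj => ?_) hqv
      exact (hne j hj).1.trans (congrFun eV₃ j)
    · rcases h2.lt_or_eq with h2 | rfl
      · refine (hne j (by omega)).2.trans_le ?_
        rw [eC₃]
        exact hC₂ j h1 (by omega)
      · refine hqC.trans_le ?_
        omega
    · simp
      omega
  · simp only [BExp.Holds, IExp.eval, hJ, eP₃] at hb
    obtain rfl : q = p + 1 := by omega
    refine .iset (by simp) (.nil ⟨r, p, by simp [eP₃], by simp [eR₃], ?_, fun j h1 h2 => ?_, le_rfl, hkp,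
      by omega, ?_⟩)
    · exact cast (congrArg (fun E => Lws E _ s N r p) eV₃.symm) (hx.advance hL hpN hkp hbest)
    · exact (congrFun eC₃ j).trans_le (hC₂ j h1 h2)
    · simp
      omega

/-- The sum `r + k` pays for the rounds, and the extra term that is present while `k < N` pays for
the round that reaches `N`. -/
theorem depthProg_runs {s N : ℕ} (hc : IsMongeDAG s N c) (hB : 8 * N ≤ B) (hs : σ.iv .s = s)
    (hN : σ.iv .N = N) :
    Runs B c (depthProg mx) σ fun t σ' => t ≤ 15000 * (N - s + 1) ∧
      ∃ (E : ℕ → ℝ ×ₗ ℤ) (r : ℕ) (x : ℝ), Lws E (edgeWeight mx c (σ.rv .lam)) s N r N ∧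
        E N = nodeVal mx x (σ'.iv .d) := by
  have hsN := hc.1
  refine .cons (.iset (by simp) (.cons (.iset (by simp) (.cons (.rput (by simp) (by simp; omega)
    (by simp) (.cons (.iput (by simp) (by simp; omega) (by simp) (.cons (.while
    (fun τ φ => ∃ r k, τ.iv vK = k ∧ τ.iv vR = r ∧
      Lws (τ.val mx) (edgeWeight mx c (σ.rv .lam)) s N r k ∧
      (∀ j, s ≤ j → j ≤ k → τ.ia aC j ≤ j) ∧
      φ = 4010 * ((N - k) + (N - r)) + if k < N then 4010 * (N - s + 1) else 0)
    (4010 * ((N - s) + (N - s)) + 4010 * (N - s + 1)) ?_ ?_ ?_ ?_)))))))))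
  · refine ⟨s, s, by simp [hs], by simp [hs], ⟨le_rfl, le_rfl, hsN.le, ?_, fun j h1 h2 => by omega,
      fun i h1 h2 => by omega⟩, fun j h1 h2 => ?_, by rw [if_pos hsN]⟩
    · simp [State.val, hs]
      exact pathVal_zero (c := fun _ _ => 0) (v := id)
    · obtain rfl : s = j := by omega
      simp [hs]
  · rintro τ φ ha -
    simp
  · rintro τ φ ha ⟨r, k, h1, h2, h3, h4, rfl⟩ hb
    have eN : τ.iv .N = N := (ha.iv_eq _).trans hN
    have eLam : τ.rv .lam = σ.rv .lam := ha.rv_eq _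
    simp only [BExp.Holds, IExp.eval, h1, eN] at hb
    refine (lwsRound_runs (mx := mx) hc hB eN h1 h2 hb (by rw [eLam]; exact h3) h4).mono ?_
    rintro t τ' ⟨r', k', g1, g2, g3, g4, g5, g6, g7, g8⟩
    refine ⟨_, ⟨r', k', g1, g2, by rw [← eLam]; exact g3, g4, rfl⟩, ?_⟩
    have := g3.k_le
    have := g3.r_le
    have := h3.r_le
    have := h3.le_r
    rw [if_pos hb]
    simp
    split_ifs <;> omega
  · rintro τ φ t ha ⟨r, k, h1, h2, h3, h4, rfl⟩ hb ht
    have eN : τ.iv .N = N := (ha.iv_eq _).trans hN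
    simp only [BExp.Holds, IExp.eval, h1, eN] at hb
    obtain rfl : k = N := by have := h3.k_le; omega
    refine .cons (.iset (by simp [eN]; omega) (.nil ⟨?_, τ.val mx, r, τ.ra aF k, h3, ?_⟩))
    · simp at ht ⊢
      omega
    · simp [State.val, eN]

/-- The program that computes row minima into `out`. -/
def rowMinProg (out : RArr) : Cmd := block [
  .iset vA IVar.a, .iset vB IVar.b, .iset vJl IVar.lo, .iset vJh IVar.hi,
  forLoop vJ IVar.a IVar.b (block [.rput aF vJ (.get .f vJ), .iput aC vJ 0]),
  smawk false,
  forLoop vJ IVar.lo IVar.hi (.rput out vJ (.add (.get aF (.get aP vJ)) (.edge (.get aP vJ) vJ)))]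

theorem rowMinProg_runs {s N ca cb jl jh : ℕ} {out : RArr} (ho : out = .fbar ∨ out = .h)
    (hc : IsMongeDAG s N c) (hB : 8 * N ≤ B)
    (hca : s ≤ ca) (hcab : ca ≤ cb) (hcb : cb ≤ N) (hjl : ca < jl) (hjh : jl ≤ jh) (hN : jh ≤ N)
    (ha : σ.iv .a = ca) (hb : σ.iv .b = cb) (hlo : σ.iv .lo = jl) (hhi : σ.iv .hi = jh) :
    Runs B c (rowMinProg out) σ fun t σ' => t ≤ 2000 * ((cb - ca + 1) + (jh - jl + 1)) ∧
      ∀ j ∈ Set.Icc jl jh, IsLeast ((fun i => σ.ra .f i + c i j) '' {i | ca ≤ i ∧ i ≤ cb ∧ i < j})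
        (σ'.ra out j) := by
  have hB8 : 8 ≤ B := by have := hc.1; omega
  refine .cons (.iset (by simp) (.cons (.iset (by simp) (.cons (.iset (by simp) (.cons
    (.iset (by simp) (.cons (.for (L := ca) (H := cb) (T := 20) (fun i τ =>
      ∀ j, ca ≤ j → j < i → τ.ra aF j = σ.ra .f j ∧ τ.ia aC j = 0)
      (by simp) (by simp [ha]) (by omega) (by omega) (by omega) (fun j h1 h2 => by omega)
      ?_ ?_ ?_)))))))))
  · rintro i τ - hτ
    have : τ.iv .b = cb := (hτ.iv_eq _).trans hb
    simp [this]
  · rintro i τ h1 h2 h3 h4 hτ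
    have ef : τ.ra .f = σ.ra .f := hτ.ra_eq _
    refine .cons (.rput (by simp) (by simp [h3]; omega) (by simp [h3]; omega) (.cons (.iput (by simp)
      (by simp [h3]; omega) (by simp) (.nil ⟨by simp, by simp [h3], fun j hj hji => ?_⟩))))
    rcases Nat.lt_succ_iff_lt_or_eq.1 hji with hji | rfl
    · have := h4 j hj hji
      simp [h3, Function.update_of_ne (show j ≠ i by omega), this.1, this.2]
    · simp [h3, ef]
  rintro t₁ σ₁ h₁ ha₁ ht₁
  refine .cons ((smawk_runs hc hca hcab hcb hjl hjh hN hB ((ha₁.iv_eq _).trans ha)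
    ((ha₁.iv_eq _).trans hb) ((ha₁.iv_eq _).trans hlo)
    ((ha₁.iv_eq _).trans hhi)).agree.mono ?_)
  rintro t₂ σ₂ ⟨⟨hopt, ht₂⟩, ha₂⟩
  have eF₂ : σ₂.ra aF = σ₁.ra aF := ha₂.ra_eq _
  have elo : σ₂.iv .lo = jl := (ha₂.iv_eq _).trans ((ha₁.iv_eq _).trans hlo)
  have ehi : σ₂.iv .hi = jh := (ha₂.iv_eq _).trans ((ha₁.iv_eq _).trans hhi)
  have hout : aF ≠ out := by rcases ho with rfl | rfl <;> simp
  refine .cons (.for (L := jl) (H := jh) (T := 20) (fun i τ =>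
      ∀ j, jl ≤ j → j < i → τ.ra out j = σ₁.ra aF (σ₂.ia aP j) + c (σ₂.ia aP j) j)
      (by simp) (by simp [elo]) (by omega) (by omega) (by omega) (fun j h1 h2 => by omega)
      ?_ ?_ ?_)
  · rintro i τ - hτ
    have : τ.iv .hi = jh := (hτ.iv_eq _).trans ehi
    simp [this]
  · rintro i τ h1 h2 h3 h4 hτ
    have eP : τ.ia aP = σ₂.ia aP := hτ.ia_eq _
    have eF : τ.ra aF = σ₁.ra aF := by
      refine Eq.trans (hτ.ra _ ?_) eF₂
      simp [Cmd.writes, hout]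
    have hP := (hopt i h1 h2).1
    refine .rput (by simp) (by simp [h3]; omega) (by simp [h3, eP]; omega) ⟨by simp, by simp [h3],
      fun j hj hji => ?_⟩
    rcases Nat.lt_succ_iff_lt_or_eq.1 hji with hji | rfl
    · simp [h3, Function.update_of_ne (show j ≠ i by omega), h4 j hj hji]
    · simp [h3, eF, eP]
  · rintro t₃ σ₃ h₃ - ht₃
    refine .nil ⟨?_, fun j hj => ?_⟩
    · simp at ht₁ ht₃ ⊢
      omega
    · rw [h₃ j hj.1 (by have := hj.2; omega)]
      obtain ⟨hP, hd⟩ := hopt j hj.1 hj.2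
      -- With all link numbers set to zero the lexicographic order reduces to the order of the
      -- lengths.
      have e : ∀ i, ca ≤ i → i ≤ cb → σ₁.key false c i j = toLex (σ.ra .f i + c i j, (0 : ℤ)) := by
        intro i h1 h2
        have := h₁ i h1 (by omega)
        simp [State.key, key, this.1, this.2]
      refine ⟨⟨_, ⟨hP.1, hP.2, (hd ca le_rfl hcab (hjl.trans_le hj.1)).1⟩, ?_⟩, ?_⟩
      · simp only
        rw [(h₁ _ hP.1 (by omega)).1]
      · rintro _ ⟨i, ⟨h1, h2, h3⟩, rfl⟩
        have := (hd i h1 h2 h3).2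
        rw [e i h1 h2, e _ hP.1 hP.2, Prod.Lex.toLex_le_toLex] at this
        rw [(h₁ _ hP.1 (by omega)).1]
        exact this.elim le_of_lt fun h => h.1.le

/-! ### The concrete subroutines meet their specifications -/

def subroutines : Subroutines := ⟨rowMinProg, depthProg false, depthProg true⟩

/-- `R` is scratch memory or belongs to `al`. -/
def Region.allowed (al : List Region) : Region → Bool
  | .iv (.tmp _) | .rv (.tmp _) | .ia _ | .ra (.tmp _) => true
  | R => decide (R ∈ al)

theorem AgreeOff.frame {l : List Region} {X : Set IVar} {Y : Set RArr} {σ σ' : State}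
    (h : AgreeOff l σ σ') (al : List Region) (hl : l.all (Region.allowed al) = true)
    (hX : ∀ x, Region.iv x ∈ al → x ∈ X) (hlam : Region.rv .lam ∉ al)
    (hY : ∀ A, Region.ra A ∈ al → A ∈ Y) : Frame X Y σ σ' := by
  rw [List.all_eq_true] at hl
  refine ⟨fun x hx hxX => h.iv x fun hm => ?_, h.rv _ fun hm => ?_,
    fun A hA hAY => h.ra A fun hm => ?_⟩
  · have := hl _ hm
    cases x <;> simp_all [Region.allowed, IVar.IsTmp]
  · have := hl _ hm
    simp_all [Region.allowed]
  · have := hl _ hm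
    cases A <;> simp_all [Region.allowed, RArr.IsTmp]

theorem rowMinProg_correct {out : RArr} (ho : out = .fbar ∨ out = .h) :
    RowMinCorrect 20000 out (rowMinProg out) := by
  intro B c σ hc hB h1 h2 h3 h4 h5 h6
  obtain ⟨t, σ', he, ⟨ht, hmin⟩, ha⟩ := (rowMinProg_runs (B := B) ho hc (by omega) h1 h2 h3 h4 h5 h6
    rfl rfl rfl rfl).agree
  refine ⟨t, σ', he, by omega, ?_, hmin⟩
  rcases ho with rfl | rfl
  · exact ha.frame [.ra .fbar] rfl (by simp) (by simp) (by simp)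
  · exact ha.frame [.ra .h] rfl (by simp) (by simp) (by simp)

theorem depthProg_correct {mx : Bool} {g : (ℕ → ℕ → ℝ) → ℕ → ℝ → ℕ → ℕ}
    (hg : ∀ (c : ℕ → ℕ → ℝ) (s N : ℕ) (lam : ℝ) (E : ℕ → ℝ ×ₗ ℤ) (r : ℕ) (x : ℝ) (m : ℕ),
      Lws E (edgeWeight mx c lam) s N r N → E N = nodeVal mx x m → m = g c s lam N) :
    DepthCorrect 20000 g (depthProg mx) := by
  intro B c σ hc hB
  obtain ⟨t, σ', he, ⟨ht, E, r, x, hE, hx⟩, ha⟩ :=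
    (depthProg_runs (mx := mx) (B := B) hc (by omega) rfl rfl).agree
  exact ⟨t, σ', he, by omega, ha.frame [.iv .d] rfl (by simp) (by simp) (by simp),
    hg _ _ _ _ _ _ _ _ hE hx⟩

theorem subroutines_correct : subroutines.Correct 20000 :=
  ⟨rowMinProg_correct (.inl rfl), rowMinProg_correct (.inr rfl),
    depthProg_correct fun _ _ _ _ _ _ _ _ h hE => h.dMin_eq hE,
    depthProg_correct fun _ _ _ _ _ _ _ _ h hE => h.dMax_eq hE⟩

end MongeProbe

namespace MongeProbe

/-! ### The phases of the procedure -/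

variable {B : ℕ} {c : ℕ → ℕ → ℝ} {σ : State} {R : Subroutines} {s N M m r : ℕ}

section
variable {X : Set IVar} {Y : Set RArr} {σ₁ σ₂ : State} (h : Frame X Y σ₁ σ₂)
include h

theorem Frame.iv_eq (x : IVar) (h₁ : ¬ x.IsTmp := by exact id) (h₂ : x ∉ X := by simp) :
    σ₂.iv x = σ₁.iv x := h.1 x h₁ h₂

theorem Frame.ra_eq (A : RArr) (h₁ : ¬ A.IsTmp := by exact id) (h₂ : A ∉ Y := by simp) :
    σ₂.ra A = σ₁.ra A := h.2.2 A h₁ h₂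

theorem Frame.trans {σ₃ : State} (h' : Frame X Y σ₂ σ₃) : Frame X Y σ₁ σ₃ :=
  ⟨fun x h₁ h₂ => (h'.1 x h₁ h₂).trans (h.1 x h₁ h₂), h'.2.1.trans h.2.1,
    fun A h₁ h₂ => (h'.2.2 A h₁ h₂).trans (h.2.2 A h₁ h₂)⟩

theorem Frame.mono {X' : Set IVar} {Y' : Set RArr} (hX : X ⊆ X') (hY : Y ⊆ Y') :
    Frame X' Y' σ₁ σ₂ :=
  ⟨fun x h₁ h₂ => h.1 x h₁ fun h => h₂ (hX h), h.2.1, fun A h₁ h₂ => h.2.2 A h₁ fun h => h₂ (hY h)⟩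

theorem Frame.setI {x : IVar} (v : ℕ) (hx : x ∈ X := by simp) : Frame X Y σ₁ (σ₂.setI x v) :=
  h.trans ⟨fun y _ hy => by
    rw [setI_iv, if_neg]
    rintro rfl
    exact hy hx, rfl, fun _ _ _ => rfl⟩

end

/-- `f` and `fbar` hold the lengths of the shortest paths with `m` and `m + 1` links to the nodes up
to `n`. -/
def Tables (c : ℕ → ℕ → ℝ) (s m n : ℕ) (σ : State) : Prop :=
  (∀ j, s + m ≤ j → j ≤ n → σ.ra .f j = minLength c s m j) ∧
    ∀ j, s + m + 1 ≤ j → j ≤ n → σ.ra .fbar j = minLength c s (m + 1) j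

theorem Tables.sub_eq {n n' : ℕ} (h : Tables c s m n' σ) (hn : s + m + 1 ≤ n) (hn' : n ≤ n') :
    σ.ra .fbar n - σ.ra .f n = delta c s m n := by
  rw [h.1 n (by omega) hn', h.2 n hn hn', delta]

/-- The row minima over the nodes with shortest `k`-link paths are the lengths of the shortest paths
with `k + 1` links. -/
theorem eq_minLength_of_isLeast {F : ℕ → ℝ} {k a b j : ℕ} {x : ℝ} (hk : 1 ≤ k) (ha : a = s + k)
    (hj : a < j) (hjb : j ≤ b + 1) (hF : ∀ i, a ≤ i → i ≤ b → F i = minLength c s k i)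
    (hx : IsLeast ((fun i => F i + c i j) '' {i | a ≤ i ∧ i ≤ b ∧ i < j}) x) :
    x = minLength c s (k + 1) j := by
  subst ha
  have e : (fun i => F i + c i j) '' {i | s + k ≤ i ∧ i ≤ b ∧ i < j} =
      (fun i => minLength c s k i + c i j) '' {i | s + k ≤ i ∧ i < j} := by
    ext y
    constructor
    · rintro ⟨i, ⟨h1, h2, h3⟩, rfl⟩
      exact ⟨i, ⟨h1, h3⟩, by simp only; rw [hF i h1 h2]⟩
    · rintro ⟨i, ⟨h1, h3⟩, rfl⟩
      exact ⟨i, ⟨h1, by omega, h3⟩, by simp only; rw [hF i h1 (by omega)]⟩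
  rw [e] at hx
  exact hx.unique (isLeast_minLength_succ hk hj)

/-- The integer variables that `pbf` changes. -/
def pbfVars : Set IVar := {.k, .j, .a, .b, .lo, .hi}

/-- Every link number from `2` to `m` needs `w` rows and `w` columns for `w = n - s - m + 1`. At
20000 per row or column, with the copying, this stays below `41000 * w`. -/
theorem pbf_runs {n : ℕ} (hR : R.Correct 20000) (hc : IsMongeDAG s N c) (hm : 2 ≤ m)
    (hn : s + m + 1 ≤ n) (hnN : n ≤ N) (hB : 20000 * N ≤ B) (hs : σ.iv .s = s) (hN : σ.iv .N = N)
    (hM : σ.iv .m = m) (hn' : σ.iv .n = n) :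
    Runs B c (pbf R) σ fun t σ' => t ≤ 50000 * m * (n - s - m + 1) ∧ Tables c s m n σ' ∧
      Frame pbfVars {.f, .fbar} σ σ' := by
  obtain ⟨w, hw⟩ : ∃ w, w = n - s - m + 1 := ⟨_, rfl⟩
  refine .cons (.for (L := s + 1) (H := n - m + 1) (T := 10) (fun i τ =>
    ∀ j, s + 1 ≤ j → j < i → τ.ra .f j = c s j)
    (by simp; omega) (by simp [hs]) (by omega) (by omega) (by omega) (fun j h1 h2 => by omega)
    ?_ ?_ ?_)
  · rintro i τ - ha
    have h1 : τ.iv .n = n := (ha.iv_eq _).trans hn'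
    have h2 : τ.iv .m = m := (ha.iv_eq _).trans hM
    simp [h1, h2]
    omega
  · rintro i τ h1 h2 h3 h4 ha
    have e1 : τ.iv .s = s := (ha.iv_eq _).trans hs
    refine .rput (by simp) (by simp [h3]; omega) (by simp) ⟨by simp, by simp [h3], fun j hj hji => ?_⟩
    rcases Nat.lt_succ_iff_lt_or_eq.1 hji with hji | rfl
    · simp [h3, Function.update_of_ne (show j ≠ i by omega), h4 j hj hji]
    · simp [h3, e1]
  rintro t₁ σ₁ h₁ ha₁ ht₁
  have hF₁ : Frame pbfVars {.f, .fbar} σ σ₁ :=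
    ha₁.frame [.iv .j, .ra .f] rfl (by simp [pbfVars]) (by simp) (by simp)
  -- The subroutines are arbitrary here, so the written regions are unknown; the invariant carries
  -- `Frame` instead.
  refine .cons (.iset (by simp; omega) (.cons (.loop (φ := 41000 * w * (m - 1))
    (fun τ φ => ∃ k, 2 ≤ k ∧ k ≤ m + 1 ∧ τ.iv .k = k ∧ Frame pbfVars {.f, .fbar} σ τ ∧
      (∀ j, s + k - 1 ≤ j → j ≤ n - m + k - 1 → τ.ra .f j = minLength c s (k - 1) j) ∧
      φ = 41000 * w * (m + 1 - k)) ?_ ?_ ?_ ?_)))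
  · refine ⟨2, le_rfl, by omega, by simp, hF₁.setI _ (by simp [pbfVars]), fun j h1 h2 => ?_, rfl⟩
    rw [minLength_one (by omega)]
    exact h₁ j (by omega) (by omega)
  · rintro τ φ -
    simp
  · rintro τ φ ⟨k, h1, h2, h3, h4, h5, rfl⟩ hb
    have e1 : τ.iv .s = s := (h4.iv_eq _ id (by simp [pbfVars])).trans hs
    have e2 : τ.iv .N = N := (h4.iv_eq _ id (by simp [pbfVars])).trans hN
    have e3 : τ.iv .m = m := (h4.iv_eq _ id (by simp [pbfVars])).trans hM
    have e4 : τ.iv .n = n := (h4.iv_eq _ id (by simp [pbfVars])).trans hn'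
    simp only [BExp.Holds, IExp.eval, h3, e3] at hb
    refine .cons (.iset (by simp [e1, h3]; omega) (.cons (.iset (by simp [e3, e4, h3]; omega) (.cons
      (.iset (by simp [e1, h3]; omega) (.cons (.iset (by simp [e3, e4, h3]; omega) (.cons ?_))))))))
    refine Runs.mono (hR.rowMin_fbar B c _ (by simpa [e1, e2] using hc) (by simpa [e2] using hB)
      (by simp [e1, h3]; omega) (by simp [e1, e3, e4, h3]; omega) (by simp [e2, e3, e4, h3]; omega)
      (by simp [e1, h3]; omega) (by simp [e1, e3, e4, h3]; omega)
      (by simp [e2, e3, e4, h3]; omega)) ?_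
    rintro t₂ σ₂ ⟨ht₂, hF₂, hmin⟩
    have hF₂' : Frame pbfVars {.f, .fbar} σ σ₂ := by
      refine Frame.trans ?_ (hF₂.mono (by simp) (by simp))
      exact (((h4.setI _ (by simp [pbfVars])).setI _ (by simp [pbfVars])).setI _
        (by simp [pbfVars])).setI _ (by simp [pbfVars])
    have f1 : σ₂.iv .s = s := (hF₂'.iv_eq _ id (by simp [pbfVars])).trans hs
    have f3 : σ₂.iv .m = m := (hF₂'.iv_eq _ id (by simp [pbfVars])).trans hM
    have f4 : σ₂.iv .n = n := (hF₂'.iv_eq _ id (by simp [pbfVars])).trans hn'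
    have f5 : σ₂.iv .k = k := (hF₂.iv_eq _).trans (by simp [h3])
    have hfb : ∀ j, s + k ≤ j → j ≤ n - m + k → σ₂.ra .fbar j = minLength c s k j := by
      intro j hj1 hj2
      have := hmin j ⟨by simp [e1, h3]; omega, by simp [e3, e4, h3]; omega⟩
      have := eq_minLength_of_isLeast (k := k - 1) (s := s) (by omega) (by simp [e1, h3]; omega)
        (by simp [e1, h3]; omega) (by simp [e3, e4, h3]; omega) (fun i hi1 hi2 => h5 i (by
          simp [e1, h3] at hi1; omega) (by simp [e3, e4, h3] at hi2; omega)) this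
      rwa [show k - 1 + 1 = k by omega] at this
    refine .cons (.for (L := s + k) (H := n - m + k) (T := 10) (fun i τ =>
      ∀ j, s + k ≤ j → j < i → τ.ra .f j = minLength c s k j)
      (by simp [f1, f5]; omega) (by simp [f1, f5]) (by omega) (by omega) (by omega)
      (fun j h1 h2 => by omega) ?_ ?_ ?_)
    · rintro i τ' - ha
      have g1 : τ'.iv .n = n := (ha.iv_eq _).trans f4
      have g2 : τ'.iv .m = m := (ha.iv_eq _).trans f3
      have g3 : τ'.iv .k = k := (ha.iv_eq _).trans f5
      simp [g1, g2, g3]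
      omega
    · rintro i τ' g1 g2 g3 g4 ha
      have g5 : τ'.ra .fbar = σ₂.ra .fbar := ha.ra_eq _
      refine .rput (by simp) (by simp [g3]; omega) (by simp [g3]; omega) ⟨by simp, by simp [g3],
        fun j hj hji => ?_⟩
      rcases Nat.lt_succ_iff_lt_or_eq.1 hji with hji | rfl
      · simp [g3, Function.update_of_ne (show j ≠ i by omega), g4 j hj hji]
      · simp [g3, g5, hfb j hj g2]
    · rintro t₃ σ₃ h₃ ha₃ ht₃
      have g1 : σ₃.iv .k = k := (ha₃.iv_eq _).trans f5
      have hF₃ : Frame pbfVars {.f, .fbar} σ₂ σ₃ :=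
        ha₃.frame [.iv .j, .ra .f] rfl (by simp [pbfVars]) (by simp) (by simp)
      refine .cons (.iset (by simp [g1]; omega) (.nil ⟨41000 * w * (m + 1 - (k + 1)), ⟨k + 1, by omega,
        by omega, by simp [g1], (hF₂'.trans hF₃).setI _ (by simp [pbfVars]), fun j hj1 hj2 => ?_, rfl⟩,
        ?_⟩))
      · exact h₃ j (by omega) (by omega)
      · simp [e1, e3, e4, h3] at ht₂
        simp at ht₃ ⊢
        obtain ⟨d, rfl⟩ := Nat.exists_eq_add_of_le hb
        rw [show k + d + 1 - k = (k + d - k) + 1 by omega, mul_add _ (k + d - k) 1]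
        omega
  · rintro τ φ t ⟨k, h1, h2, h3, h4, h5, rfl⟩ hb ht
    have e1 : τ.iv .s = s := (h4.iv_eq _ id (by simp [pbfVars])).trans hs
    have e2 : τ.iv .N = N := (h4.iv_eq _ id (by simp [pbfVars])).trans hN
    have e3 : τ.iv .m = m := (h4.iv_eq _ id (by simp [pbfVars])).trans hM
    have e4 : τ.iv .n = n := (h4.iv_eq _ id (by simp [pbfVars])).trans hn'
    simp only [BExp.Holds, IExp.eval, h3, e3] at hb
    obtain rfl : k = m + 1 := by omega
    refine .cons (.iset (by simp [e1, e3]; omega) (.cons (.iset (by simp; omega) (.cons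
      (.iset (by simp [e1, e3]; omega) (.cons (.iset (by simp) (.cons ?_))))))))
    refine Runs.mono (hR.rowMin_fbar B c _ (by simpa [e1, e2] using hc) (by simpa [e2] using hB)
      (by simp [e1]) (by simp [e1, e3, e4]; omega) (by simp [e2, e4]; omega)
      (by simp [e1, e3]) (by simp [e1, e3, e4]; omega)
      (by simp [e2, e4]; omega)) ?_
    rintro t₂ σ₂ ⟨ht₂, hF₂, hmin⟩
    have hF₂' : Frame pbfVars {.f, .fbar} σ σ₂ := by
      refine Frame.trans ?_ (hF₂.mono (by simp) (by simp))
      exact (((h4.setI _ (by simp [pbfVars])).setI _ (by simp [pbfVars])).setI _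
        (by simp [pbfVars])).setI _ (by simp [pbfVars])
    refine .nil ⟨?_, ⟨fun j hj1 hj2 => ?_, fun j hj1 hj2 => ?_⟩, hF₂'⟩
    · simp [e1, e3, e4] at ht₂
      simp at ht₁ ht ⊢
      rw [← hw]
      obtain ⟨d, rfl⟩ := Nat.exists_eq_add_of_le hm
      have e : 50000 * (2 + d) * w = 41000 * w * (2 + d - 1) + (9000 * (w * d) + 59000 * w) := by
        rw [show 2 + d - 1 = d + 1 by omega]
        ring
      rw [e]
      omega
    · rw [hF₂.ra_eq .f]
      exact h5 j (by omega) (by omega)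
    · have := hmin j ⟨by simp [e1, e3]; omega, by simp [e4]; omega⟩
      exact eq_minLength_of_isLeast (s := s) (by omega) (by simp [e1, e3])
        (by simp [e1, e3]; omega) (by simp [e4]; omega) (fun i hi1 hi2 => h5 i (by
          simp [e1, e3] at hi1; omega) (by simp [e4] at hi2; omega)) this

end MongeProbe

/-! ### The two searches, the final test and the contraction -/

namespace MongeProbe

variable {B : ℕ} {c : ℕ → ℕ → ℝ} {σ σ' : State} {R : Subroutines} {s N M m r : ℕ}

theorem Tables.mono {n n' : ℕ} (h : Tables c s m n' σ) (hn : n ≤ n') : Tables c s m n σ :=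
  ⟨fun j h1 h2 => h.1 j h1 (h2.trans hn), fun j h1 h2 => h.2 j h1 (h2.trans hn)⟩

theorem Tables.congr {n : ℕ} (h : Tables c s m n σ) (h₁ : σ'.ra .f = σ.ra .f)
    (h₂ : σ'.ra .fbar = σ.ra .fbar) : Tables c s m n σ' := by
  simpa [Tables, h₁, h₂] using h

/-- The variable `lam` holds a sample that lies in `Λ_s(M,N)`. -/
def Hit (c : ℕ → ℕ → ℝ) (s N M m : ℕ) (σ : State) : Prop :=
  σ.iv .hit = 1 ∧ σ.rv .lam ∈ Lam c s M N ∧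
    ∃ n ∈ Set.Icc (s + m + 1) (N - M + m), σ.rv .lam = delta c s m n

/-- The probe `r` lies in the interval `(n₁, n₂]` of length at most `w`, on which the samples are
known. -/
def Bracket (c : ℕ → ℕ → ℝ) (s N M m r w : ℕ) (σ : State) : Prop :=
  σ.iv .hit = 0 ∧ s + m ≤ σ.iv .n₁ ∧ σ.iv .n₁ < r ∧ r ≤ σ.iv .n₂ ∧ σ.iv .n₂ ≤ N - M + m ∧
    σ.iv .n₂ ≤ σ.iv .n₁ + w ∧ Tables c s m (σ.iv .n₂) σ

section
variable (hR : R.Correct 20000) (hc : IsMongeDAG s N c) (hM : 4 ≤ M) (hN : M + s + 1 ≤ N)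
  (hm : 2 ≤ m) (hmM : m + 2 ≤ M) (hr : IsProbe c s N M m r) (hB : 20000 * N ≤ B)
include hc hM hN hm hmM hr

/-- The sample at `n` exceeds `delta c s M N`, whereas all samples from the probe on do not. -/
theorem lt_probe_of_lt_dMin {n : ℕ} (hn : n ≤ N - M + m) (h : M < dMin c s (delta c s m n) N) :
    n < r := by
  by_contra! hle
  have h1 := delta_lt_of_lt_dMin hc (by omega) hN h
  have h2 := delta_anti_end hc (m := m) (by omega) hr.1.1.1 hle (by omega)
  exact absurd hr.1.2 (not_le.2 (h1.trans_le h2))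

omit hm hmM in
theorem probe_le_of_dMin_lt {n : ℕ} (hn : s + m + 1 ≤ n) (hn' : n ≤ N - M + m)
    (h : dMin c s (delta c s m n) N < M) : r ≤ n := by
  have h1 := le_delta_of_dMin_lt hc (by omega) hN h
  exact hr.2 ⟨⟨hn, hn'⟩, h1.trans (delta_mono_links hc (by omega) (by omega) (by omega) le_rfl)⟩

/-- A sample in `Lam` lies at or beyond the probe, so the sample at `r` is at least as large and
reaches the left end of `Lam`; then `dMax` at `r` would be at least `M`. -/
theorem not_mem_Lam_of_dMax_lt (h : dMax c s (delta c s m r) N < M) :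
    ∀ n ∈ Set.Icc (s + m + 1) (N - M + m), delta c s m n ∉ Lam c s M N := by
  rintro n ⟨h1, h2⟩ ⟨h3, h4⟩
  have h5 : r ≤ n := hr.2 ⟨⟨h1, h2⟩, h4⟩
  have h6 := delta_anti_end hc (m := m) (by omega) hr.1.1.1 h5 (by omega)
  exact absurd ((le_dMax_iff hc (by omega) hN).2 (h3.trans h6)) (not_le.2 h)

omit hc hM hN hmM in
theorem contraction_eq_of_isLeast {j : ℕ} {x : ℝ} (hj : r ≤ j) {F : ℕ → ℝ}
    (hF : ∀ i, s + m ≤ i → i ≤ r → F i = minLength c s m i)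
    (hx : IsLeast ((fun i => F i + c i j) '' {i | s + m ≤ i ∧ i ≤ r - 1 ∧ i < j}) x) :
    x = contraction c s m r (r - 1) j := by
  have := hr.1.1.1
  rw [contraction, if_pos rfl, ← hx.csInf_eq]
  congr 1
  ext y
  constructor
  · rintro ⟨i, ⟨h1, h2, h3⟩, rfl⟩
    exact ⟨i, ⟨h1, by omega⟩, by simp only; rw [hF i h1 (by omega)]⟩
  · rintro ⟨i, ⟨h1, h3⟩, rfl⟩
    exact ⟨i, ⟨h1, by omega, by omega⟩, by simp only; rw [hF i h1 (by omega)]⟩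

include hR hB

set_option maxHeartbeats 1000000 in
-- After `i` doublings `n₁ = s + m + 2 ^ i - 1`. As `n₁ < r`, the power `2 ^ i` is at most `D = r -
-- s - m`, so at most `Nat.log 2 D + 1` rounds occur. Round `i` spends at most `E * 2 ^ i` on the
-- tables, and these costs sum to at most `2 * (E * D)`.
theorem expSearch_runs (hσ : IsInput s N M m σ) :
    Runs B c (expSearch R) σ fun t σ' =>
      t ≤ 200000 * m * (r - s - m) + (20000 * (N - s + 1) + 200) * (Nat.log 2 (r - s - m) + 1) + 50 ∧
        IsInput s N M m σ' ∧ σ'.iv .n₁ < r ∧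
        (Hit c s N M m σ' ∨ Bracket c s N M m r (2 ^ Nat.log 2 (r - s - m)) σ') := by
  obtain ⟨i1, i2, i3, i4⟩ := hσ
  have hr1 := hr.1.1.1
  have hr2 := hr.1.1.2
  obtain ⟨D, hD⟩ : ∃ D, D = r - s - m := ⟨_, rfl⟩
  obtain ⟨k, hk⟩ : ∃ k, k = Nat.log 2 D := ⟨_, rfl⟩
  obtain ⟨E, hE⟩ : ∃ E, E = 100000 * m := ⟨_, rfl⟩
  obtain ⟨G, hG⟩ : ∃ G, G = 20000 * (N - s + 1) + 200 := ⟨_, rfl⟩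
  rw [← hD, ← hk, ← hG, show 200000 * m * D = 2 * (E * D) by rw [hE]; ring]
  refine .cons (.iset (by simp; omega) (.cons (.iset (by simp; omega) (.cons (.iset (by simp; omega)
    (.cons (.iset (by simp) (.cons (.iset (by simp; omega) (.cons ?_))))))))))
  refine .loop (φ := 2 * (E * D) + G * (k + 1)) (fun τ φ => IsInput s N M m τ ∧
    τ.iv .n₁ < r ∧ ((τ.iv .go = 1 ∧ τ.iv .hit = 0 ∧ τ.iv .n₂ = N - M + m ∧ ∃ i, τ.iv .l = 2 ^ i ∧
      τ.iv .n₁ + 1 = s + m + 2 ^ i ∧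
      φ + (E * 2 ^ i + G * i) = 2 * (E * D) + G * (k + 1) + E) ∨
    (τ.iv .go = 0 ∧ φ = 0 ∧ (Hit c s N M m τ ∨
      (τ.iv .hit = 0 ∧ s + m ≤ τ.iv .n₁ ∧ r ≤ τ.iv .n ∧ τ.iv .n ≤ N - M + m ∧
        τ.iv .n ≤ τ.iv .n₁ + 2 ^ k ∧ Tables c s m (τ.iv .n) τ))))) ?_ ?_ ?_ ?_
  · refine ⟨⟨by simp [i1], by simp [i2], by simp [i3], by simp [i4]⟩,
      by simp [i1, i4]; omega, .inl ⟨by simp, by simp,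
      by simp [i2, i3, i4], 0, by simp, by simp [i1, i4], by simp⟩⟩
  · rintro τ φ -
    simp
    omega
  · rintro τ φ ⟨⟨e1, e2, e3, e4⟩, h6, ⟨h1, h2, h3, i, h4, h5, h7⟩ | ⟨h1, -⟩⟩ hb
    swap
    · simp [h1] at hb
    have hi : 2 ^ i ≤ D := by omega
    have hik : i ≤ k := by rw [hk]; exact Nat.le_log_of_pow_le (by omega) hi
    have hpos : 1 ≤ 2 ^ i := Nat.one_le_two_pow
    have hpk : 2 ^ i ≤ 2 ^ k := Nat.pow_le_pow_right (by omega) hik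
    have hED : E * 2 ^ i ≤ E * D := Nat.mul_le_mul_left _ hi
    have hGk : G * i ≤ G * k := Nat.mul_le_mul_left _ hik
    have hGk' : G * (k + 1) = G * k + G := by ring
    have hGi : G * (i + 1) = G * i + G := by ring
    have hEi : E * 2 ^ (i + 1) = E * 2 ^ i + E * 2 ^ i := by ring
    have hpi : 2 ^ (i + 1) = 2 ^ i + 2 ^ i := by ring
    obtain ⟨n, hn⟩ : ∃ n, n = min (τ.iv .n₁ + τ.iv .l) (N - M + m) := ⟨_, rfl⟩
    have hn1 : s + m + 1 ≤ n := by omega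
    have hn2 : n ≤ N - M + m := by omega
    have hset : Runs B c (.cond (.ilt IVar.n₂ IVar.n) (.iset .n IVar.n₂) .skip)
        (τ.setI .n (τ.iv .n₁ + τ.iv .l))
        fun t τ' => t ≤ 6 ∧ (∀ x, x ≠ .n → τ'.iv x = τ.iv x) ∧ τ'.iv .n = n := by
      refine .cond (by simp) (fun hb => .iset (by simp) ⟨by simp, fun x hx => by simp [hx], ?_⟩)
        (fun hb => .skip ⟨by simp, fun x hx => by simp [hx], ?_⟩)
      · simp [h3] at hb ⊢
        omega
      · simp [h3] at hb ⊢
        omega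
    refine .cons (.iset (by simp; omega) (.cons (hset.mono ?_)))
    rintro t₀ τ₀ ⟨ht₀, hτ₀, hn₀⟩
    refine .cons ((pbf_runs hR hc hm hn1 (by omega) hB (by simp [hτ₀, e1]) (by simp [hτ₀, e2])
      (by simp [hτ₀, e4]) hn₀).mono ?_)
    rintro t₁ τ₁ ⟨ht₁, hT, hF₁⟩
    have hv (x : IVar) (h₁ : ¬ x.IsTmp) (h₂ : x ∉ pbfVars) (h₃ : x ≠ .n) : τ₁.iv x = τ.iv x :=
      (hF₁.iv_eq x h₁ h₂).trans (hτ₀ x h₃)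
    have g0 : τ₁.iv .n = n := (hF₁.iv_eq .n id (by simp [pbfVars])).trans hn₀
    have g1 : τ₁.iv .s = s := (hv _ id (by simp [pbfVars]) (by simp)).trans e1
    have g2 : τ₁.iv .N = N := (hv _ id (by simp [pbfVars]) (by simp)).trans e2
    have g3 : τ₁.iv .M = M := (hv _ id (by simp [pbfVars]) (by simp)).trans e3
    have g4 : τ₁.iv .m = m := (hv _ id (by simp [pbfVars]) (by simp)).trans e4
    have g5 : τ₁.iv .n₁ = τ.iv .n₁ := hv _ id (by simp [pbfVars]) (by simp)
    have g6 : τ₁.iv .n₂ = N - M + m := (hv _ id (by simp [pbfVars]) (by simp)).trans h3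
    have g7 : τ₁.iv .l = 2 ^ i := (hv _ id (by simp [pbfVars]) (by simp)).trans h4
    have g8 : τ₁.iv .hit = 0 := (hv _ id (by simp [pbfVars]) (by simp)).trans h2
    have g9 : τ₁.iv .go = 1 := (hv _ id (by simp [pbfVars]) (by simp)).trans h1
    have hlam : τ₁.ra .fbar n - τ₁.ra .f n = delta c s m n := hT.sub_eq hn1 le_rfl
    refine .cons (.rset (by simp [g0]; omega) (.cons ?_))
    refine Runs.mono (hR.dMin B c _ (by simpa [g1, g2] using hc) (by simpa [g2] using hB)) ?_
    rintro t₂ τ₂ ⟨ht₂, hF₂, hd⟩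
    simp [g0, g1, g2, hlam] at ht₂ hd
    have k0 : τ₂.iv .n = n := (hF₂.iv_eq .n).trans g0
    have k1 : τ₂.iv .s = s := (hF₂.iv_eq .s).trans g1
    have k2 : τ₂.iv .N = N := (hF₂.iv_eq .N).trans g2
    have k3 : τ₂.iv .M = M := (hF₂.iv_eq .M).trans g3
    have k4 : τ₂.iv .m = m := (hF₂.iv_eq .m).trans g4
    have k5 : τ₂.iv .n₁ = τ.iv .n₁ := (hF₂.iv_eq .n₁).trans g5
    have k6 : τ₂.iv .n₂ = N - M + m := (hF₂.iv_eq .n₂).trans g6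
    have k7 : τ₂.iv .l = 2 ^ i := (hF₂.iv_eq .l).trans g7
    have k8 : τ₂.iv .hit = 0 := (hF₂.iv_eq .hit).trans g8
    have k9 : τ₂.iv .go = 1 := (hF₂.iv_eq .go).trans g9
    have kl : τ₂.rv .lam = delta c s m n := hF₂.2.1.trans (by simp [g0, hlam])
    have hT₂ : Tables c s m n τ₂ := hT.congr (hF₂.ra_eq .f) (hF₂.ra_eq .fbar)
    -- Here `n - s - m + 1 ≤ 2 * 2 ^ i`, which explains the factor in `E = 100000 * m`.
    have ht₁' : t₁ ≤ E * 2 ^ i := by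
      refine ht₁.trans ?_
      rw [hE, show 100000 * m * 2 ^ i = 50000 * m * (2 * 2 ^ i) by ring]
      exact Nat.mul_le_mul_left _ (by omega)
    have inp : IsInput s N M m τ₂ := ⟨k1, k2, k3, k4⟩
    refine .cons (.cond (by simp) (fun hb => ?_) fun hb => .cond (by simp) (fun hb' => ?_)
      fun hb' => ?_)
    · simp [k3, hd] at hb
      refine .cons (.iset (by simp; omega) (.cons (.iset (by simp) (.nil (.nil ⟨0, ?_, ?_⟩)))))
      · refine ⟨by simpa [IsInput] using inp, by simpa [k5] using h6, .inr ⟨by simp, rfl, .inl ⟨by simp, ?_, n,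
          ⟨hn1, hn2⟩, by simp [kl]⟩⟩⟩
        simpa [kl] using mem_Lam_of_dMin_eq hc (by omega) hN hb
      · simp
        omega
    · simp [k3, hd] at hb hb'
      have hnr := lt_probe_of_lt_dMin hc hM hN hm hmM hr hn2 hb'
      -- As `n < r ≤ N - M + m`, the node was not clipped.
      have hn' : n + 1 = s + m + 2 ^ (i + 1) := by omega
      refine .cons (.iset (by simp) (.cons (.iset (by simp [k7]; omega) (.nil (.nil
        ⟨2 * (E * D) + G * (k + 1) + E - (E * 2 ^ (i + 1) + G * (i + 1)), ?_, ?_⟩)))))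
      · have hi' : 2 ^ (i + 1) ≤ D := by omega
        have hED' : E * 2 ^ (i + 1) ≤ E * D := Nat.mul_le_mul_left _ hi'
        refine ⟨by simpa [IsInput] using inp, by simpa [k0] using hnr, .inl ⟨by simp [k9],
          by simp [k8], by simp [k6], i + 1, by simp [k7, hpi], by simp [k0, hn'], by omega⟩⟩
      · simp
        have hi' : 2 ^ (i + 1) ≤ D := by omega
        have hED' : E * 2 ^ (i + 1) ≤ E * D := Nat.mul_le_mul_left _ hi'
        omega
    · simp [k3, hd] at hb hb'
      have hnr := probe_le_of_dMin_lt hc hM hN hr hn1 hn2 (by omega)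
      refine .iset (by simp) (.nil ⟨0, ?_, ?_⟩)
      · refine ⟨by simpa [IsInput] using inp, by simpa [k5] using h6, .inr ⟨by simp, rfl, .inr
          ⟨by simp [k8], by simp [k5]; omega, by simpa [k0] using hnr,
          by simpa [k0] using hn2, by simp [k0, k5]; omega, by simpa [k0, Tables] using hT₂⟩⟩⟩
      · simp
        omega
  · rintro τ φ t ⟨inp, h6, ⟨h1, -⟩ | ⟨h1, rfl, h2⟩⟩ hb ht
    · simp [h1] at hb
    simp at ht
    refine .cons (.iset (by simp) (.nil ⟨by simp; omega, by simpa [IsInput] using inp,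
      by simpa using h6, ?_⟩))
    rcases h2 with h2 | h2
    · exact .inl (by simpa [Hit] using h2)
    · exact .inr (by simpa [Bracket, Tables, h6] using h2)

/-- The bracket of length at most `2 ^ i` halves in each round, and the tables already cover it, so
a round costs one call of `dMin`. At length one its right end is the probe. -/
theorem binSearch_runs {k : ℕ} (hσ : IsInput s N M m σ) (hσ' : σ.iv .n₁ < r)
    (h : Hit c s N M m σ ∨ Bracket c s N M m r (2 ^ k) σ) :
    Runs B c (binSearch R) σ fun t σ' =>
      t ≤ (20000 * (N - s + 1) + 100) * k + 20 ∧ IsInput s N M m σ' ∧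
        (Hit c s N M m σ' ∨ σ'.iv .n₂ = r ∧ Bracket c s N M m r 1 σ') := by
  have hr1 := hr.1.1.1
  have hr2 := hr.1.1.2
  obtain ⟨G, hG⟩ : ∃ G, G = 20000 * (N - s + 1) + 100 := ⟨_, rfl⟩
  rw [← hG]
  refine .loop (φ := G * k) (fun τ φ => IsInput s N M m τ ∧ τ.iv .n₁ < r ∧ (Hit c s N M m τ ∨
    ∃ i, φ = G * i ∧ Bracket c s N M m r (2 ^ i) τ)) ?_ ?_ ?_ ?_
  · exact ⟨hσ, hσ', h.imp_right fun h => ⟨k, rfl, h⟩⟩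
  · rintro τ φ ⟨-, h, -⟩
    simp
    omega
  · rintro τ φ ⟨⟨e1, e2, e3, e4⟩, h6, h1 | ⟨i, rfl, h0, h1, h2, h3, h4, h5, hT⟩⟩ hb
    · simp [h1.1] at hb
    simp [h0] at hb
    obtain _ | i := i
    · simp at h5
      omega
    have hpi : 2 ^ (i + 1) = 2 ^ i + 2 ^ i := by ring
    have hGi : G * (i + 1) = G * i + G := by ring
    obtain ⟨n, hn⟩ : ∃ n, n = (τ.iv .n₁ + τ.iv .n₂ + 1) / 2 := ⟨_, rfl⟩
    have hn1 : s + m + 1 ≤ n := by omega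
    have hn2 : n ≤ N - M + m := by omega
    have hlam : τ.ra .fbar n - τ.ra .f n = delta c s m n := hT.sub_eq hn1 (by omega)
    refine .cons (.iset (by simp; omega) (.cons (.rset (by simp [← hn]; omega) (.cons ?_))))
    refine Runs.mono (hR.dMin B c _ (by simpa [e1, e2] using hc) (by simpa [e2] using hB)) ?_
    rintro t₂ τ₂ ⟨ht₂, hF₂, hd⟩
    simp [← hn, e1, e2, hlam] at ht₂ hd
    have k0 : τ₂.iv .n = n := (hF₂.iv_eq .n).trans hn.symm
    have k1 : τ₂.iv .s = s := (hF₂.iv_eq .s).trans e1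
    have k2 : τ₂.iv .N = N := (hF₂.iv_eq .N).trans e2
    have k3 : τ₂.iv .M = M := (hF₂.iv_eq .M).trans e3
    have k4 : τ₂.iv .m = m := (hF₂.iv_eq .m).trans e4
    have k5 : τ₂.iv .n₁ = τ.iv .n₁ := hF₂.iv_eq .n₁
    have k6 : τ₂.iv .n₂ = τ.iv .n₂ := hF₂.iv_eq .n₂
    have k8 : τ₂.iv .hit = 0 := (hF₂.iv_eq .hit).trans h0
    have kl : τ₂.rv .lam = delta c s m n := hF₂.2.1.trans (by simp [← hn, hlam])
    have hT₂ : Tables c s m (τ.iv .n₂) τ₂ := hT.congr (hF₂.ra_eq .f) (hF₂.ra_eq .fbar)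
    have inp : IsInput s N M m τ₂ := ⟨k1, k2, k3, k4⟩
    refine .cons (.cond (by simp) (fun hb => ?_) fun hb => .cond (by simp) (fun hb' => ?_)
      fun hb' => ?_)
    · simp [k3, hd] at hb
      refine .iset (by simp; omega) (.nil ⟨0, ?_, ?_⟩)
      · refine ⟨by simpa [IsInput] using inp, by simpa [k5] using h6, .inl ⟨by simp, ?_, n, ⟨hn1, hn2⟩, by simp [kl]⟩⟩
        simpa [kl] using mem_Lam_of_dMin_eq hc (by omega) hN hb
      · simp
        omega
    · simp [k3, hd] at hb hb'
      have hnr := lt_probe_of_lt_dMin hc hM hN hm hmM hr hn2 hb'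
      refine .iset (by simp) (.nil ⟨G * i, ?_, ?_⟩)
      · refine ⟨by simpa [IsInput] using inp, by simpa [k0] using hnr, .inr ⟨i, rfl, by simp [k8], by simp [k0]; omega,
          by simpa [k0] using hnr, by simp [k6]; omega, by simp [k6]; omega, by simp [k0, k6]; omega,
          by simpa [k6, Tables] using hT₂⟩⟩
      · simp
        omega
    · simp [k3, hd] at hb hb'
      have hnr := probe_le_of_dMin_lt hc hM hN hr hn1 hn2 (by omega)
      refine .iset (by simp) (.nil ⟨G * i, ?_, ?_⟩)
      · refine ⟨by simpa [IsInput] using inp, by simpa [k5] using h6, .inr ⟨i, rfl, by simp [k8], by simp [k5]; omega,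
          by simp [k5]; omega, by simp [k0]; omega, by simp [k0]; omega, by simp [k0, k5]; omega,
          by simpa [k0, Tables] using hT₂.mono (n := n) (by omega)⟩⟩
      · simp
        omega
  · rintro τ φ t ⟨inp, -, h⟩ hb ht
    simp at ht
    refine ⟨by omega, inp, h.imp_right ?_⟩
    rintro ⟨i, rfl, h0, h1, h2, h3, h4, h5, hT⟩
    simp [h0] at hb
    exact ⟨by omega, h0, h1, h2, h3, h4, by omega, hT⟩

theorem finalTest_runs (hσ : IsInput s N M m σ) (hn₂ : σ.iv .n₂ = r)
    (h : Bracket c s N M m r 1 σ) :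
    Runs B c (finalTest R) σ fun t σ' =>
      t ≤ 20000 * (N - s + 1) + 50 ∧ IsInput s N M m σ' ∧ (Hit c s N M m σ' ∨
        (σ'.iv .hit = 0 ∧ σ'.iv .r = r ∧ Tables c s m r σ' ∧
          ∀ n ∈ Set.Icc (s + m + 1) (N - M + m), delta c s m n ∉ Lam c s M N)) := by
  obtain ⟨e1, e2, e3, e4⟩ := hσ
  have hr1 := hr.1.1.1
  have hr2 := hr.1.1.2
  obtain ⟨h0, -, -, -, -, -, hT⟩ := h
  rw [hn₂] at hT
  have hlam : σ.ra .fbar r - σ.ra .f r = delta c s m r := hT.sub_eq hr1 le_rfl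
  refine .cons (.iset (by simp) (.cons (.rset (by simp [hn₂]; omega) (.cons ?_))))
  refine Runs.mono (hR.dMax B c _ (by simpa [e1, e2] using hc) (by simpa [e2] using hB)) ?_
  rintro t₂ τ₂ ⟨ht₂, hF₂, hd⟩
  simp [hn₂, e1, e2, hlam] at ht₂ hd
  have k0 : τ₂.iv .r = r := (hF₂.iv_eq .r).trans hn₂
  have k1 : τ₂.iv .s = s := (hF₂.iv_eq .s).trans e1
  have k2 : τ₂.iv .N = N := (hF₂.iv_eq .N).trans e2
  have k3 : τ₂.iv .M = M := (hF₂.iv_eq .M).trans e3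
  have k4 : τ₂.iv .m = m := (hF₂.iv_eq .m).trans e4
  have k8 : τ₂.iv .hit = 0 := (hF₂.iv_eq .hit).trans h0
  have kl : τ₂.rv .lam = delta c s m r := hF₂.2.1.trans (by simp [hn₂, hlam])
  have hT₂ : Tables c s m r τ₂ := hT.congr (hF₂.ra_eq .f) (hF₂.ra_eq .fbar)
  have inp : IsInput s N M m τ₂ := ⟨k1, k2, k3, k4⟩
  refine .cons (.cond (by simp) (fun hb => .iset (by simp; omega) (.nil ?_))
    fun hb => .skip (.nil ?_))
  · simp [k3, hd] at hb
    refine ⟨by simp; omega, by simpa [IsInput] using inp,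
      .inl ⟨by simp, ⟨?_, ?_⟩, r, ⟨hr1, hr2⟩, by simp [kl]⟩⟩
    · simpa [kl] using (le_dMax_iff hc (by omega) hN).1 hb
    · simpa [kl] using hr.1.2
  · simp [k3, hd] at hb
    exact ⟨by simp; omega, inp, .inr ⟨k8, k0, hT₂, not_mem_Lam_of_dMax_lt hc hM hN hm hmM hr hb⟩⟩

theorem contractPhase_runs (hσ : IsInput s N M m σ) (h0 : σ.iv .hit = 0) (hr' : σ.iv .r = r)
    (hT : Tables c s m r σ) :
    Runs B c (contractPhase R) σ fun t σ' =>
      t ≤ 40000 * (N - s + 1) + 50 ∧ σ'.iv .hit = 0 ∧ σ'.iv .s = r - 1 ∧ σ'.iv .M = M - m ∧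
        ∀ j ∈ Set.Icc r N, σ'.ra .h j = contraction c s m r (r - 1) j := by
  obtain ⟨e1, e2, e3, e4⟩ := hσ
  have hr1 := hr.1.1.1
  have hr2 := hr.1.1.2
  refine .cons (.iset (by simp; omega) (.cons (.iset (by simp; omega) (.cons (.iset (by simp)
    (.cons (.iset (by simp) (.cons ?_))))))))
  refine Runs.mono (hR.rowMin_h B c _ (by simpa [e1, e2] using hc) (by simpa [e2] using hB)
    (by simp [e1]) (by simp [e1, e4, hr']; omega) (by simp [e2, hr']; omega)
    (by simp [e1, e4, hr']; omega) (by simp [e2, hr']; omega) (by simp [e2])) ?_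
  rintro t₂ τ₂ ⟨ht₂, hF₂, hmin⟩
  simp [e1, e2, e4, hr'] at ht₂
  have k0 : τ₂.iv .r = r := (hF₂.iv_eq .r).trans hr'
  have k3 : τ₂.iv .M = M := (hF₂.iv_eq .M).trans e3
  have k4 : τ₂.iv .m = m := (hF₂.iv_eq .m).trans e4
  have k8 : τ₂.iv .hit = 0 := (hF₂.iv_eq .hit).trans h0
  refine .cons (.iset (by simp; omega) (.cons (.iset (by simp) (.nil ⟨?_, by simp [k8],
    by simp [k0], by simp [k3, k4], fun j hj => ?_⟩))))
  · simp
    omega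
  · have := hmin j (by simpa [e2, hr'] using hj)
    simp [e1, e4, hr'] at this
    exact contraction_eq_of_isLeast hm hr hj.1 hT.1 this

end

end MongeProbe

/-! ### Assembly of the phases and of the constants -/

namespace MongeProbe

section
variable {B : ℕ} {c : ℕ → ℕ → ℝ} {σ : State} {R : Subroutines} {s N M m r : ℕ}

/-- With `k = Nat.log 2 (r - s - m)`, the searches cost at most `k + 1` and `k` linear terms, the
final test one and the contraction two; one more absorbs the overhead. -/
theorem probe_runs (hR : R.Correct 20000) (hc : IsMongeDAG s N c) (hM : 4 ≤ M)
    (hN : M + s + 1 ≤ N) (hm : 2 ≤ m) (hmM : m + 2 ≤ M) (hr : IsProbe c s N M m r)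
    (hB : 20000 * N ≤ B) (hσ : IsInput s N M m σ) :
    Runs B c (probe R) σ fun t σ' =>
      t ≤ 200000 * m * (r - s - m) +
        (20000 * (N - s + 1) + 200) * (2 * Nat.log 2 (r - s - m) + 5) ∧
      HitOrContract c s N M m r σ' := by
  obtain ⟨k, hk⟩ : ∃ k, k = Nat.log 2 (r - s - m) := ⟨_, rfl⟩
  have h2 : (20000 * (N - s + 1) + 200) * (2 * k + 5) =
      (20000 * (N - s + 1) + 200) * (k + 1) +
        ((20000 * (N - s + 1) + 100) * k + 100 * k + (80000 * (N - s + 1) + 800)) := by ring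
  rw [← hk, h2]
  refine .cons ((expSearch_runs hR hc hM hN hm hmM hr hB hσ).mono ?_)
  rw [← hk]
  rintro t₁ σ₁ ⟨ht₁, i₁, hn₁, h₁⟩
  refine .cons ((binSearch_runs hR hc hM hN hm hmM hr hB i₁ hn₁ h₁).mono ?_)
  rintro t₂ σ₂ ⟨ht₂, i₂, h₂⟩
  rcases h₂ with h₂ | ⟨hr₂, h₂⟩
  · refine .cons (.cond (by simp) (fun hb => ?_) fun _ => .skip (.cons (.cond (by simp)
      (fun hb => ?_) fun _ => .skip (.nil ⟨?_, .inl h₂⟩))))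
    · simp [h₂.1] at hb
    · simp [h₂.1] at hb
    · simp
      omega
  · refine .cons (.cond (by simp) (fun _ => ?_) fun hb => absurd (by simpa using h₂.1) hb)
    refine (finalTest_runs hR hc hM hN hm hmM hr hB i₂ hr₂ h₂).mono ?_
    rintro t₃ σ₃ ⟨ht₃, i₃, h₃ | ⟨h₃, hr₃, hT, hno⟩⟩
    · refine .cons (.cond (by simp) (fun hb => ?_) fun _ => .skip (.nil ⟨?_, .inl h₃⟩))
      · simp [h₃.1] at hb
      · simp
        omega
    · refine .cons (.cond (by simp) (fun _ => ?_) fun hb => absurd (by simpa using h₃) hb)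
      refine (contractPhase_runs hR hc hM hN hm hmM hr hB i₃ h₃ hr₃ hT).mono ?_
      rintro t₄ σ₄ ⟨ht₄, h₄, h₅⟩
      refine .nil ⟨?_, .inr ⟨h₄, hno, h₅⟩⟩
      simp
      omega

end

theorem Cmd.space_le (p : Cmd) (B : ℕ) : p.space B ≤ p.regions.card * (B + 1) :=
  Finset.sum_le_card_nsmul _ _ _ fun x _ => by cases x <;> simp [Region.cells]

end MongeProbe

theorem mainTheorem7 :
    ∃ (R : Subroutines) (K : ℕ), R.Correct K ∧
      ∃ C : ℝ, 0 < C ∧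
        ∀ (c : ℕ → ℕ → ℝ) (s N M m : ℕ), 1 ≤ s → IsMongeDAG s N c →
          4 ≤ M → M + s + 1 ≤ N → 2 ≤ m → m + 2 ≤ M →
          ∃ r, IsProbe c s N M m r ∧
            ∃ B : ℕ, ((probe R).space B : ℝ) ≤ C * N ∧
              ∀ σ : State, IsInput s N M m σ →
                ∃ (t : ℕ) (σ' : State), Exec B c (probe R) σ t σ' ∧
                  (t : ℝ) ≤ C * ((m : ℝ) * ((r : ℝ) - s - m + 1)
                    + ((N : ℝ) - s + 1) * Real.logb 2 ((r : ℝ) - s - m + 1)) ∧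
                  HitOrContract c s N M m r σ' := by
  -- The program is fixed, so its number of regions is a constant; each region has at most `20000 *
  -- N + 1 ≤ 20001 * N` cells.
  refine ⟨subroutines, 20000, subroutines_correct,
    200000 + 20001 * ((probe subroutines).regions.card : ℝ), by positivity, ?_⟩
  intro c s N M m _ hc hM hN hm hmM
  obtain ⟨r, hr⟩ := exists_isProbe hc (show 1 ≤ m by omega) (show m ≤ M by omega) hN
  refine ⟨r, hr, 20000 * N, ?_, fun σ hσ => ?_⟩
  · have h1 : (1 : ℝ) ≤ N := by exact_mod_cast (by omega : 1 ≤ N)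
    have h2 : ((probe subroutines).space (20000 * N) : ℝ) ≤
        (probe subroutines).regions.card * (20000 * N + 1) := by
      exact_mod_cast Cmd.space_le _ _
    refine h2.trans ?_
    nlinarith [(Nat.cast_nonneg _ : (0 : ℝ) ≤ (probe subroutines).regions.card)]
  · obtain ⟨t, σ', he, ht, h⟩ :=
      probe_runs subroutines_correct hc hM hN hm hmM hr le_rfl hσ
    refine ⟨t, σ', he, ?_, h⟩
    have hr1 := hr.1.1.1
    obtain ⟨D, rfl⟩ : ∃ D, r = s + m + D := ⟨r - (s + m), by omega⟩
    obtain ⟨W, rfl⟩ : ∃ W, N = s + W := ⟨N - s, by omega⟩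
    rw [show s + m + D - s - m = D by omega, show s + W - s + 1 = W + 1 by omega] at ht
    have hD : (1 : ℝ) ≤ D := by exact_mod_cast (by omega : 1 ≤ D)
    have hlog : (Nat.log 2 D : ℝ) ≤ Real.logb 2 (D + 1) :=
      (Real.natLog_le_logb D 2).trans (Real.logb_le_logb_of_le (by norm_num) (by linarith)
        (by linarith))
    -- As `D ≥ 1`, the logarithm is at least one and absorbs the constant number of additional
    -- linear terms: `2 * log + 5 ≤ 7 * log`.
    have hone : 1 ≤ Real.logb 2 ((D : ℝ) + 1) := by
      rw [Real.le_logb_iff_rpow_le (by norm_num) (by linarith)]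
      norm_num
      linarith
    have ht' : (t : ℝ) ≤ 200000 * m * D + (20000 * (W + 1) + 200) * (2 * Nat.log 2 D + 5) := by
      exact_mod_cast ht
    have e1 : ((s + m + D : ℕ) : ℝ) - s - m + 1 = D + 1 := by push_cast; ring
    have e2 : ((s + W : ℕ) : ℝ) - s + 1 = W + 1 := by push_cast; ring
    rw [e1, e2]
    have hW : (0 : ℝ) ≤ W := Nat.cast_nonneg _
    have hm0 : (0 : ℝ) ≤ m := Nat.cast_nonneg _
    have hlin : (20000 * ((W : ℝ) + 1) + 200) * (2 * Nat.log 2 D + 5) ≤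
        (20200 * (W + 1)) * (7 * Real.logb 2 (D + 1)) := by
      gcongr
      · linarith
      · linarith
    have hS : 0 ≤ (m : ℝ) * (D + 1) + (W + 1) * Real.logb 2 (D + 1) := by positivity
    have h3 : 0 ≤ (W + 1) * Real.logb 2 ((D : ℝ) + 1) := by positivity
    calc (t : ℝ) ≤ 200000 * ((m : ℝ) * (D + 1) + (W + 1) * Real.logb 2 (D + 1)) := by
          linarith
      _ ≤ _ := by
          gcongr
          linarith [(Nat.cast_nonneg _ : (0 : ℝ) ≤ (probe subroutines).regions.card)]
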